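/- **Definitions.** NP-hardness of distinguishing two classes of instances is meant under polynomial-time many-one reductions: for every language $L\in\mathsf{NP}$ there is a polynomial-time computable map sending members of $L$ to the first class and non-members to the second. For integers $z>y\ge 1$ and a real $\alpha$, the *$(\alpha,z,y)$-Johnson Coverage* problem is: given $n$, a non-empty collection $E\subseteq\binom{[n]}{z}$ and a number $k$, distinguish between (Completeness) there are $S_1,\dots,S_k\in\binom{[n]}{y}$ such that every $T\in E$ contains some $S_i$; and (Soundness) for all $S_1,\dots,S_k\in\binom{[n]}{y}$, at most $\alpha|E|$ members of $E$ contain some $S_i$. The *Johnson Coverage Hypothesis* (JCH) states that for every $\varepsilon>0$ there is $z\ge 2$ such that $(1-\frac1e+\varepsilon,\,z,\,z-1)$-Johnson Coverage is NP-hard. For real $p\ge 1$ and a bipartite graph $G$ with sides $A,B$, a map $\tau:A\sqcup B\to\mathbb R^d$ is a *$\lambda$-gap realization* of $G$ in $\ell_p$ if for some $\beta>0$ we have $\|\tau(u)-\tau(v)\|_p=\beta$ for every edge $(u,v)\in A\times B$ and $\|\tau(u)-\tau(v)\|_p\ge\lambda\beta$ for every non-edge $(u,v)\in A\times B$. The gap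 number $g_p(G)\in[1,\infty]$ is the supremum of the $\lambda\ge1$ for which $G$ has a $\lambda$-gap realization in some finite dimension. For $q\ge t\ge r$ let $J(q,t,r)$ be the bipartite inclusion graph between $\binom{[q]}{t}$ and $\binom{[q]}{r}$. For $\Delta\ge 1$ put $$\gamma_{p,\Delta}=\inf_{q\ge t\ge\Delta+1} g_p\bigl(J(q,t,t-\Delta)\bigr),\qquad \zeta_1(p,\Delta,\alpha)=1+(1-\alpha)(\gamma_{p,\Delta}-1),\qquad \zeta_1(p)=\zeta_1\bigl(p,1,1-\tfrac1e\bigr).$$ For real $p\ge1$ and $F$, say that *discrete $k$-median in $O(\log n)$-dimensional $\ell_p$ is NP-hard to approximate within $F$* if there are constants $A$ and $\rho>0$ and a polynomial $B$ such that, given a set $\mathcal P\subset\mathbb R^d$ of $n\ge 2$ points and a set $\mathcal C\subset\mathbb R^d$ of $m$ candidate centers, all with rational coordinates, with $d\le A\log n$ and $m\le B(n)$, and a number $k$, it is NP-hard to distinguish between: * Completeness: there are $\mathcal C'=\{c_1,\dots,c_k\}\subseteq\mathcal C$ and $\sigma:\mathcal P\to\mathcal C'$ with $\sum_{a\in\mathcal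 P}\|a-\sigma(a)\|_p\le\rho\,n(\log n)^{1/p}$; * Soundness: for all $\mathcal C'=\{c_1,\dots,c_k\}\subseteq\mathcal C$ and all $\sigma:\mathcal P\to\mathcal C'$, $\sum_{a\in\mathcal P}\|a-\sigma(a)\|_p\ge F\cdot\rho\,n(\log n)^{1/p}$. **Theorem.** (1) Let $p\ge1$ be real, let $z>y\ge1$ be integers and let $\alpha$ be real. If $(\alpha,z,y)$-Johnson Coverage is NP-hard, then for every $\varepsilon>0$, discrete $k$-median in $O(\log n)$-dimensional $\ell_p$ is NP-hard to approximate within $\zeta_1(p,z-y,\alpha)-\varepsilon$. (2) Assuming JCH, for every real $p\ge 1$ and every $\varepsilon>0$, discrete $k$-median in $O(\log n)$-dimensional $\ell_p$ is NP-hard to approximate within $\zeta_1(p)-\varepsilon$. In particular it is NP-hard to approximate within $1.73$ in $\ell_1$, and within every $F<1+\frac{\sqrt3-1}{e}\approx1.27$ in $\ell_2$. (3) Here $\zeta_1(1)=1+\frac2e>1.73$ and $\zeta_1(2)\ge1+\frac{\sqrt3-1}{e}>1.269$. -/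

import Mathlib

/-! ### Polynomial time, NP, and NP-hardness of promise problems -/

/-- `f` is computable in polynomial time by a (multi-stack) Turing machine, where inputs and outputs
are written as strings through `ea` and `eb`. -/
def PolyTime {I J Γ₁ Γ₂ : Type} (ea : I → List Γ₁) (eb : J → List Γ₂) (f : I → J) : Prop :=
  Nonempty (Turing.TM2ComputableInPolyTime ea eb f)

/-- The class NP, by polynomial-time verifiers with polynomially long certificates. The pair of the
input and the certificate is written as one string over the alphabet `Bool ⊕ Bool`. -/
def InNP (L : Set (List Bool)) : Prop :=
  ∃ (q : Polynomial ℕ) (V : List Bool × List Bool → Bool),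
    PolyTime
      (Computability.encodingProd
        (Computability.encodingList Bool) (Computability.encodingList Bool)).encode
      Computability.encodeBool V ∧
    ∀ x : List Bool, x ∈ L ↔ ∃ w : List Bool, w.length ≤ q.eval x.length ∧ V (x, w) = true

/-- It is NP-hard to distinguish the instances in `YES` from those in `NO`: every language in NP has
a polynomial-time many-one reduction that maps members to `YES` and non-members to `NO`. -/
def NPHardToDistinguish {I Γ : Type} (enc : I → List Γ) (YES NO : Set I) : Prop :=
  ∀ L : Set (List Bool), InNP L →
    ∃ f : List Bool → I,
      PolyTime (Computability.encodingList Bool).encode enc f ∧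
      (∀ x ∈ L, f x ∈ YES) ∧ (∀ x, x ∉ L → f x ∈ NO)

/-- A list of bit strings as one string, with `none` closing each block. -/
def encodeBlocks (bs : List (List Bool)) : List (Option Bool) :=
  bs.flatMap fun w => w.map some ++ [none]

theorem encodeBlocks_injective : Function.Injective encodeBlocks := by
  have aux : ∀ (v w : List Bool) (a b : List (Option Bool)),
      v.map some ++ none :: a = w.map some ++ none :: b → v = w ∧ a = b := by
    intro v
    induction v with
    | nil => intro w a b h; cases w <;> simp_all
    | cons c v ih =>
      intro w a b h
      cases w with
      | nil => simp at h
      | cons c' w =>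
        simp only [List.map_cons, List.cons_append, List.cons.injEq, Option.some.injEq] at h
        obtain ⟨h1, h2⟩ := ih w a b h.2
        exact ⟨by rw [h.1, h1], h2⟩
  intro s
  induction s with
  | nil => intro t h; cases t <;> simp_all [encodeBlocks]
  | cons v s ih =>
    intro t h
    cases t with
    | nil => simp [encodeBlocks] at h
    | cons w t =>
      simp only [encodeBlocks, List.flatMap_cons, List.append_assoc, List.singleton_append] at h
      obtain ⟨h1, h2⟩ := aux v w _ _ h
      rw [h1, ih h2]

theorem encodeNat_injective : Function.Injective Computability.encodeNat :=
  Computability.encodingNatBool.encode_injective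

/-! ### The Johnson Coverage problem -/

/-- An instance of Johnson Coverage: a universe `[n]`, a non-empty collection `E` of `z`-element
subsets of `[n]` (listed without repetition), and a number `k`. -/
structure JCInstance (z : ℕ) where
  n : ℕ
  k : ℕ
  edges : List (Finset (Fin n))
  nodup : edges.Nodup
  nonempty : edges ≠ []
  uniform : ∀ T ∈ edges, T.card = z

namespace JCInstance

/-- The collection `E` as a finite set. -/
def E {z : ℕ} (I : JCInstance z) : Finset (Finset (Fin I.n)) := ⟨I.edges, I.nodup⟩

/-- The string of an instance: `k` in binary, then one characteristic vector in `{0,1}^n` for each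
member of `E`. -/
def encode {z : ℕ} (I : JCInstance z) : List (Option Bool) :=
  encodeBlocks
    (Computability.encodeNat I.k :: I.edges.map fun T => List.ofFn fun i => decide (i ∈ T))

theorem encode_injective {z : ℕ} : Function.Injective (encode (z := z)) := by
  rintro ⟨n, k, e, h1, h2, h3⟩ ⟨n', k', e', h1', h2', h3'⟩ h
  have h := encodeBlocks_injective h
  simp only [List.cons.injEq] at h
  obtain ⟨hk, he⟩ := h
  obtain rfl := encodeNat_injective hk
  have hn : n = n' := by
    cases e with
    | nil => exact absurd rfl h2
    | cons T e =>
      cases e' with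
      | nil => exact absurd rfl h2'
      | cons T' e' =>
        simp only [List.map_cons, List.cons.injEq] at he
        simpa using congrArg List.length he.1
  subst hn
  have : Function.Injective fun T : Finset (Fin n) => List.ofFn fun i => decide (i ∈ T) := by
    intro S T hST
    have := List.ofFn_injective hST
    ext i
    simpa using congrFun this i
  obtain rfl := List.map_injective_iff.2 this he
  rfl

end JCInstance

/-- `cov(S, E)`: the members of `E` that contain `S`. -/
def cov {n : ℕ} (S : Finset (Fin n)) (E : Finset (Finset (Fin n))) : Finset (Finset (Fin n)) :=
  E.filter fun T => S ⊆ T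

/-- `cov(S_1, E) ∪ ⋯ ∪ cov(S_k, E)`. -/
def covAll {n k : ℕ} (S : Fin k → Finset (Fin n)) (E : Finset (Finset (Fin n))) :
    Finset (Finset (Fin n)) :=
  Finset.univ.biUnion fun i => cov (S i) E

/-- Completeness: some `k` subsets of size `y` cover all of `E`. -/
def JCYes (z y : ℕ) : Set (JCInstance z) :=
  {I | ∃ S : Fin I.k → Finset (Fin I.n), (∀ i, (S i).card = y) ∧ covAll S I.E = I.E}

/-- Soundness: any `k` subsets of size `y` cover at most an `α` fraction of `E`. -/
def JCNo (α : ℝ) (z y : ℕ) : Set (JCInstance z) :=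
  {I | ∀ S : Fin I.k → Finset (Fin I.n), (∀ i, (S i).card = y) →
    ((covAll S I.E).card : ℝ) ≤ α * (I.E.card : ℝ)}

/-- The `(α, z, y)`-Johnson Coverage problem is NP-hard. -/
def JohnsonCoverageNPHard (α : ℝ) (z y : ℕ) : Prop :=
  NPHardToDistinguish (JCInstance.encode (z := z)) (JCYes z y) (JCNo α z y)

/-- The Johnson Coverage Hypothesis. -/
def JohnsonCoverageHypothesis : Prop :=
  ∀ ε : ℝ, 0 < ε → ∃ z : ℕ, 2 ≤ z ∧
    JohnsonCoverageNPHard (1 - 1 / Real.exp 1 + ε) z (z - 1)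

/-! ### Gap realizations and the constants `γ` and `ζ₁` -/

/-- The `ℓ_p` distance on `ℝ^d`. -/
noncomputable def lpDist (p : ℝ) {d : ℕ} (a b : Fin d → ℝ) : ℝ :=
  (∑ i, |a i - b i| ^ p) ^ (1 / p)

/-- The bipartite graph with sides `A`, `B` and adjacency `Adj` has a `lam`-gap realization in some
finite-dimensional `ℓ_p` space. -/
def GapRealizable (p : ℝ) {A B : Type} (Adj : A → B → Prop) (lam : ℝ) : Prop :=
  ∃ (d : ℕ) (τA : A → Fin d → ℝ) (τB : B → Fin d → ℝ) (β : ℝ), 0 < β ∧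
    (∀ u v, Adj u v → lpDist p (τA u) (τB v) = β) ∧
    (∀ u v, ¬ Adj u v → lam * β ≤ lpDist p (τA u) (τB v))

/-- The gap number: the supremum of all `lam ≥ 1` for which the graph has a `lam`-gap realization.
It is `∞` for complete bipartite graphs, hence the extended values. -/
noncomputable def gapNumber (p : ℝ) {A B : Type} (Adj : A → B → Prop) : ENNReal :=
  ⨆ lam ∈ {lam : ℝ | 1 ≤ lam ∧ GapRealizable p Adj lam}, ENNReal.ofReal lam

/-- The adjacency of `J(q, t, r)`, between the `t`-subsets and the `r`-subsets of `[q]`. -/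
def johnsonAdj (q t r : ℕ) (T : {T : Finset (Fin q) // T.card = t})
    (S : {S : Finset (Fin q) // S.card = r}) : Prop :=
  S.1 ⊆ T.1

/-- `γ_{p,Δ}`, the infimum of the gap numbers of `J(q, t, t - Δ)` over all `q ≥ t ≥ Δ + 1`. -/
noncomputable def gammaGap (p : ℝ) (Δ : ℕ) : ℝ :=
  (⨅ (q : ℕ) (t : ℕ) (_ : Δ + 1 ≤ t ∧ t ≤ q), gapNumber p (johnsonAdj q t (t - Δ))).toReal

/-- `ζ₁(p, Δ, α)`. -/
noncomputable def zetaOne (p : ℝ) (Δ : ℕ) (α : ℝ) : ℝ :=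
  1 + (1 - α) * (gammaGap p Δ - 1)

/-! ### Discrete k-median -/

/-- An instance of discrete k-median: a finite set of points and a finite set of candidate centers
in `ℝ^d` with rational coordinates (listed without repetition), and a number `k`. -/
structure KMedianInstance where
  d : ℕ
  k : ℕ
  points : List (Fin d → ℚ)
  centers : List (Fin d → ℚ)
  points_nodup : points.Nodup
  centers_nodup : centers.Nodup

/-- A rational number as two blocks: sign and absolute value of the numerator, and the
denominator, all in binary. -/
def encodeRat (r : ℚ) : List (List Bool) :=
  [decide (r.num < 0) :: Computability.encodeNat r.num.natAbs, Computability.encodeNat r.den]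

theorem encodeRat_injective : Function.Injective encodeRat := by
  intro r s h
  simp only [encodeRat, List.cons.injEq, decide_eq_decide, and_true] at h
  have h1 := encodeNat_injective h.1.2
  have h2 := encodeNat_injective h.2
  refine Rat.ext ?_ h2
  have h0 := h.1.1
  omega

namespace KMedianInstance

/-- The point-set `P`. -/
def P (I : KMedianInstance) : Finset (Fin I.d → ℚ) := ⟨I.points, I.points_nodup⟩

/-- The set `C` of candidate centers. -/
def C (I : KMedianInstance) : Finset (Fin I.d → ℚ) := ⟨I.centers, I.centers_nodup⟩

/-- The string of an instance: the dimension, the numbers of points and of centers, and `k`, in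
binary, then all coordinates of all points and centers. -/
def encode (I : KMedianInstance) : List (Option Bool) :=
  encodeBlocks
    ([Computability.encodeNat I.d, Computability.encodeNat I.points.length,
      Computability.encodeNat I.centers.length, Computability.encodeNat I.k] ++
    (I.points ++ I.centers).flatMap fun v => (List.ofFn v).flatMap encodeRat)

theorem encode_injective : Function.Injective encode := by
  rintro ⟨d, k, a, c, h1, h2⟩ ⟨d', k', a', c', h1', h2'⟩ h
  have h := encodeBlocks_injective h
  simp only [List.cons_append, List.nil_append, List.cons.injEq] at h
  obtain ⟨hd, ha, hc, hk, h⟩ := h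
  obtain rfl := encodeNat_injective hd
  obtain rfl := encodeNat_injective hk
  have ha := encodeNat_injective ha
  -- equal-length flattening is injective
  have flat : ∀ {X Y : Type} (f : X → List Y) (m : ℕ), (∀ x, (f x).length = m) →
      Function.Injective f → ∀ l l' : List X, l.length = l'.length →
      l.flatMap f = l'.flatMap f → l = l' := by
    intro X Y f m hm hf l
    induction l with
    | nil => intro l' hl _; exact (List.length_eq_zero_iff.1 hl.symm).symm
    | cons x l ih =>
      intro l' hl h
      cases l' with
      | nil => simp at hl
      | cons x' l' =>
        simp only [List.flatMap_cons] at h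
        obtain ⟨e1, e2⟩ := List.append_inj h (by rw [hm, hm])
        rw [hf e1, ih l' (by simpa using hl) e2]
  have hlen : (a ++ c).length = (a' ++ c').length := by
    rw [List.length_append, List.length_append, ha, encodeNat_injective hc]
  have key := flat (fun v : Fin d → ℚ => (List.ofFn v).flatMap encodeRat) (d * 2)
    (by intro v; simp [List.length_flatMap, encodeRat, Function.comp_def])
    (by
      intro v w hvw
      exact List.ofFn_injective
        (flat encodeRat 2 (by intro r; simp [encodeRat]) encodeRat_injective _ _ (by simp) hvw))
    _ _ hlen h
  obtain ⟨rfl, rfl⟩ := List.append_inj key ha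
  rfl

end KMedianInstance

/-- `C' = {c 1, …, c k} ⊆ C` is a choice of candidate centers and `σ` maps every point into `C'`. -/
def IsClustering (I : KMedianInstance) (c : Fin I.k → Fin I.d → ℚ)
    (σ : (Fin I.d → ℚ) → (Fin I.d → ℚ)) : Prop :=
  (∀ j, c j ∈ I.C) ∧ ∀ a ∈ I.P, σ a ∈ Set.range c

/-- The sum over all points `a` of the `ℓ_p` distance from `a` to `σ a`. -/
noncomputable def kMedianCost (p : ℝ) (I : KMedianInstance)
    (σ : (Fin I.d → ℚ) → (Fin I.d → ℚ)) : ℝ :=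
  ∑ a ∈ I.P, lpDist p (fun i => (a i : ℝ)) (fun i => (σ a i : ℝ))

/-- With `n` the number of points (at least two, so that `log n > 0`): the dimension is at most
`A log n` and the number of candidate centers is at most `B(n)`. -/
def KMedianInstance.Bounded (I : KMedianInstance) (A : ℝ) (B : Polynomial ℕ) : Prop :=
  2 ≤ I.P.card ∧ (I.d : ℝ) ≤ A * Real.log I.P.card ∧ I.C.card ≤ B.eval I.P.card

/-- Completeness: some clustering costs at most `ρ n (log n)^(1/p)`. -/
def KMedianYes (p A : ℝ) (B : Polynomial ℕ) (ρ : ℝ) : Set KMedianInstance :=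
  {I | I.Bounded A B ∧ ∃ c σ, IsClustering I c σ ∧
    kMedianCost p I σ ≤ ρ * I.P.card * Real.log I.P.card ^ (1 / p)}

/-- Soundness: every clustering costs at least `F · ρ n (log n)^(1/p)`. -/
def KMedianNo (p A : ℝ) (B : Polynomial ℕ) (ρ F : ℝ) : Set KMedianInstance :=
  {I | I.Bounded A B ∧ ∀ c σ, IsClustering I c σ →
    F * (ρ * I.P.card * Real.log I.P.card ^ (1 / p)) ≤ kMedianCost p I σ}

/-- Discrete k-median in `O(log n)`-dimensional `ℓ_p` space with `poly(n)` candidate centers is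
NP-hard to approximate within the factor `F`. -/
def KMedianNPHardWithin (p F : ℝ) : Prop :=
  ∃ (A : ℝ) (B : Polynomial ℕ) (ρ : ℝ), 0 < ρ ∧
    NPHardToDistinguish KMedianInstance.encode (KMedianYes p A B ρ) (KMedianNo p A B ρ F)

/-! ### Structured programs on stacks and their compilation to `TM2` machines -/

namespace StackProg

open Turing

/-! Every uncovered edge should pay the gap of a Johnson graph. A `lam`-gap realization of
$J(q,z,y)$ for a constant $q$ places $z$-sets and $y$-sets so that included pairs lie at distance
$\beta$ and all others at distance at least $\lambda\beta$. A Coverage instance, however, has an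
unbounded universe $[n]$, so the realization is applied to colors. A code over $4^D$ symbols, whose
words have length $l\approx\log_2 N$ for $N$ points and pairwise agree in less than a fraction $1/D$
of the positions, colors $[n]$ with $4^D$ colors at each position. An edge $T$ becomes the
concatenation over all positions of the vectors of its color sets, and a candidate center is made in
the same way from a set $S$; the dimension is a constant times $l$, and $p$-th powers of distances
add up over the positions.

Colorings may merge elements, so color sets are padded with $z$ new colors to the sizes $z$ and $y$.
If $S\subseteq T$, the padded sets are included at every position (`padSet_image_subset`), so the
distance is about $(lb)^{1/p}$, where $b=\beta^p$. Otherwise the coloring is injective on $S\cup T$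
at all but a fraction $O(z^2/D)$ of the positions, and there inclusion fails
(`subset_of_padSet_image_subset`), so the distance is about $\lambda(lb)^{1/p}$ or more. In the
soundness case at least a $1-\alpha$ fraction of the edges is far from all chosen centers, whence
the factor $1+(1-\alpha)(\lambda-1)$ (`exists_clustering`, `le_kMedianCost`). Rational
approximations of the vectors cost only an arbitrarily small relative error.

Each edge is repeated $nK$ times, the copies being told apart by code words that hardly move the
vectors. This makes $n^y$ polynomial in $N$, and a large constant $K$ makes $l\log 2$ and $\log N$
agree up to a factor $1+e$. `kMedianNPHardWithin_of_gapRealizable` collects these estimates.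

That the reduction runs in polynomial time is proved on actual machines. Structured stack programs
are compiled to `TM2` machines (`Run.reach`); the functions `PF` computed by such programs on binary
trees are closed under the usual list operations, so the reduction is one of them
(`PF.reduceString`); and `polyTime_comp` appends such a program to an arbitrary polynomial-time
machine. The greedy code is computable in this way because there are only polynomially many words of
logarithmic length.

For the constants, a path of length three gives $\gamma_{p,\Delta}\le3$, and indicator vectors give
gap $3^{1/p}$ when $\Delta=1$. -/

/-- Structured programs acting on a family of stacks. -/
inductive Prog {K : Type} (Γ : K → Type) : Type
  | skip : Prog Γ
  | push (k : K) (a : Γ k) : Prog Γ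
  | pop (k : K) : Prog Γ
  | seq (P Q : Prog Γ) : Prog Γ
  | ite (k : K) (test : Option (Γ k) → Bool) (P Q : Prog Γ) : Prog Γ
  | loop (k : K) (test : Option (Γ k) → Bool) (P : Prog Γ) : Prog Γ

section Semantics

variable {K : Type} [DecidableEq K] {Γ : K → Type}

/-- `Run P S S' n`: the program `P` turns the stacks `S` into `S'` in `n` steps. -/
inductive Run : Prog Γ → (∀ k, List (Γ k)) → (∀ k, List (Γ k)) → ℕ → Prop
  | skip (S) : Run .skip S S 1
  | push (k a S) : Run (.push k a) S (Function.update S k (a :: S k)) 1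
  | pop (k S) : Run (.pop k) S (Function.update S k (S k).tail) 1
  | seq {P Q S S' S'' n m} : Run P S S' n → Run Q S' S'' m → Run (.seq P Q) S S'' (n + m)
  | ite_true {k t P Q S S' n} : t (S k).head? = true → Run P S S' n →
      Run (.ite k t P Q) S S' (n + 1)
  | ite_false {k t P Q S S' n} : t (S k).head? = false → Run Q S S' n →
      Run (.ite k t P Q) S S' (n + 1)
  | loop_false {k t P S} : t (S k).head? = false → Run (.loop k t P) S S 1
  | loop_true {k t P S S' S'' n m} : t (S k).head? = true → Run P S S' n →
      Run (.loop k t P) S' S'' m → Run (.loop k t P) S S'' (n + m + 1)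

theorem Run.cast {P : Prog Γ} {S S' T T' : ∀ k, List (Γ k)} {n : ℕ} (h : Run P S S' n)
    (e : S = T) (e' : S' = T') : Run P T T' n := by
  subst e e'; exact h

end Semantics

/-- The labels of the compiled program. -/
def Lbl {K : Type} {Γ : K → Type} : Prog Γ → Type
  | .skip => Unit
  | .push _ _ => Unit
  | .pop _ => Unit
  | .seq P Q => Lbl P ⊕ Lbl Q
  | .ite _ _ P Q => Option (Lbl P ⊕ Lbl Q)
  | .loop _ _ P => Option (Lbl P)

instance Lbl.finite {K : Type} {Γ : K → Type} : (P : Prog Γ) → Finite (Lbl P)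
  | .skip => inferInstanceAs (Finite Unit)
  | .push _ _ => inferInstanceAs (Finite Unit)
  | .pop _ => inferInstanceAs (Finite Unit)
  | .seq P Q =>
    have := Lbl.finite P; have := Lbl.finite Q; inferInstanceAs (Finite (Lbl P ⊕ Lbl Q))
  | .ite _ _ P Q =>
    have := Lbl.finite P; have := Lbl.finite Q; inferInstanceAs (Finite (Option (Lbl P ⊕ Lbl Q)))
  | .loop _ _ P => have := Lbl.finite P; inferInstanceAs (Finite (Option (Lbl P)))

/-- The label at which the compiled program starts. -/
def start {K : Type} {Γ : K → Type} : (P : Prog Γ) → Lbl P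
  | .skip => ()
  | .push _ _ => ()
  | .pop _ => ()
  | .seq P _ => Sum.inl (start P)
  | .ite _ _ _ _ => none
  | .loop _ _ _ => none

/-- The compiled program, whose labels are embedded into `Λ` and which leaves to `next`. Tests are
stored in the second component of the internal state. -/
def code {K : Type} {Γ : K → Type} {Λ σ : Type} :
    (P : Prog Γ) → (Lbl P → Λ) → Λ → Lbl P → TM2.Stmt Γ Λ (σ × Bool)
  | .skip, _, next, _ => .goto fun _ => next
  | .push k a, _, next, _ => .push k (fun _ => a) (.goto fun _ => next)
  | .pop k, _, next, _ => .pop k (fun v _ => v) (.goto fun _ => next)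
  | .seq P Q, emb, next, l =>
    Sum.elim (code P (fun l => emb (Sum.inl l)) (emb (Sum.inr (start Q))))
      (code Q (fun l => emb (Sum.inr l)) next) l
  | .ite k t P Q, emb, next, l =>
    Option.elim l
      (.peek k (fun v o => (v.1, t o)) (.branch (fun v => v.2)
        (.goto fun _ => emb (some (Sum.inl (start P))))
        (.goto fun _ => emb (some (Sum.inr (start Q))))))
      (Sum.elim (code P (fun l => emb (some (Sum.inl l))) next)
        (code Q (fun l => emb (some (Sum.inr l))) next))
  | .loop k t P, emb, next, l =>
    Option.elim l
      (.peek k (fun v o => (v.1, t o)) (.branch (fun v => v.2)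
        (.goto fun _ => emb (some (start P))) (.goto fun _ => next)))
      (code P (fun l => emb (some l)) (emb none))

/-! ### Correctness of the compilation -/

section Reach

variable {K : Type} [DecidableEq K] {Γ : K → Type} {Λ σ : Type}

/-- The machine `M` goes from `c` to `c'` in exactly `n` steps. -/
def Reach (M : Λ → TM2.Stmt Γ Λ σ) (n : ℕ) (c c' : TM2.Cfg Γ Λ σ) : Prop :=
  (flip bind (TM2.step M))^[n] (some c) = some c'

theorem Reach.trans {M : Λ → TM2.Stmt Γ Λ σ} {n m : ℕ} {c c' c'' : TM2.Cfg Γ Λ σ}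
    (h : Reach M n c c') (h' : Reach M m c' c'') : Reach M (n + m) c c'' := by
  unfold Reach at *
  rw [Nat.add_comm, Function.iterate_add_apply, h, h']

theorem Reach.single {M : Λ → TM2.Stmt Γ Λ σ} {c c' : TM2.Cfg Γ Λ σ}
    (h : TM2.step M c = some c') : Reach M 1 c c' := h

/-- Each rule of `Run` costs exactly as many steps as the compiled code takes. Only the stored test
result in the state may change, hence the existential over `b`. Code and entry labels are related
through `emb`, so that the induction can pass to subprograms. -/
theorem Run.reach {P : Prog Γ} {S S' : ∀ k, List (Γ k)} {n : ℕ} (h : Run P S S' n)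
    (M : Λ → TM2.Stmt Γ Λ (σ × Bool)) (emb : Lbl P → Λ) (next : Λ)
    (hM : ∀ l, M (emb l) = code P emb next l) (v : σ × Bool) :
    ∃ b, Reach M n ⟨some (emb (start P)), v, S⟩ ⟨some next, (v.1, b), S'⟩ := by
  induction h generalizing next v with
  | skip S => exact ⟨v.2, Reach.single (by simp [TM2.step, hM, code])⟩
  | push k a S => exact ⟨v.2, Reach.single (by simp [TM2.step, hM, code])⟩
  | pop k S => exact ⟨v.2, Reach.single (by simp [TM2.step, hM, code])⟩
  | @seq P Q _ _ _ _ _ _ _ ih1 ih2 =>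
    obtain ⟨b, h1⟩ := ih1 (fun l => emb (Sum.inl l)) (emb (Sum.inr (start Q)))
      (fun l => hM (Sum.inl l)) v
    obtain ⟨b', h2⟩ := ih2 (fun l => emb (Sum.inr l)) next (fun l => hM (Sum.inr l)) (v.1, b)
    exact ⟨b', h1.trans h2⟩
  | @ite_true k t P Q S _ n ht _ ih =>
    obtain ⟨b, h1⟩ := ih (fun l => emb (some (Sum.inl l))) next
      (fun l => hM (some (Sum.inl l))) (v.1, true)
    refine ⟨b, Nat.add_comm n 1 ▸ Reach.trans (Reach.single ?_) h1⟩
    have := hM none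
    simp only [code, Option.elim] at this
    simp [TM2.step, start, this, ht]
  | @ite_false k t P Q S _ n ht _ ih =>
    obtain ⟨b, h1⟩ := ih (fun l => emb (some (Sum.inr l))) next
      (fun l => hM (some (Sum.inr l))) (v.1, false)
    refine ⟨b, Nat.add_comm n 1 ▸ Reach.trans (Reach.single ?_) h1⟩
    have := hM none
    simp only [code, Option.elim] at this
    simp [TM2.step, start, this, ht]
  | @loop_false k t P S ht =>
    refine ⟨false, Reach.single ?_⟩
    have := hM none
    simp only [code, Option.elim] at this
    simp [TM2.step, start, this, ht]
  | @loop_true k t P S _ _ n m ht _ _ ih1 ih2 =>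
    obtain ⟨b, h1⟩ := ih1 (fun l => emb (some l)) (emb none) (fun l => hM (some l)) (v.1, true)
    obtain ⟨b', h2⟩ := ih2 emb next hM (v.1, b)
    refine ⟨b', Nat.add_comm (n + m) 1 ▸ Reach.trans (Reach.single ?_) (h1.trans h2)⟩
    have := hM none
    simp only [code, Option.elim] at this
    simp [TM2.step, start, this, ht]

end Reach

/-! ### Programs on part of the stacks -/

section Lift

variable {X W : Type} [DecidableEq X] [DecidableEq W] {ΓX : X → Type} {ΓW : W → Type}

/-- The same program on the second part of a larger family of stacks. -/
def Prog.lift (ΓX : X → Type) : Prog ΓW → Prog (Sum.elim ΓX ΓW)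
  | .skip => .skip
  | .push k a => .push (Sum.inr k) a
  | .pop k => .pop (Sum.inr k)
  | .seq P Q => .seq (P.lift ΓX) (Q.lift ΓX)
  | .ite k t P Q => .ite (Sum.inr k) t (P.lift ΓX) (Q.lift ΓX)
  | .loop k t P => .loop (Sum.inr k) t (P.lift ΓX)

/-- Two families of stacks side by side. -/
def stkSum (R : ∀ x, List (ΓX x)) (S : ∀ w, List (ΓW w)) : ∀ k, List (Sum.elim ΓX ΓW k)
  | Sum.inl x => R x
  | Sum.inr w => S w

theorem stkSum_update_inr (R : ∀ x, List (ΓX x)) (S : ∀ w, List (ΓW w)) (w : W)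
    (l : List (ΓW w)) :
    Function.update (stkSum R S) (Sum.inr w) l = stkSum R (Function.update S w l) := by
  funext k
  rcases k with x | w'
  · exact Function.update_of_ne (by simp) _ _
  · by_cases h : w' = w
    · subst h
      exact (Function.update_self _ _ _).trans (Function.update_self w' l S).symm
    · have e := Function.update_of_ne h l S
      exact (Function.update_of_ne (by simpa using h) _ _).trans e.symm

theorem stkSum_update_inl (R : ∀ x, List (ΓX x)) (S : ∀ w, List (ΓW w)) (x : X)
    (l : List (ΓX x)) :
    Function.update (stkSum R S) (Sum.inl x) l = stkSum (Function.update R x l) S := by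
  funext k
  rcases k with x' | w'
  · by_cases h : x' = x
    · subst h
      exact (Function.update_self _ _ _).trans (Function.update_self x' l R).symm
    · have e := Function.update_of_ne h l R
      exact (Function.update_of_ne (by simpa using h) _ _).trans e.symm
  · exact Function.update_of_ne (by simp) _ _

theorem Run.lift {P : Prog ΓW} {S S' : ∀ w, List (ΓW w)} {n : ℕ} (h : Run P S S' n)
    (R : ∀ x, List (ΓX x)) : Run (P.lift ΓX) (stkSum R S) (stkSum R S') n := by
  induction h with
  | skip S => exact .skip _
  | push k a S =>
    exact (Run.push (Γ := Sum.elim ΓX ΓW) (Sum.inr k) a (stkSum R S)).cast rfl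
      (stkSum_update_inr R S k _)
  | pop k S =>
    exact (Run.pop (Γ := Sum.elim ΓX ΓW) (Sum.inr k) (stkSum R S)).cast rfl
      (stkSum_update_inr R S k _)
  | seq _ _ ih1 ih2 => exact .seq ih1 ih2
  | ite_true ht _ ih => exact .ite_true ht ih
  | ite_false ht _ ih => exact .ite_false ht ih
  | loop_false ht => exact .loop_false (Γ := Sum.elim ΓX ΓW) (k := Sum.inr _) ht
  | loop_true ht _ _ ih1 ih2 => exact .loop_true (k := Sum.inr _) ht ih1 ih2

end Lift

end StackProg

/-! ### Binary trees as data, and programs manipulating them on four stacks -/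

/-- Binary trees, the universal data type of the polynomial-time functions below. -/
inductive Dat : Type
  | nil : Dat
  | cons (a b : Dat) : Dat

namespace Dat

/-- Number of nodes. -/
def size : Dat → ℕ
  | nil => 1
  | cons a b => 1 + a.size + b.size

/-- Prefix notation; `some true` is a binary node, `some false` a leaf. -/
def enc : Dat → List (Option Bool)
  | nil => [some false]
  | cons a b => some true :: (a.enc ++ b.enc)

theorem size_pos (t : Dat) : 0 < t.size := by
  cases t <;> simp only [size] <;> omega

theorem length_enc (t : Dat) : t.enc.length = t.size := by
  induction t with
  | nil => rfl
  | cons a b iha ihb => simp [enc, size, iha, ihb]; omega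

theorem none_notMem_enc (t : Dat) : none ∉ t.enc := by
  induction t with
  | nil => simp [enc]
  | cons a b iha ihb => simp [enc, iha, ihb]

end Dat

namespace StackProg

/-! ### Upper bounds for running times -/

section RunLe

variable {K : Type} [DecidableEq K] {Γ : K → Type}

/-- The program `P` turns `S` into `S'` in at most `N` steps. -/
def RunLe (P : Prog Γ) (S S' : ∀ k, List (Γ k)) (N : ℕ) : Prop := ∃ n ≤ N, Run P S S' n

theorem RunLe.mono {P : Prog Γ} {S S' : ∀ k, List (Γ k)} {N N' : ℕ} (h : RunLe P S S' N)
    (hN : N ≤ N') : RunLe P S S' N' := by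
  obtain ⟨n, hn, h⟩ := h
  exact ⟨n, hn.trans hN, h⟩

theorem RunLe.seq {P Q : Prog Γ} {S S' S'' : ∀ k, List (Γ k)} {N N' : ℕ}
    (h : RunLe P S S' N) (h' : RunLe Q S' S'' N') : RunLe (.seq P Q) S S'' (N + N') := by
  obtain ⟨n, hn, h⟩ := h
  obtain ⟨n', hn', h'⟩ := h'
  exact ⟨_, Nat.add_le_add hn hn', .seq h h'⟩

theorem RunLe.skip (S : ∀ k, List (Γ k)) : RunLe .skip S S 1 := ⟨1, le_rfl, .skip S⟩

theorem RunLe.ite_true {k : K} {t : Option (Γ k) → Bool} {P Q : Prog Γ}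
    {S S' : ∀ k, List (Γ k)} {N : ℕ} (ht : t (S k).head? = true) (h : RunLe P S S' N) :
    RunLe (.ite k t P Q) S S' (N + 1) := by
  obtain ⟨n, hn, h⟩ := h
  exact ⟨_, Nat.add_le_add_right hn 1, .ite_true ht h⟩

theorem RunLe.ite_false {k : K} {t : Option (Γ k) → Bool} {P Q : Prog Γ}
    {S S' : ∀ k, List (Γ k)} {N : ℕ} (ht : t (S k).head? = false) (h : RunLe Q S S' N) :
    RunLe (.ite k t P Q) S S' (N + 1) := by
  obtain ⟨n, hn, h⟩ := h
  exact ⟨_, Nat.add_le_add_right hn 1, .ite_false ht h⟩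

theorem RunLe.loop_false {k : K} {t : Option (Γ k) → Bool} {P : Prog Γ}
    {S : ∀ k, List (Γ k)} (ht : t (S k).head? = false) : RunLe (.loop k t P) S S 1 :=
  ⟨_, le_rfl, .loop_false ht⟩

theorem RunLe.loop_true {k : K} {t : Option (Γ k) → Bool} {P : Prog Γ}
    {S S' S'' : ∀ k, List (Γ k)} {N N' : ℕ} (ht : t (S k).head? = true) (h : RunLe P S S' N)
    (h' : RunLe (.loop k t P) S' S'' N') : RunLe (.loop k t P) S S'' (N + N' + 1) := by
  obtain ⟨n, hn, h⟩ := h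
  obtain ⟨n', hn', h'⟩ := h'
  exact ⟨_, by omega, .loop_true ht h h'⟩

end RunLe

/-- Programs on four work stacks over the alphabet of `Dat.enc` with the separator `none`. -/
abbrev WProg : Type := Prog (K := Fin 4) fun _ => Option Bool

/-- The four work stacks: the main stack, two auxiliary stacks, and a counter. -/
def st (m a b c : List (Option Bool)) : ∀ _ : Fin 4, List (Option Bool) := ![m, a, b, c]

section Basic

variable (x : Option Bool) (m a b c : List (Option Bool))

theorem RunLe.push0 : RunLe (.push 0 x : WProg) (st m a b c) (st (x :: m) a b c) 1 :=
  ⟨1, le_rfl, (Run.push (Γ := fun _ : Fin 4 => Option Bool) 0 x (st m a b c)).cast rfl (by funext k; fin_cases k <;> rfl)⟩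
theorem RunLe.push1 : RunLe (.push 1 x : WProg) (st m a b c) (st m (x :: a) b c) 1 :=
  ⟨1, le_rfl, (Run.push (Γ := fun _ : Fin 4 => Option Bool) 1 x (st m a b c)).cast rfl (by funext k; fin_cases k <;> rfl)⟩
theorem RunLe.push2 : RunLe (.push 2 x : WProg) (st m a b c) (st m a (x :: b) c) 1 :=
  ⟨1, le_rfl, (Run.push (Γ := fun _ : Fin 4 => Option Bool) 2 x (st m a b c)).cast rfl (by funext k; fin_cases k <;> rfl)⟩
theorem RunLe.push3 : RunLe (.push 3 x : WProg) (st m a b c) (st m a b (x :: c)) 1 :=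
  ⟨1, le_rfl, (Run.push (Γ := fun _ : Fin 4 => Option Bool) 3 x (st m a b c)).cast rfl (by funext k; fin_cases k <;> rfl)⟩
theorem RunLe.pop0 : RunLe (.pop 0 : WProg) (st (x :: m) a b c) (st m a b c) 1 :=
  ⟨1, le_rfl, (Run.pop (Γ := fun _ : Fin 4 => Option Bool) 0 _).cast rfl (by funext k; fin_cases k <;> rfl)⟩
theorem RunLe.pop1 : RunLe (.pop 1 : WProg) (st m (x :: a) b c) (st m a b c) 1 :=
  ⟨1, le_rfl, (Run.pop (Γ := fun _ : Fin 4 => Option Bool) 1 _).cast rfl (by funext k; fin_cases k <;> rfl)⟩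
theorem RunLe.pop2 : RunLe (.pop 2 : WProg) (st m a (x :: b) c) (st m a b c) 1 :=
  ⟨1, le_rfl, (Run.pop (Γ := fun _ : Fin 4 => Option Bool) 2 _).cast rfl (by funext k; fin_cases k <;> rfl)⟩
theorem RunLe.pop3 : RunLe (.pop 3 : WProg) (st m a b (x :: c)) (st m a b c) 1 :=
  ⟨1, le_rfl, (Run.pop (Γ := fun _ : Fin 4 => Option Bool) 3 _).cast rfl (by funext k; fin_cases k <;> rfl)⟩

end Basic

/-! ### Reading, moving and copying trees -/

/-- Is the top symbol a binary node? -/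
def isNode (o : Option (Option Bool)) : Bool := o = some (some true)

/-- Is there a top symbol other than the separator? -/
def isTok (o : Option (Option Bool)) : Bool := o = some (some true) ∨ o = some (some false)

/-- Push a symbol onto a stack if `f` is set. -/
def pushIf (f : Bool) (k : Fin 4) (x : Option Bool) : WProg := if f then .push k x else .skip

/-- The effect of transferring the word `w` symbol by symbol if `f` is set. -/
def xfer (f : Bool) (w a : List (Option Bool)) : List (Option Bool) :=
  if f then w.reverse ++ a else a

theorem xfer_append (f : Bool) (v w a : List (Option Bool)) :
    xfer f w (xfer f v a) = xfer f (v ++ w) a := by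
  cases f <;> simp [xfer]

theorem pushIf_one (f : Bool) (x : Option Bool) (m a b c : List (Option Bool)) :
    RunLe (pushIf f 1 x) (st m a b c) (st m (xfer f [x] a) b c) 1 := by
  cases f
  · exact .skip _
  · exact .push1 x m a b c

theorem pushIf_two (f : Bool) (x : Option Bool) (m a b c : List (Option Bool)) :
    RunLe (pushIf f 2 x) (st m a b c) (st m a (xfer f [x] b) c) 1 := by
  cases f
  · exact .skip _
  · exact .push2 x m a b c

/-- The main loop of `scan`: the counter holds the number of trees still to be read. -/
def scanLoop (f g : Bool) : WProg :=
  .loop 3 isNode <| .seq (.pop 3) <| .ite 0 isNode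
    (.seq (.pop 0) <| .seq (pushIf f 1 (some true)) <| .seq (pushIf g 2 (some true)) <|
      .seq (.push 3 (some true)) (.push 3 (some true)))
    (.seq (.pop 0) <| .seq (pushIf f 1 (some false)) (pushIf g 2 (some false)))

/-- In prefix notation a leaf completes one pending tree, while a node replaces one pending tree by
two. The statement is in continuation form: a run from the state after the tree extends to a run
from the state before it. Thus the two subtrees of a node can be processed one after the other
inside the same loop. -/
theorem scanLoop_run (f g : Bool) (t : Dat) : ∀ (m a b c : List (Option Bool))
    (S : ∀ _ : Fin 4, List (Option Bool)) (N : ℕ),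
    RunLe (scanLoop f g) (st m (xfer f t.enc a) (xfer g t.enc b) c) S N →
    RunLe (scanLoop f g) (st (t.enc ++ m) a b (some true :: c)) S (N + 9 * t.size) := by
  induction t with
  | nil =>
    intro m a b c S N h
    refine RunLe.mono (.loop_true rfl (.seq (.pop3 _ _ _ _ _) (.ite_false (N := 1 + (1 + 1)) rfl
      (.seq (.pop0 _ _ _ _ _) (.seq (pushIf_one _ _ _ _ _ _) (pushIf_two _ _ _ _ _ _))))) h) ?_
    simp only [Dat.size]; omega
  | cons x y ihx ihy =>
    intro m a b c S N h
    have h1 := ihx (y.enc ++ m) (xfer f [some true] a) (xfer g [some true] b) (some true :: c) S _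
      (ihy m _ _ c S N (by
        simp only [xfer_append, List.append_assoc]
        exact h))
    have h2 : RunLe (scanLoop f g) (st (x.enc ++ (y.enc ++ m)) (xfer f [some true] a)
      (xfer g [some true] b) (some true :: some true :: c)) S _ := h1
    have e : (Dat.cons x y).enc ++ m = some true :: (x.enc ++ (y.enc ++ m)) := by
      simp [Dat.enc]
    rw [e]
    refine RunLe.mono (.loop_true rfl (.seq (.pop3 _ _ _ _ _)
      (.ite_true (N := 1 + (1 + (1 + (1 + 1)))) rfl
      (.seq (.pop0 _ _ _ _ _) (.seq (pushIf_one _ _ _ _ _ _) (.seq (pushIf_two _ _ _ _ _ _)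
        (.seq (.push3 _ _ _ _ _) (.push3 _ _ _ _ _))))))) h2) ?_
    simp only [Dat.size]; omega

/-- Remove the top tree of the main stack, transferring it to the chosen auxiliary stacks. -/
def scan (f g : Bool) : WProg :=
  .seq (.push 3 none) <| .seq (.push 3 (some true)) <| .seq (scanLoop f g) (.pop 3)

/-- The separator pushed below the counter stops the loop even if the old counter stack `c` has
pending marks of its own. -/
theorem scan_run (f g : Bool) (t : Dat) (m a b c : List (Option Bool)) :
    RunLe (scan f g) (st (t.enc ++ m) a b c) (st m (xfer f t.enc a) (xfer g t.enc b) c)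
      (13 * t.size) := by
  refine RunLe.mono (.seq (.push3 _ _ _ _ _) (.seq (.push3 _ _ _ _ _)
    (.seq (scanLoop_run f g t m a b (none :: c) _ 1 (.loop_false rfl)) (.pop3 _ _ _ _ _)))) ?_
  have := t.size_pos
  omega

/-- Remove the top tree. -/
def dropTree : WProg := scan false false

theorem dropTree_run (t : Dat) (m a b c : List (Option Bool)) :
    RunLe dropTree (st (t.enc ++ m) a b c) (st m a b c) (13 * t.size) :=
  scan_run false false t m a b c

/-- Move the top tree to the first auxiliary stack. -/
def stashA : WProg := .seq (.push 1 none) (scan true false)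

theorem stashA_run (t : Dat) (m a b c : List (Option Bool)) :
    RunLe stashA (st (t.enc ++ m) a b c) (st m (t.enc.reverse ++ none :: a) b c)
      (14 * t.size) :=
  RunLe.mono (.seq (.push1 _ _ _ _ _) (scan_run true false t m _ b c))
    (by have := t.size_pos; omega)

/-- Move the top tree to the second auxiliary stack. -/
def stashB : WProg := .seq (.push 2 none) (scan false true)

theorem stashB_run (t : Dat) (m a b c : List (Option Bool)) :
    RunLe stashB (st (t.enc ++ m) a b c) (st m a (t.enc.reverse ++ none :: b) c)
      (14 * t.size) :=
  RunLe.mono (.seq (.push2 _ _ _ _ _) (scan_run false true t m a _ c))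
    (by have := t.size_pos; omega)

/-- Move the word above the separator back to the main stack, from stack `k`. -/
def unstash (k : Fin 4) : WProg :=
  .seq (.loop k isTok <| .ite k isNode (.seq (.pop k) (.push 0 (some true)))
    (.seq (.pop k) (.push 0 (some false)))) (.pop k)

theorem unstashA_loop (w : List (Option Bool)) : ∀ (m a b c : List (Option Bool)), none ∉ w →
    RunLe (.loop 1 isTok <| .ite 1 isNode (.seq (.pop 1) (.push 0 (some true)))
      (.seq (.pop 1) (.push 0 (some false))) : WProg) (st m (w ++ none :: a) b c)
      (st (w.reverse ++ m) (none :: a) b c) (4 * w.length + 1) := by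
  induction w with
  | nil => intro m a b c _; exact .loop_false rfl
  | cons x w ih =>
    intro m a b c hw
    simp only [List.mem_cons, not_or] at hw
    have h := ih (x :: m) a b c hw.2
    rw [List.reverse_cons, List.append_assoc, List.singleton_append]
    obtain _ | _ | _ := x
    · exact absurd rfl hw.1
    · exact RunLe.mono (.loop_true rfl (.ite_false (N := 1 + 1) rfl
        (.seq (.pop1 _ _ _ _ _) (.push0 _ _ _ _ _))) h) (by simp; omega)
    · exact RunLe.mono (.loop_true rfl (.ite_true (N := 1 + 1) rfl
        (.seq (.pop1 _ _ _ _ _) (.push0 _ _ _ _ _))) h) (by simp; omega)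

theorem unstashB_loop (w : List (Option Bool)) : ∀ (m a b c : List (Option Bool)), none ∉ w →
    RunLe (.loop 2 isTok <| .ite 2 isNode (.seq (.pop 2) (.push 0 (some true)))
      (.seq (.pop 2) (.push 0 (some false))) : WProg) (st m a (w ++ none :: b) c)
      (st (w.reverse ++ m) a (none :: b) c) (4 * w.length + 1) := by
  induction w with
  | nil => intro m a b c _; exact .loop_false rfl
  | cons x w ih =>
    intro m a b c hw
    simp only [List.mem_cons, not_or] at hw
    have h := ih (x :: m) a b c hw.2
    rw [List.reverse_cons, List.append_assoc, List.singleton_append]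
    obtain _ | _ | _ := x
    · exact absurd rfl hw.1
    · exact RunLe.mono (.loop_true rfl (.ite_false (N := 1 + 1) rfl
        (.seq (.pop2 _ _ _ _ _) (.push0 _ _ _ _ _))) h) (by simp; omega)
    · exact RunLe.mono (.loop_true rfl (.ite_true (N := 1 + 1) rfl
        (.seq (.pop2 _ _ _ _ _) (.push0 _ _ _ _ _))) h) (by simp; omega)

theorem unstashA_run (t : Dat) (m a b c : List (Option Bool)) :
    RunLe (unstash 1) (st m (t.enc.reverse ++ none :: a) b c) (st (t.enc ++ m) a b c)
      (6 * t.size) := by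
  have h := unstashA_loop t.enc.reverse m a b c (by simpa using t.none_notMem_enc)
  rw [List.reverse_reverse, List.length_reverse, t.length_enc] at h
  exact RunLe.mono (.seq h (.pop1 _ _ _ _ _)) (by have := t.size_pos; omega)

theorem unstashB_run (t : Dat) (m a b c : List (Option Bool)) :
    RunLe (unstash 2) (st m a (t.enc.reverse ++ none :: b) c) (st (t.enc ++ m) a b c)
      (6 * t.size) := by
  have h := unstashB_loop t.enc.reverse m a b c (by simpa using t.none_notMem_enc)
  rw [List.reverse_reverse, List.length_reverse, t.length_enc] at h
  exact RunLe.mono (.seq h (.pop2 _ _ _ _ _)) (by have := t.size_pos; omega)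

/-- Duplicate the top tree. -/
def dupTree : WProg :=
  .seq (.push 1 none) <| .seq (.push 2 none) <| .seq (scan true true) <|
    .seq (unstash 1) (unstash 2)

theorem dupTree_run (t : Dat) (m a b c : List (Option Bool)) :
    RunLe dupTree (st (t.enc ++ m) a b c) (st (t.enc ++ (t.enc ++ m)) a b c)
      (27 * t.size) :=
  RunLe.mono (.seq (.push1 _ _ _ _ _) (.seq (.push2 _ _ _ _ _) (.seq
    (scan_run true true t m _ _ c) (.seq (unstashA_run t m a _ c)
      (unstashB_run t _ a b c))))) (by have := t.size_pos; omega)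

/-- Push a word so that it can be read from the top of the main stack. -/
def pushWord : List (Option Bool) → WProg
  | [] => .skip
  | x :: w => .seq (pushWord w) (.push 0 x)

theorem pushWord_run (w m a b c : List (Option Bool)) :
    RunLe (pushWord w) (st m a b c) (st (w ++ m) a b c) (w.length + 1) := by
  induction w with
  | nil => exact .skip _
  | cons x w ih => exact .seq ih (.push0 _ _ _ _ _)

end StackProg

/-! ### Polynomial-time functions on represented types -/

namespace StackProg

/-- A representation of the elements of a type by binary trees. -/
class DatRep (α : Type) where
  /-- the tree of an element -/
  rep : α → Dat

open DatRep (rep)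

instance : DatRep Unit := ⟨fun _ => .nil⟩
instance : DatRep Bool := ⟨fun b => if b then .cons .nil .nil else .nil⟩
instance {α β : Type} [DatRep α] [DatRep β] : DatRep (α × β) := ⟨fun x => .cons (rep x.1) (rep x.2)⟩

/-- Lists are right combs. -/
def repList {α : Type} [DatRep α] : List α → Dat
  | [] => .nil
  | x :: l => .cons (rep x) (repList l)

instance {α : Type} [DatRep α] : DatRep (List α) := ⟨repList⟩

/-- The size of the tree of an element. -/
def sz {α : Type} [DatRep α] (a : α) : ℕ := (rep a).size

variable {α β γ δ σ : Type} [DatRep α] [DatRep β] [DatRep γ] [DatRep δ] [DatRep σ]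

theorem sz_pos (a : α) : 0 < sz a := Dat.size_pos _
theorem sz_prod (x : α × β) : sz x = 1 + sz x.1 + sz x.2 := rfl
theorem sz_mk (a : α) (b : β) : sz (a, b) = 1 + sz a + sz b := rfl
theorem sz_nil : sz ([] : List α) = 1 := rfl
theorem sz_cons (a : α) (l : List α) : sz (a :: l) = 1 + sz a + sz l := rfl

theorem sz_append (l l' : List α) : sz (l ++ l') + 1 = sz l + sz l' := by
  induction l with
  | nil => simp [sz_nil]; omega
  | cons a l ih => simp only [List.cons_append, sz_cons]; omega

theorem sz_lt_of_mem {a : α} {l : List α} (h : a ∈ l) : sz a < sz l := by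
  induction l with
  | nil => simp at h
  | cons b l ih =>
    rw [sz_cons]
    rcases List.mem_cons.1 h with rfl | h
    · have := sz_pos l; omega
    · have := ih h; omega

theorem length_lt_sz (l : List α) : l.length < sz l := by
  induction l with
  | nil => simp [sz_nil]
  | cons a l ih => rw [sz_cons, List.length_cons]; have := sz_pos a; omega

theorem sz_sublist {l l' : List α} (h : l.Sublist l') : sz l ≤ sz l' := by
  induction h with
  | slnil => exact le_rfl
  | cons a _ ih => rw [sz_cons]; omega
  | cons_cons a _ ih => rw [sz_cons, sz_cons]; omega

theorem sz_reverse (l : List α) : sz l.reverse = sz l := by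
  induction l with
  | nil => rfl
  | cons a l ih =>
    have := sz_append l.reverse [a]
    rw [List.reverse_cons, sz_cons]
    rw [sz_cons, sz_nil] at this
    omega

theorem sz_le_of_forall {l : List α} {B : ℕ} (h : ∀ a ∈ l, sz a ≤ B) :
    sz l ≤ 1 + l.length * (B + 1) := by
  induction l with
  | nil => simp [sz_nil]
  | cons a l ih =>
    have h1 := h a (by simp)
    have h2 := ih fun b hb => h b (by simp [hb])
    rw [sz_cons, List.length_cons, Nat.add_mul, one_mul]
    omega

omit [DatRep α] in
theorem sz_flatMap_le {l : List α} {k : α → List β} {B : ℕ} (h : ∀ a ∈ l, sz (k a) ≤ B) :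
    sz (l.flatMap k) ≤ 1 + l.length * B := by
  induction l with
  | nil => simp [sz_nil]
  | cons a l ih =>
    have h1 := h a (by simp)
    have h2 := ih fun b hb => h b (by simp [hb])
    have h3 := sz_append (k a) (l.flatMap k)
    rw [List.flatMap_cons, List.length_cons, Nat.add_mul, one_mul]
    omega

/-! #### Polynomial bounds -/

theorem eval_mono (p : Polynomial ℕ) : Monotone fun n => p.eval n := by
  intro m n h
  simp only [Polynomial.eval_eq_sum_range]
  exact Finset.sum_le_sum fun i _ => Nat.mul_le_mul_left _ (Nat.pow_le_pow_left h i)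

/-- The function `f` is bounded by a polynomial in the size of its argument. -/
def PolyBd (f : α → ℕ) : Prop := ∃ p : Polynomial ℕ, ∀ x, f x ≤ p.eval (sz x)

theorem PolyBd.mono {f g : α → ℕ} (hg : PolyBd g) (h : ∀ x, f x ≤ g x) : PolyBd f := by
  obtain ⟨p, hp⟩ := hg
  exact ⟨p, fun x => (h x).trans (hp x)⟩

theorem PolyBd.const (n : ℕ) : PolyBd fun _ : α => n :=
  ⟨Polynomial.C n, fun _ => by simp⟩

theorem PolyBd.sz : PolyBd (sz : α → ℕ) := ⟨Polynomial.X, fun _ => by simp⟩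

theorem PolyBd.add {f g : α → ℕ} (hf : PolyBd f) (hg : PolyBd g) :
    PolyBd fun x => f x + g x := by
  obtain ⟨p, hp⟩ := hf
  obtain ⟨q, hq⟩ := hg
  exact ⟨p + q, fun x => by simpa using Nat.add_le_add (hp x) (hq x)⟩

theorem PolyBd.mul {f g : α → ℕ} (hf : PolyBd f) (hg : PolyBd g) :
    PolyBd fun x => f x * g x := by
  obtain ⟨p, hp⟩ := hf
  obtain ⟨q, hq⟩ := hg
  exact ⟨p * q, fun x => by simpa using Nat.mul_le_mul (hp x) (hq x)⟩

theorem PolyBd.pow {f : α → ℕ} (hf : PolyBd f) (n : ℕ) : PolyBd fun x => f x ^ n := by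
  obtain ⟨p, hp⟩ := hf
  exact ⟨p ^ n, fun x => by simpa using Nat.pow_le_pow_left (hp x) n⟩

theorem PolyBd.eval {f : α → ℕ} (hf : PolyBd f) (q : Polynomial ℕ) :
    PolyBd fun x => q.eval (f x) := by
  obtain ⟨p, hp⟩ := hf
  exact ⟨q.comp p, fun x => by simpa using eval_mono q (hp x)⟩

/-! #### The class of polynomial-time functions -/

/-- `f` is computed in polynomial time by a program working on top of the main stack. -/
def PF (f : α → β) : Prop :=
  ∃ (P : WProg) (p : Polynomial ℕ), ∀ x, sz (f x) ≤ p.eval (sz x) ∧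
    ∀ m a b c, RunLe P (st ((rep x).enc ++ m) a b c) (st ((rep (f x)).enc ++ m) a b c)
      (p.eval (sz x))

theorem PF.mk {f : α → β} (P : WProg) {T : α → ℕ} (hs : PolyBd fun x => sz (f x))
    (hT : PolyBd T) (h : ∀ x m a b c, RunLe P (st ((rep x).enc ++ m) a b c)
      (st ((rep (f x)).enc ++ m) a b c) (T x)) : PF f := by
  obtain ⟨p, hp⟩ := hs.add hT
  exact ⟨P, p, fun x => ⟨le_of_add_le_left (hp x), fun m a b c =>
    (h x m a b c).mono (le_of_add_le_right (hp x))⟩⟩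

theorem PF.sz_bd {f : α → β} (hf : PF f) : PolyBd fun x => sz (f x) := by
  obtain ⟨_, p, h⟩ := hf
  exact ⟨p, fun x => (h x).1⟩

theorem PF.run {f : α → β} (hf : PF f) : ∃ (P : WProg) (p : Polynomial ℕ), ∀ x m a b c,
    RunLe P (st ((rep x).enc ++ m) a b c) (st ((rep (f x)).enc ++ m) a b c)
      (p.eval (sz x)) := by
  obtain ⟨P, p, h⟩ := hf
  exact ⟨P, p, fun x => (h x).2⟩

theorem PolyBd.comp {f : α → β} {g : β → ℕ} (hg : PolyBd g) (hf : PF f) :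
    PolyBd fun x => g (f x) := by
  obtain ⟨p, hp⟩ := hg
  exact (hf.sz_bd.eval p).mono fun x => hp (f x)

theorem PF.congr {f g : α → β} (hf : PF f) (h : ∀ x, f x = g x) : PF g := funext h ▸ hf

/-- Only the trees of the argument and of the value matter. -/
theorem PF.of_rep {α' β' : Type} [DatRep α'] [DatRep β'] {F : α' → β'} (hF : PF F) {f : α → β}
    (i : α → α') (hi : ∀ x, rep (i x) = rep x) (h : ∀ x, rep (F (i x)) = rep (f x)) : PF f := by
  obtain ⟨P, p, hP⟩ := hF
  refine ⟨P, p, fun x => ?_⟩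
  have := hP (i x)
  simpa only [sz, hi, h] using this

theorem PF.id : PF fun x : α => x :=
  .mk .skip .sz (.const 1) fun _ _ _ _ _ => .skip _

theorem PF.comp {f : β → γ} {g : α → β} (hf : PF f) (hg : PF g) : PF fun x => f (g x) := by
  obtain ⟨P, p, hP⟩ := hf.run
  obtain ⟨Q, q, hQ⟩ := hg.run
  exact .mk (.seq Q P) (hf.sz_bd.comp hg) ((PolyBd.sz.eval q).add (hg.sz_bd.eval p))
    fun x m a b c => .seq (hQ x m a b c) (hP _ m a b c)

theorem PF.const (b : β) : PF fun _ : α => b :=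
  .mk (.seq dropTree (pushWord (rep b).enc)) (.const _)
    (((PolyBd.const 13).mul .sz).add (.const _))
    fun x m a c d => .seq (dropTree_run (rep x) m a c d) (pushWord_run _ m a c d)

theorem PF.pair {f : α → β} {g : α → γ} (hf : PF f) (hg : PF g) : PF fun x => (f x, g x) := by
  obtain ⟨P, p, hP⟩ := hf.run
  obtain ⟨Q, q, hQ⟩ := hg.run
  -- The value of `f` waits on the auxiliary stack while `g` works on the second copy of the
  -- argument. Two adjacent trees become a pair once a node symbol is put in front.
  refine .mk (.seq dupTree <| .seq P <| .seq stashA <| .seq Q <| .seq (unstash 1)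
    (.push 0 (some true))) (((PolyBd.const 1).add hf.sz_bd).add hg.sz_bd)
    (((PolyBd.const 27).mul .sz).add ((PolyBd.sz.eval p).add (((PolyBd.const 14).mul
    hf.sz_bd).add ((PolyBd.sz.eval q).add (((PolyBd.const 6).mul hf.sz_bd).add (.const 1))))))
    fun x m a b c => ?_
  have e : (rep (f x, g x)).enc ++ m =
      some true :: ((rep (f x)).enc ++ ((rep (g x)).enc ++ m)) := by
    simp [rep, Dat.enc]
  rw [e]
  exact .seq (dupTree_run _ _ _ _ _) (.seq (hP x _ _ _ _) (.seq (stashA_run _ _ _ _ _)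
    (.seq (hQ x _ _ _ _) (.seq (unstashA_run _ _ _ _ _) (.push0 _ _ _ _ _)))))

theorem PF.fst : PF fun x : α × β => x.1 := by
  refine .mk (.seq (.pop 0) <| .seq stashA <| .seq dropTree (unstash 1))
    (PolyBd.sz.mono fun x => by rw [sz_prod]; omega) ((PolyBd.const 40).mul .sz)
    fun x m a b c => ?_
  have e : (rep x).enc ++ m = some true :: ((rep x.1).enc ++ ((rep x.2).enc ++ m)) := by
    simp [rep, Dat.enc]
  rw [e]
  refine RunLe.mono (.seq (.pop0 _ _ _ _ _) (.seq (stashA_run _ _ _ _ _)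
    (.seq (dropTree_run _ _ _ _ _) (unstashA_run _ _ _ _ _)))) ?_
  rw [sz_prod]
  simp only [sz]
  omega

theorem PF.snd : PF fun x : α × β => x.2 := by
  refine .mk (.seq (.pop 0) dropTree)
    (PolyBd.sz.mono fun x => by rw [sz_prod]; omega) ((PolyBd.const 40).mul .sz)
    fun x m a b c => ?_
  have e : (rep x).enc ++ m = some true :: ((rep x.1).enc ++ ((rep x.2).enc ++ m)) := by
    simp [rep, Dat.enc]
  rw [e]
  refine RunLe.mono (.seq (.pop0 _ _ _ _ _) (dropTree_run _ _ _ _ _)) ?_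
  rw [sz_prod]
  simp only [sz]
  omega

theorem PF.fst' {f : γ → α × β} (hf : PF f) : PF fun x => (f x).1 := PF.fst.comp hf
theorem PF.snd' {f : γ → α × β} (hf : PF f) : PF fun x => (f x).2 := PF.snd.comp hf

theorem PF.cons {f : α → β} {g : α → List β} (hf : PF f) (hg : PF g) :
    PF fun x => f x :: g x :=
  (hf.pair hg).of_rep (fun x => x) (fun _ => rfl) fun _ => rfl

/-- Case distinction on a list. -/
theorem PF.list_cases {l : α → List γ} {f : α → β} {g : α × γ × List γ → β} (hl : PF l)
    (hf : PF f) (hg : PF g) : PF fun x => match l x with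
      | [] => f x
      | u :: v => g (x, u, v) := by
  obtain ⟨P, p, hP⟩ := hl.run
  obtain ⟨Q, q, hQ⟩ := hf.run
  -- A nonempty list has the tree of the pair of its head and tail, so the tree of `(x, l x)` is
  -- already that of `(x, u, v)`. The list is therefore only tested, dropped, and computed again
  -- next to `x`.
  obtain ⟨R, r, hR⟩ := (PF.id.pair hl).run
  obtain ⟨S, s, hS⟩ := hg.run
  have hpd : PolyBd fun x => 1 + sz x + sz (l x) := ((PolyBd.const 1).add .sz).add hl.sz_bd
  obtain ⟨G, hG⟩ := hg.sz_bd
  refine .mk (.seq dupTree <| .seq P <| .ite 0 isNode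
    (.seq dropTree (.seq R S)) (.seq dropTree Q))
    ((hf.sz_bd.add (hpd.eval G)).mono fun x => ?_)
    (((PolyBd.const 27).mul .sz).add ((PolyBd.sz.eval p).add
      (((((PolyBd.const 13).mul hl.sz_bd).add ((PolyBd.sz.eval r).add (hpd.eval s))).add
        (PolyBd.sz.eval q)).add (.const 1))))
    fun x m a b c => .seq (dupTree_run _ _ _ _ _) (.seq (hP x _ _ _ _) ?_)
  · have hle : ∀ u v, l x = u :: v → sz (g (x, u, v)) ≤ G.eval (1 + sz x + sz (l x)) := by
      intro u v h
      have := hG (x, u, v)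
      rw [h]
      exact this
    cases h : l x with
    | nil => simp
    | cons u v =>
      have := hle u v h
      simp only [h] at this ⊢
      omega
  · have key : ∀ e, l x = e → RunLe (.ite 0 isNode (.seq dropTree (.seq R S)) (.seq dropTree Q))
        (st ((rep e).enc ++ ((rep x).enc ++ m)) a b c)
        (st ((rep (match e with
          | [] => f x
          | u :: v => g (x, u, v))).enc ++ m) a b c)
        (13 * sz (l x) + (r.eval (sz x) + s.eval (1 + sz x + sz (l x))) + q.eval (sz x) + 1) := by
      intro e he
      cases e with
      | nil =>
        refine (RunLe.ite_false (N := 13 * sz ([] : List γ) + _) rfl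
          (.seq (dropTree_run (rep ([] : List γ)) _ _ _ _) (hQ x _ _ _ _))).mono ?_
        rw [he]; omega
      | cons u v =>
        have h1 := hR x m a b c
        have h2 := hS (x, u, v) m a b c
        have h3 : (rep (x, l x)) = rep (x, u, v) := by rw [he]; rfl
        rw [h3] at h1
        refine (RunLe.ite_true (N := 13 * sz (u :: v) + _) rfl
          (.seq (dropTree_run (rep (u :: v)) _ _ _ _) (.seq h1 h2))).mono ?_
        rw [he]
        have : sz (x, u, v) = 1 + sz x + sz (u :: v) := rfl
        rw [this]; omega
    exact key _ rfl

end StackProg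

/-! ### Iteration, folds and list operations -/

namespace StackProg
open DatRep (rep)
variable {α β γ δ σ : Type} [DatRep α] [DatRep β] [DatRep γ] [DatRep δ] [DatRep σ]

/-- The loop of an iteration, counted by the list on the main stack; the state is on the second
auxiliary stack. -/
theorem iterate_loop {g : σ → σ} {P : WProg} {p : Polynomial ℕ}
    (hP : ∀ x m a b c, RunLe P (st ((rep x).enc ++ m) a b c) (st ((rep (g x)).enc ++ m) a b c)
      (p.eval (sz x))) (B : ℕ) (l : List δ) : ∀ (x : σ) (L : ℕ) (m a b c : List (Option Bool)),
    (∀ i ≤ l.length, sz (g^[i] x) ≤ B) → sz l ≤ L →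
    RunLe (.loop 0 isNode (.seq (.pop 0) <| .seq dropTree <| .seq stashA <| .seq (unstash 2) <|
      .seq P <| .seq stashB (unstash 1)))
      (st ((rep l).enc ++ m) a ((rep x).enc.reverse ++ none :: b) c)
      (st (some false :: m) a ((rep (g^[l.length] x)).enc.reverse ++ none :: b) c)
      (l.length * (20 * L + 20 * B + p.eval B) + 1) := by
  induction l with
  | nil => intro x L m a b c _ _; exact (RunLe.loop_false rfl).mono (by simp)
  | cons d l ih =>
    intro x L m a b c hB hL
    rw [sz_cons] at hL
    have h := ih (g x) L m a b c (fun i hi => by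
      have := hB (i + 1) (by simpa using hi)
      rwa [Function.iterate_succ_apply] at this) (by omega)
    have e : (rep (d :: l)).enc ++ m = some true :: ((rep d).enc ++ ((rep l).enc ++ m)) := by
      simp [rep, repList, Dat.enc]
    rw [e, List.length_cons, Function.iterate_succ_apply]
    refine RunLe.mono (.loop_true rfl (.seq (.pop0 _ _ _ _ _) (.seq (dropTree_run _ _ _ _ _)
      (.seq (stashA_run _ _ _ _ _) (.seq (unstashB_run _ _ _ _ _) (.seq (hP _ _ _ _ _)
        (.seq (stashB_run _ _ _ _ _) (unstashA_run _ _ _ _ _))))))) h) ?_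
    have h1 : (rep x).size ≤ B := hB 0 (by simp)
    have h2 : (rep (g x)).size ≤ B := hB 1 (by simp)
    have h3 : p.eval (sz x) ≤ p.eval B := eval_mono p h1
    have h4 : (rep d).size + (rep l).size + 1 ≤ L := by simp only [sz] at hL; omega
    rw [Nat.add_mul, one_mul]
    omega

/-- Iteration along a list, with polynomially bounded intermediate values. -/
theorem PF.iterate {u : γ → List δ} {s : γ → σ} {g : σ → σ} (hu : PF u) (hs : PF s) (hg : PF g)
    {bd : γ → ℕ} (hbd : PolyBd bd) (h : ∀ c, ∀ i ≤ (u c).length, sz (g^[i] (s c)) ≤ bd c) :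
    PF fun c => g^[(u c).length] (s c) := by
  obtain ⟨P, p, hP⟩ := hu.run
  obtain ⟨Q, q, hQ⟩ := hs.run
  obtain ⟨R, r, hR⟩ := hg.run
  refine .mk (.seq dupTree <| .seq Q <| .seq stashB <| .seq P <|
    .seq (.loop 0 isNode (.seq (.pop 0) <| .seq dropTree <| .seq stashA <| .seq (unstash 2) <|
      .seq R <| .seq stashB (unstash 1))) <| .seq (.pop 0) (unstash 2))
    (hbd.mono fun x => h x _ le_rfl)
    (((PolyBd.const 27).mul .sz).add ((PolyBd.sz.eval q).add (((PolyBd.const 14).mul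
      hs.sz_bd).add ((PolyBd.sz.eval p).add (((hu.sz_bd.mul ((((PolyBd.const 20).mul
        hu.sz_bd).add ((PolyBd.const 20).mul hbd)).add (hbd.eval r))).add (.const 1)).add
          ((PolyBd.const 1).add ((PolyBd.const 6).mul hbd)))))))
    fun x m a b c => .seq (dupTree_run _ _ _ _ _) (.seq (hQ x _ _ _ _)
      (.seq (stashB_run _ _ _ _ _) (.seq (hP x _ _ _ _)
      (.seq ((iterate_loop hR (bd x) (u x) (s x) (sz (u x)) m a b c (h x) le_rfl).mono ?_)
      (.seq (.pop0 _ _ _ _ _) ((unstashB_run _ _ _ _ _).mono ?_))))))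
  · have := (length_lt_sz (u x)).le
    gcongr
  · have := h x _ le_rfl
    gcongr
    exact this

/-- A fold is an iteration on triples of parameter, unread list and accumulator. The map is the
identity once the list is empty, so the formula holds for every `i`. -/
theorem iterate_foldl {γ α σ : Type} (h : γ → σ → α → σ) (c : γ) : ∀ (l : List α) (s : σ) (i : ℕ),
    (fun x : γ × List α × σ => match x.2.1 with
      | [] => x
      | u :: v => (x.1, v, h x.1 x.2.2 u))^[i] (c, l, s)
      = (c, l.drop i, (l.take i).foldl (h c) s) := by
  intro l s i
  induction i generalizing l s with
  | zero => simp
  | succ i ih =>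
    cases l with
    | nil =>
      rw [Function.iterate_succ_apply]
      simpa using ih [] s
    | cons u v =>
      rw [Function.iterate_succ_apply]
      simpa using ih v (h c s u)

/-- Folding with polynomially bounded intermediate values. -/
theorem PF.foldl {f : γ → List α} {s : γ → σ} {h : γ → σ → α → σ} (hf : PF f) (hs : PF s)
    (hh : PF fun x : γ × σ × α => h x.1 x.2.1 x.2.2) {bd : γ → ℕ} (hbd : PolyBd bd)
    (hle : ∀ c l, l <+: f c → sz (l.foldl (h c) (s c)) ≤ bd c) :
    PF fun c => (f c).foldl (h c) (s c) := by
  have hg : PF (fun x : γ × List α × σ => match x.2.1 with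
      | [] => x
      | u :: v => (x.1, v, h x.1 x.2.2 u)) := by
    refine PF.list_cases (l := fun x : γ × List α × σ => x.2.1)
      (g := fun y => (y.1.1, y.2.2, h y.1.1 y.1.2.2 y.2.1)) PF.snd.fst' PF.id ?_
    exact PF.fst.fst'.pair (PF.snd.snd'.pair
      (hh.comp (PF.fst.fst'.pair (PF.fst.snd'.snd'.pair PF.snd.fst'))))
  have key := PF.iterate hf (PF.id.pair (hf.pair hs)) hg
    (((PolyBd.const 2).add PolyBd.sz).add (hf.sz_bd.add hbd)) (fun c i _ => by
      rw [iterate_foldl, sz_mk, sz_mk]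
      have h1 := sz_sublist (List.drop_sublist i (f c))
      have h2 := hle c _ (List.take_prefix i (f c))
      omega)
  refine key.snd'.snd'.congr fun c => ?_
  rw [iterate_foldl]
  simp

theorem PF.reverse : PF fun l : List α => l.reverse := by
  refine (PF.foldl (f := fun l : List α => l) (s := fun _ => [])
    (h := fun _ acc x => x :: acc) PF.id (.const _) (PF.snd.snd'.cons PF.snd.fst')
    PolyBd.sz fun c l hl => ?_).congr fun l => ?_
  · rw [List.foldl_flip_cons_eq_append, List.append_nil, List.map_id', sz_reverse]
    exact sz_sublist hl.sublist
  · simp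

theorem PF.append' : PF fun x : List α × List α => x.1 ++ x.2 := by
  refine (PF.foldl (f := fun x : List α × List α => x.1.reverse) (s := fun x => x.2)
    (h := fun _ acc x => x :: acc) (PF.reverse.comp .fst) .snd (PF.snd.snd'.cons PF.snd.fst')
    PolyBd.sz fun c l hl => ?_).congr fun l => ?_
  · have h1 := sz_sublist hl.sublist
    have h2 := sz_append l.reverse c.2
    rw [List.foldl_flip_cons_eq_append, List.map_id', sz_prod]
    rw [sz_reverse] at h1 h2
    omega
  · simp

theorem PF.append {f g : γ → List α} (hf : PF f) (hg : PF g) : PF fun x => f x ++ g x :=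
  PF.append'.comp (hf.pair hg)

theorem PF.flatMap {f : γ → List α} {k : γ → α → List β} (hf : PF f)
    (hk : PF fun x : γ × α => k x.1 x.2) : PF fun c => (f c).flatMap (k c) := by
  obtain ⟨p, hp⟩ := hk.sz_bd
  have hfold : ∀ (c : γ) (l : List α) (acc : List β),
      l.foldl (fun acc x => acc ++ k c x) acc = acc ++ l.flatMap (k c) := by
    intro c l
    induction l with
    | nil => simp
    | cons a l ih => intro acc; simp [ih]
  refine (PF.foldl (s := fun _ => []) (h := fun c acc x => acc ++ k c x) hf (.const _)
    (PF.snd.fst'.append (hk.comp (PF.fst.pair PF.snd.snd')))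
    ((PolyBd.const 1).add (hf.sz_bd.mul ((((PolyBd.const 1).add PolyBd.sz).add
      hf.sz_bd).eval p))) fun c l hl => ?_).congr fun c => ?_
  · rw [hfold, List.nil_append]
    refine (sz_flatMap_le (B := p.eval (1 + sz c + sz (f c))) fun a ha => ?_).trans ?_
    · refine (hp (c, a)).trans (eval_mono p ?_)
      rw [sz_mk]
      have := sz_lt_of_mem (hl.subset ha)
      omega
    · have := (length_lt_sz l).le.trans (sz_sublist hl.sublist)
      gcongr
  · rw [hfold, List.nil_append]

theorem PF.map {f : γ → List α} {k : γ → α → β} (hf : PF f)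
    (hk : PF fun x : γ × α => k x.1 x.2) : PF fun c => (f c).map (k c) :=
  (hf.flatMap (k := fun c x => [k c x]) (hk.cons (.const _))).congr fun c => by
    rw [← List.flatMap_singleton' (List.map _ _), List.flatMap_map]

/-- Booleans as lists. -/
def boolList (b : Bool) : List Unit := if b then [()] else []

theorem rep_boolList (b : Bool) : rep (boolList b) = rep b := by cases b <;> rfl

theorem PF.cond {b : γ → Bool} {f g : γ → α} (hb : PF b) (hf : PF f) (hg : PF g) :
    PF fun c => if b c then f c else g c := by
  have h : PF fun c => boolList (b c) :=
    hb.of_rep (fun c => c) (fun _ => rfl) fun c => (rep_boolList (b c)).symm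
  refine (PF.list_cases (g := fun x : γ × Unit × List Unit => f x.1) h hg
    (hf.comp .fst)).congr fun c => ?_
  cases b c <;> simp [boolList]

theorem PF.filter {f : γ → List α} {b : γ → α → Bool} (hf : PF f)
    (hb : PF fun x : γ × α => b x.1 x.2) : PF fun c => (f c).filter (b c) := by
  refine (hf.flatMap (k := fun c x => if b c x then [x] else [])
    (hb.cond (PF.snd.cons (.const _)) (.const _))).congr fun c => ?_
  induction f c with
  | nil => rfl
  | cons a l ih => rw [List.flatMap_cons, ih]; cases h : b c a <;> simp [h]

theorem PF.isEmpty {f : γ → List α} (hf : PF f) : PF fun c => (f c).isEmpty := by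
  refine (PF.list_cases (g := fun _ => false) hf (.const true) (.const _)).congr fun c => ?_
  cases f c <;> rfl

theorem PF.not {b : γ → Bool} (hb : PF b) : PF fun c => !b c :=
  (hb.cond (.const false) (.const true)).congr fun c => by cases b c <;> rfl

theorem PF.any {f : γ → List α} {b : γ → α → Bool} (hf : PF f)
    (hb : PF fun x : γ × α => b x.1 x.2) : PF fun c => (f c).any (b c) := by
  refine (hf.filter hb).isEmpty.not.congr fun c => ?_
  induction f c with
  | nil => rfl
  | cons a l ih => cases h : b c a <;> simp [h, ← ih]

theorem PF.all {f : γ → List α} {b : γ → α → Bool} (hf : PF f)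
    (hb : PF fun x : γ × α => b x.1 x.2) : PF fun c => (f c).all (b c) :=
  (hf.any (b := fun c x => !b c x) hb.not).not.congr fun c => by rw [List.not_any_eq_all_not]; simp

theorem PF.tail {f : γ → List α} (hf : PF f) : PF fun c => (f c).tail := by
  refine (PF.list_cases (g := fun x : γ × α × List α => x.2.2) hf (.const [])
    PF.snd.snd').congr fun c => ?_
  cases f c <;> rfl

theorem PF.headD {f : γ → List α} (hf : PF f) (a : α) : PF fun c => (f c).headD a := by
  refine (PF.list_cases (g := fun x : γ × α × List α => x.2.1) hf (.const a)
    PF.snd.fst').congr fun c => ?_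
  cases f c <;> rfl

/-- Removing one element of `g c` for each element of `f c` compares the lengths without any
arithmetic. -/
theorem PF.length_lt {f : γ → List α} {g : γ → List β} (hf : PF f) (hg : PF g) :
    PF fun c => decide ((f c).length < (g c).length) := by
  have hfold : ∀ (l : List α) (l' : List β), l.foldl (fun s _ => s.tail) l' = l'.drop l.length := by
    intro l
    induction l with
    | nil => simp
    | cons a l ih => intro l'; simp [ih, List.drop_tail]
  refine ((PF.foldl (s := g) (h := fun _ s _ => s.tail) hf hg PF.snd.fst'.tail hg.sz_bd
    fun c l _ => ?_).isEmpty.not).congr fun c => ?_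
  · rw [hfold]; exact sz_sublist (List.drop_sublist _ _)
  · rw [hfold, Bool.eq_iff_iff]; simp

theorem PF.zip {f : γ → List α} {g : γ → List β} (hf : PF f) (hg : PF g) :
    PF fun c => (f c).zip (g c) := by
  -- The state consists of the unread part of the second list and the pairs formed so far in reverse
  -- order.
  let h : γ → List β × List (α × β) → α → List β × List (α × β) := fun _ s x =>
    match s.1 with
    | [] => s
    | y :: ys => (ys, (x, y) :: s.2)
  have hfold : ∀ (c : γ) (l : List α) (s : List β × List (α × β)), l.foldl (h c) s =
      (s.1.drop l.length, (l.zip s.1).reverse ++ s.2) := by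
    intro c l
    induction l with
    | nil => simp
    | cons a l ih =>
      rintro ⟨s1, s2⟩
      cases s1 with
      | nil => rw [List.foldl_cons]; simpa [h] using ih ([], s2)
      | cons y ys => rw [List.foldl_cons]; simpa [h] using ih (ys, (a, y) :: s2)
  have hzip : ∀ (l : List α) (l' : List β), sz (l.zip l') ≤ sz l + sz l' := by
    intro l
    induction l with
    | nil => intro l'; simp [sz_nil]
    | cons a l ih =>
      intro l'
      cases l' with
      | nil => rw [List.zip_nil_right]; have := sz_pos (a :: l); simp only [sz_nil]; omega
      | cons b l' =>
        have := ih l'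
        rw [List.zip_cons_cons, sz_cons, sz_cons, sz_cons, sz_mk]
        omega
  have hh : PF fun x : γ × (List β × List (α × β)) × α => h x.1 x.2.1 x.2.2 :=
    PF.list_cases (l := fun x : γ × (List β × List (α × β)) × α => x.2.1.1)
      (f := fun x => x.2.1) (g := fun y => (y.2.2, (y.1.2.2, y.2.1) :: y.1.2.1.2)) PF.snd.fst'.fst'
      PF.snd.fst' (PF.snd.snd'.pair ((PF.fst.snd'.snd'.pair PF.snd.fst').cons
        PF.fst.snd'.fst'.snd'))
  refine (PF.reverse.comp (PF.foldl (s := fun c => (g c, [])) (h := h) hf (hg.pair (.const _)) hh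
    ((PolyBd.const 1).add (hg.sz_bd.add (hf.sz_bd.add hg.sz_bd)))
    fun c l hl => ?_).snd').congr fun c => ?_
  · rw [hfold c, sz_mk, List.append_nil, sz_reverse]
    have h1 := sz_sublist (List.drop_sublist l.length (g c))
    have h2 := hzip l (g c)
    have h3 := sz_sublist hl.sublist
    simp only at h1 ⊢
    omega
  · rw [hfold c]; simp

/-! #### Finite types -/

/-- Elements of a finite type in unary. -/
@[reducible] noncomputable def DatRep.ofFinite (α : Type) [Finite α] : DatRep α :=
  ⟨fun a => rep (List.replicate (Finite.equivFin α a : ℕ) ())⟩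

/-- The elements are represented by distinct numbers in unary. -/
class UnaryRep (κ : Type) [DatRep κ] : Prop where
  exists_idx : ∃ e : κ → ℕ, Function.Injective e ∧ ∀ a, rep a = rep (List.replicate (e a) ())

theorem UnaryRep.ofFinite (κ : Type) [Finite κ] : @UnaryRep κ (DatRep.ofFinite κ) :=
  let _ := DatRep.ofFinite κ
  ⟨fun a => Finite.equivFin κ a, fun _ _ h => (Finite.equivFin κ).injective (Fin.ext h),
    fun _ => rfl⟩

instance : UnaryRep Bool :=
  ⟨Bool.toNat, fun a b => by cases a <;> cases b <;> simp, fun a => by cases a <;> rfl⟩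

noncomputable instance (n : ℕ) : DatRep (Fin n) := .ofFinite _
noncomputable instance (n : ℕ) : DatRep (Finset (Fin n)) := .ofFinite _
instance (n : ℕ) : UnaryRep (Fin n) := .ofFinite _
instance (n : ℕ) : UnaryRep (Finset (Fin n)) := .ofFinite _

/-- The number representing a symbol of a block string. -/
def symIdx : Option Bool → ℕ
  | none => 0
  | some false => 1
  | some true => 2

instance : DatRep (Option Bool) := ⟨fun a => rep (List.replicate (symIdx a) ())⟩
instance : UnaryRep (Option Bool) :=
  ⟨symIdx, fun a b => by rcases a with _ | _ | _ <;> rcases b with _ | _ | _ <;> simp [symIdx],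
    fun _ => rfl⟩

/-- A unary index is consumed by repeated case distinction on a list. The function `f` is only a
default for indices beyond the table. -/
theorem PF.select (f : γ → α) (hf : PF f) : ∀ fs : List (γ → α), (∀ g ∈ fs, PF g) →
    ∃ F : γ × List Unit → α, PF F ∧
      ∀ i (h : i < fs.length) (c : γ), F (c, List.replicate i ()) = fs[i] c := by
  intro fs
  induction fs with
  | nil => exact fun _ => ⟨fun x => f x.1, hf.comp .fst, fun i h => by simp at h⟩
  | cons g fs ih =>
    intro hfs
    obtain ⟨F, hF, h⟩ := ih fun g hg => hfs g (by simp [hg])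
    refine ⟨_, PF.list_cases (l := fun x : γ × List Unit => x.2) (f := fun x => g x.1)
      (g := fun x => F (x.1.1, x.2.2)) PF.snd ((hfs g (by simp)).comp .fst)
      (hF.comp (PF.fst.fst'.pair PF.snd.snd')), fun i hi c => ?_⟩
    cases i with
    | zero => rfl
    | succ i => simpa [List.replicate_succ] using h i (by simpa using hi) c

/-- A finite case distinction. -/
theorem PF.finite_cases {κ : Type} [Finite κ] [DatRep κ] [UnaryRep κ] {k : γ → κ}
    {f : κ → γ → α} (hk : PF k) (hf : ∀ a, PF (f a)) : PF fun c => f (k c) c := by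
  classical
  obtain ⟨e, he, hrep⟩ := UnaryRep.exists_idx (κ := κ)
  rcases isEmpty_or_nonempty κ with hκ | hκ
  · exact ⟨.skip, 0, fun x => hκ.elim (k x)⟩
  · obtain ⟨B, hB⟩ := (Set.finite_range e).bddAbove
    have hinv : ∀ a, Function.invFun e (e a) = a := Function.leftInverse_invFun he
    obtain ⟨F, hF, h⟩ := PF.select (f (Classical.arbitrary κ)) (hf _)
      -- The finite table is indexed by the unary codes; entries at numbers that are not codes are
      -- arbitrary.
      (List.ofFn fun i : Fin (B + 1) => f (Function.invFun e i)) (by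
        intro g hg
        obtain ⟨i, rfl⟩ := List.mem_ofFn.1 hg
        exact hf _)
    have hu : PF fun c => List.replicate (e (k c)) () :=
      hk.of_rep (fun c => c) (fun _ => rfl) fun c => hrep (k c)
    refine (hF.comp (PF.id.pair hu)).congr fun c => ?_
    rw [h _ (by simpa using Nat.lt_succ_of_le (hB ⟨k c, rfl⟩))]
    simp [hinv]

theorem PF.finite {κ : Type} [Finite κ] [DatRep κ] [UnaryRep κ] {k : γ → κ} (hk : PF k)
    (f : κ → α) : PF fun c => f (k c) :=
  PF.finite_cases (f := fun a _ => f a) hk fun a => .const (f a)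

theorem PF.finite₂ {κ κ' : Type} [Finite κ] [DatRep κ] [UnaryRep κ] [Finite κ'] [DatRep κ']
    [UnaryRep κ'] {k : γ → κ} {k' : γ → κ'} (hk : PF k) (hk' : PF k') (f : κ → κ' → α) :
    PF fun c => f (k c) (k' c) :=
  PF.finite_cases (f := fun a c => f a (k' c)) hk fun a => hk'.finite (f a)

theorem sz_bdd_of_finite (κ : Type) [Finite κ] [DatRep κ] : ∃ B, ∀ x : κ, sz x ≤ B := by
  obtain ⟨B, hB⟩ := (Set.finite_range (sz : κ → ℕ)).bddAbove
  exact ⟨B, fun x => hB ⟨x, rfl⟩⟩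

end StackProg

/-! ### Binary counters -/

namespace StackProg
open DatRep (rep)
variable {α β γ δ σ : Type} [DatRep α] [DatRep β] [DatRep γ] [DatRep δ] [DatRep σ]

/-- Increment of a binary number, least significant bit first. -/
def inc : List Bool → List Bool
  | [] => [true]
  | false :: l => true :: l
  | true :: l => false :: inc l

/-- One step of an increment from left to right, with the carry and the reversed output. -/
def incStep (s : Bool × List Bool) (b : Bool) : Bool × List Bool :=
  (s.1 && b, (if s.1 then !b else b) :: s.2)

theorem foldl_incStep_false (l acc : List Bool) :
    l.foldl incStep (false, acc) = (false, l.reverse ++ acc) := by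
  induction l generalizing acc with
  | nil => rfl
  | cons b l ih => simp [incStep, ih]

/-- This expresses the increment as a single pass with a carry, which is a fold; a carry that
survives the pass becomes a new leading bit. -/
theorem inc_eq_foldl (l acc : List Bool) :
    (l.foldl incStep (true, acc)).2.reverse ++
      (if (l.foldl incStep (true, acc)).1 then [true] else []) = acc.reverse ++ inc l := by
  induction l generalizing acc with
  | nil => simp [inc]
  | cons b l ih =>
    cases b
    · simp [incStep, foldl_incStep_false, inc]
    · rw [List.foldl_cons]
      simpa [incStep, inc] using ih (false :: acc)

theorem encodePosNum_succ (p : PosNum) :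
    Computability.encodePosNum p.succ = inc (Computability.encodePosNum p) := by
  induction p with
  | one => rfl
  | bit0 p _ => rfl
  | bit1 p ih => simp [PosNum.succ, Computability.encodePosNum, inc, ih]

/-- With this the standard binary encoding of a length is obtained by counting. -/
theorem encodeNat_succ (n : ℕ) :
    Computability.encodeNat (n + 1) = inc (Computability.encodeNat n) := by
  unfold Computability.encodeNat
  rw [Nat.cast_succ, Num.add_one]
  cases (n : Num) with
  | zero => rfl
  | pos p => exact encodePosNum_succ p

/-- The number of elements of a list in binary. -/
def bin {α : Type} (l : List α) : List Bool := Computability.encodeNat l.length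

theorem length_inc_le (l : List Bool) : (inc l).length ≤ l.length + 1 := by
  induction l with
  | nil => simp [inc]
  | cons b l ih => cases b <;> simp [inc, ih]

theorem length_encodeNat_le (n : ℕ) : (Computability.encodeNat n).length ≤ n := by
  induction n with
  | zero => simp [Computability.encodeNat, Computability.encodeNum]
  | succ n ih => rw [encodeNat_succ]; exact (length_inc_le _).trans (by omega)

/-- The bit length is the logarithm up to an additive one. The upper bound keeps the dimension and
the number of words small; the lower bound makes the code large enough. -/
theorem length_encodePosNum (p : PosNum) :
    2 ^ (Computability.encodePosNum p).length ≤ 2 * (p : ℕ) ∧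
      (p : ℕ) < 2 ^ (Computability.encodePosNum p).length := by
  induction p with
  | one => simp [Computability.encodePosNum]
  | bit0 p ih =>
    simp only [Computability.encodePosNum, List.length_cons, pow_succ, PosNum.cast_bit0]
    omega
  | bit1 p ih =>
    simp only [Computability.encodePosNum, List.length_cons, pow_succ, PosNum.cast_bit1]
    omega

theorem lt_two_pow_length_encodeNat (n : ℕ) : n < 2 ^ (Computability.encodeNat n).length := by
  unfold Computability.encodeNat
  have h := Num.to_of_nat n
  cases hn : (n : Num) with
  | zero => rw [hn] at h; rw [← h]; simp
  | pos p =>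
    rw [hn] at h
    have := (length_encodePosNum p).2
    rw [← h]
    exact this

theorem two_pow_length_encodeNat_le {n : ℕ} (h0 : 0 < n) :
    2 ^ (Computability.encodeNat n).length ≤ 2 * n := by
  unfold Computability.encodeNat
  have h := Num.to_of_nat n
  cases hn : (n : Num) with
  | zero => rw [hn] at h; simp at h; omega
  | pos p =>
    rw [hn] at h
    have := (length_encodePosNum p).1
    rw [← h]
    exact this

theorem PF.inc {f : γ → List Bool} (hf : PF f) : PF fun c => StackProg.inc (f c) := by
  have hlen : ∀ (l : List Bool) (s : Bool × List Bool),
      (l.foldl incStep s).2.length = s.2.length + l.length := by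
    intro l
    induction l with
    | nil => simp
    | cons b l ih => intro s; simp [ih, incStep]; omega
  have h1 : PF fun c => (f c).foldl incStep (true, []) := by
    refine PF.foldl (h := fun _ => incStep) hf (.const _) ?_
      (((PolyBd.const 5).add ((PolyBd.const 4).mul hf.sz_bd))) fun c l hl => ?_
    · exact (PF.finite₂ PF.snd.fst'.fst' PF.snd.snd' _).pair ((PF.finite₂ PF.snd.fst'.fst'
        PF.snd.snd' fun a b : Bool => if a then !b else b).cons PF.snd.fst'.snd')
    · have hb : ∀ b : Bool, sz b ≤ 3 := by
        intro b; cases b <;> simp [sz, rep, Dat.size]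
      have h2 := sz_le_of_forall (l := (l.foldl incStep (true, [])).2) (B := 3) fun b _ => hb b
      have h3 := hlen l (true, [])
      have h4 := length_lt_sz l
      have h5 := sz_sublist hl.sublist
      have h6 := hb (l.foldl incStep (true, [])).1
      rw [sz_prod]
      simp only [List.length_nil, Nat.zero_add] at h3
      omega
  exact ((PF.reverse.comp h1.snd').append (h1.fst'.cond (.const [true]) (.const []))).congr
    fun c => inc_eq_foldl (f c) []

theorem PF.bin {f : γ → List α} (hf : PF f) : PF fun c => StackProg.bin (f c) := by
  have h : ∀ l : List α, l.foldl (fun b _ => StackProg.inc b) [] = StackProg.bin l := by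
    intro l
    induction l using List.reverseRecOn with
    | nil => rfl
    | append_singleton l a ih =>
      rw [List.foldl_append, ih]
      simp [StackProg.bin, encodeNat_succ]
  refine (PF.foldl (s := fun _ => []) (h := fun _ b _ => StackProg.inc b) hf (.const _)
    PF.snd.fst'.inc ((PolyBd.const 1).add (hf.sz_bd.mul (.const 4)))
    fun c l hl => ?_).congr fun c => h _
  rw [h]
  refine (sz_le_of_forall (B := 3) fun b _ => by cases b <;> simp [sz, rep, Dat.size]).trans ?_
  have h1 := length_encodeNat_le l.length
  have h2 := (length_lt_sz l).le.trans (sz_sublist hl.sublist)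
  have : (StackProg.bin l).length ≤ sz (f c) := h1.trans h2
  gcongr

/-! ### Codes and words over finite alphabets -/

/-- Scan a list, keeping an element if it is related to all those kept before. -/
def greedy {α : Type} (R : α → α → Bool) (l : List α) : List α :=
  l.foldl (fun acc x => if acc.all (R x) then x :: acc else acc) []

theorem greedy_append_singleton {α : Type} (R : α → α → Bool) (l : List α) (x : α) :
    greedy R (l ++ [x]) =
      if (greedy R l).all (R x) then x :: greedy R l else greedy R l := by
  simp [greedy]

theorem sz_greedy_le (R : α → α → Bool) (l : List α) : sz (greedy R l) ≤ sz l := by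
  induction l using List.reverseRecOn with
  | nil => exact le_rfl
  | append_singleton l a ih =>
    have h := sz_append l [a]
    rw [sz_cons, sz_nil] at h
    rw [greedy_append_singleton]
    split_ifs
    · rw [sz_cons]; omega
    · omega

theorem PF.greedy {f : γ → List α} {R : α → α → Bool} (hf : PF f)
    (hR : PF fun x : α × α => R x.1 x.2) : PF fun c => StackProg.greedy R (f c) := by
  refine PF.foldl (h := fun (_ : γ) (acc : List α) (x : α) =>
    if acc.all (R x) then x :: acc else acc) hf (.const [])
    ?_ hf.sz_bd fun c l hl => (sz_greedy_le R l).trans (sz_sublist hl.sublist)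
  exact PF.cond (PF.all PF.snd.fst' (hR.comp (PF.fst.snd'.snd'.pair PF.snd)))
    (PF.snd.snd'.cons PF.snd.fst') PF.snd.fst'

/-- The alphabet of the codes. -/
abbrev Color (D : ℕ) : Type := Fin (4 ^ D)

/-- All words of a given length. -/
def words (D : ℕ) : ℕ → List (List (Color D))
  | 0 => [[]]
  | l + 1 => (words D l).flatMap fun w => (List.finRange (4 ^ D)).map fun c => c :: w

theorem length_words (D l : ℕ) : (words D l).length = (4 ^ D) ^ l := by
  induction l with
  | zero => rfl
  | succ l ih => simp [words, List.length_flatMap, ih, pow_succ]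

theorem length_of_mem_words {D l : ℕ} {w : List (Color D)} (h : w ∈ words D l) :
    w.length = l := by
  induction l generalizing w with
  | zero => simp [words] at h; simp [h]
  | succ l ih =>
    simp only [words, List.mem_flatMap, List.mem_map] at h
    obtain ⟨w', hw', c, _, rfl⟩ := h
    simp [ih hw']

/-- Enumerating all words is affordable because their length is the bit length of a number given in
unary, so exponential in the word length means polynomial in the input. -/
theorem PF.words {f : γ → List α} (D : ℕ) (hf : PF f) :
    PF fun c => StackProg.words D (StackProg.bin (f c)).length := by
  have hfold : ∀ l : List Bool, l.foldl (fun W _ => W.flatMap fun w =>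
      (List.finRange (4 ^ D)).map fun c => c :: w) [[]] = StackProg.words D l.length := by
    intro l
    induction l using List.reverseRecOn with
    | nil => rfl
    | append_singleton l a ih =>
      rw [List.foldl_append, ih]
      simp [StackProg.words]
  obtain ⟨B, hB⟩ := sz_bdd_of_finite (Color D)
  refine (PF.foldl (f := fun c => StackProg.bin (f c)) (s := fun _ => [[]])
    (h := fun _ (W : List (List (Color D))) _ => W.flatMap fun w =>
      (List.finRange (4 ^ D)).map fun c => c :: w) hf.bin (.const _) ?_
    ((PolyBd.const 1).add ((((PolyBd.const 2).mul hf.sz_bd).pow (2 * D)).mul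
      (((PolyBd.const 1).add (hf.sz_bd.mul (.const (B + 1)))).add (.const 1))))
    fun c l hl => ?_).congr fun c => hfold _
  · exact PF.snd.fst'.flatMap (k := fun _ w => (List.finRange (4 ^ D)).map fun c => c :: w)
      ((PF.const _).map (k := fun (x : (γ × List (List (Color D)) × Bool) × List (Color D)) c =>
        c :: x.2) (PF.snd.cons PF.fst.snd'))
  · rw [hfold]
    have hl1 : l.length ≤ (StackProg.bin (f c)).length := hl.length_le
    have hl2 : l.length ≤ sz (f c) :=
      hl1.trans ((length_encodeNat_le _).trans (length_lt_sz _).le)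
    refine (sz_le_of_forall (B := 1 + sz (f c) * (B + 1)) fun w hw => ?_).trans ?_
    · refine (sz_le_of_forall fun b _ => hB b).trans ?_
      rw [length_of_mem_words hw]
      gcongr
    · rw [length_words]
      -- The number of words is $(2^l)^{2D}$, and $2^l$ is at most twice the length of the list
      -- unless that list is empty.
      have h2 : (4 ^ D) ^ l.length ≤ (2 * sz (f c)) ^ (2 * D) := by
        rcases Nat.eq_zero_or_pos (f c).length with h0 | h0
        · have : l.length = 0 := by
            have : (StackProg.bin (f c)).length ≤ 0 := h0 ▸ length_encodeNat_le (f c).length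
            omega
          rw [this, pow_zero]
          exact Nat.one_le_pow _ _ (by have := sz_pos (f c); omega)
        · have h3 := two_pow_length_encodeNat_le h0
          calc (4 ^ D) ^ l.length = (2 ^ l.length) ^ (2 * D) := by
                rw [show 4 = 2 ^ 2 by norm_num, ← pow_mul, ← pow_mul, ← pow_mul]
                ring_nf
            _ ≤ (2 ^ (StackProg.bin (f c)).length) ^ (2 * D) := by gcongr; norm_num
            _ ≤ (2 * sz (f c)) ^ (2 * D) := by
                have := (length_lt_sz (f c)).le
                refine Nat.pow_le_pow_left (h3.trans ?_) _
                omega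
      gcongr

/-- Do two words agree in less than the fraction `1 / D` of the positions? -/
def far (D : ℕ) (w w' : List (Color D)) : Bool :=
  decide ((((w.zip w').filter fun x => x.1 = x.2).flatMap fun _ =>
    List.replicate D ()).length < w.length)

theorem PF.far (D : ℕ) : PF fun x : List (Color D) × List (Color D) =>
    StackProg.far D x.1 x.2 := by
  refine PF.length_lt (PF.flatMap (PF.filter (PF.fst.zip .snd) ?_) (.const _)) .fst
  exact PF.finite₂ PF.snd.fst' PF.snd.snd' fun a b => decide (a = b)

/-- A code of words any two of which are far from each other. -/
def codebook (D l : ℕ) : List (List (Color D)) := greedy (far D) (words D l)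

/-- Add one element at every position. -/
def insertWord {D : ℕ} (A : List (Finset (Color D))) (w : List (Color D)) :
    List (Finset (Color D)) :=
  (A.zip w).map fun x => insert x.2 x.1

theorem PF.insertWord {D : ℕ} {f : γ → List (Finset (Color D))} {g : γ → List (Color D)}
    (hf : PF f) (hg : PF g) : PF fun c => StackProg.insertWord (f c) (g c) :=
  (hf.zip hg).map (PF.finite₂ PF.snd.fst' PF.snd.snd' fun a b => insert b a)

/-- The sets of symbols of some words at all positions. -/
def profile {D : ℕ} (l : ℕ) (ws : List (List (Color D))) : List (Finset (Color D)) :=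
  ws.foldl insertWord (List.replicate l ∅)

/-- The elements marked by a bit vector. -/
def marked {α : Type} (v : List Bool) (l : List α) : List α :=
  ((v.zip l).filter fun x => x.1).map fun x => x.2

theorem PF.marked {f : γ → List Bool} {g : γ → List α} (hf : PF f) (hg : PF g) :
    PF fun c => StackProg.marked (f c) (g c) :=
  ((hf.zip hg).filter PF.snd.fst').map PF.snd.snd'

/-- The profiles of all `y`-tuples of words. -/
def tupleProfiles {D : ℕ} (l : ℕ) (ws : List (List (Color D))) : ℕ → List (List (Finset (Color D)))
  | 0 => [List.replicate l ∅]
  | y + 1 => (tupleProfiles l ws y).flatMap fun A => ws.map fun w => insertWord A w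

/-- Do two words differ somewhere? -/
def differ {D : ℕ} (A B : List (Finset (Color D))) : Bool :=
  (A.zip B).any fun x => decide (x.1 ≠ x.2)

theorem PF.differ {D : ℕ} : PF fun x : List (Finset (Color D)) × List (Finset (Color D)) =>
    StackProg.differ x.1 x.2 :=
  (PF.fst.zip PF.snd).any (PF.finite₂ PF.snd.fst' PF.snd.snd' fun a b => decide (a ≠ b))

theorem PF.emptyWord {D : ℕ} {f : γ → List α} (hf : PF f) :
    PF fun c => List.replicate (f c).length (∅ : Finset (Color D)) :=
  (hf.map (k := fun _ _ => ∅) (.const _)).congr fun _ => List.map_const'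

theorem PF.profile {D : ℕ} {f : γ → List α} {ws : γ → List (List (Color D))} (hf : PF f)
    (hws : PF ws) : PF fun c => StackProg.profile (f c).length (ws c) := by
  obtain ⟨B, hB⟩ := sz_bdd_of_finite (Finset (Color D))
  have hlen : ∀ (l : List (List (Color D))) (A : List (Finset (Color D))),
      (l.foldl StackProg.insertWord A).length ≤ A.length := by
    intro l
    induction l with
    | nil => simp
    | cons w l ih =>
      intro A
      refine (ih _).trans ?_
      simp [StackProg.insertWord]
  refine PF.foldl (h := fun _ => StackProg.insertWord) hws hf.emptyWord
    (PF.snd.fst'.insertWord PF.snd.snd') ((PolyBd.const 1).add (hf.sz_bd.mul (.const (B + 1))))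
    fun c l _ => (sz_le_of_forall fun b _ => hB b).trans ?_
  have h1 := (hlen l (List.replicate (f c).length ∅)).trans (by simpa using (length_lt_sz _).le)
  gcongr

/-- Since `y` is a constant, this is a composition of a fixed number of list operations; the degree
of the polynomial may depend on `y`. -/
theorem PF.tupleProfiles {D : ℕ} {f : γ → List α} {ws : γ → List (List (Color D))} (hf : PF f)
    (hws : PF ws) (y : ℕ) : PF fun c => StackProg.tupleProfiles (f c).length (ws c) y := by
  induction y with
  | zero => exact hf.emptyWord.cons (.const [])
  | succ y ih =>
    exact ih.flatMap (k := fun c A => (ws c).map fun w => StackProg.insertWord A w)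
      ((hws.comp .fst).map (k := fun (x : γ × List (Finset (Color D))) w =>
        StackProg.insertWord x.2 w) (PF.fst.snd'.insertWord PF.snd))

/-! ### Block strings -/

/-- The blocks of a string. -/
def parseBlocks (s : List (Option Bool)) : List (List Bool) :=
  s.reverse.foldl (fun acc o => match o with
    | none => [] :: acc
    | some b => (b :: acc.headD []) :: acc.tail) []

theorem parseBlocks_encodeBlocks (bs : List (List Bool)) :
    parseBlocks (encodeBlocks bs) = bs := by
  unfold parseBlocks
  rw [List.foldl_reverse]
  induction bs with
  | nil => rfl
  | cons w bs ih =>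
    have e : encodeBlocks (w :: bs) = w.map some ++ none :: encodeBlocks bs := by
      simp [encodeBlocks]
    rw [e, List.foldr_append, List.foldr_cons, ih]
    clear e ih
    induction w with
    | nil => rfl
    | cons b w ihw => rw [List.map_cons, List.foldr_cons, ihw]; rfl

/-- Every symbol enlarges the list of blocks by a bounded amount, at most six nodes, so the
intermediate values of the fold stay linear in the input. -/
theorem PF.parseBlocks {f : γ → List (Option Bool)} (hf : PF f) :
    PF fun c => StackProg.parseBlocks (f c) := by
  let h : γ → List (List Bool) → Option Bool → List (List Bool) := fun _ acc o => match o with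
    | none => [] :: acc
    | some b => (b :: acc.headD []) :: acc.tail
  have hsz : ∀ acc : List (List Bool), sz (acc.headD []) + sz acc.tail ≤ sz acc + 1 := by
    intro acc
    cases acc with
    | nil => exact le_rfl
    | cons u v => rw [sz_cons]; simp; omega
  refine PF.foldl (h := h) (PF.reverse.comp hf) (.const []) ?_
    ((PolyBd.const 1).add (hf.sz_bd.mul (.const 6))) fun c l hl => ?_
  · refine PF.finite_cases (k := fun x : γ × List (List Bool) × Option Bool => x.2.2)
      (f := fun o x => h x.1 x.2.1 o) PF.snd.snd' fun o => ?_
    cases o with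
    | none => exact (PF.const []).cons PF.snd.fst'
    | some b => exact ((PF.const b).cons (PF.snd.fst'.headD [])).cons PF.snd.fst'.tail
  · have key : ∀ l : List (Option Bool), sz (l.foldl (h c) []) ≤ 1 + l.length * 6 := by
      intro l
      induction l using List.reverseRecOn with
      | nil => exact le_rfl
      | append_singleton l o ih =>
        rw [List.foldl_append, List.foldl_cons, List.foldl_nil, List.length_append]
        have := hsz (l.foldl (h c) [])
        rcases o with _ | b
        · change sz ([] :: l.foldl (h c) []) ≤ _
          rw [sz_cons, sz_nil, List.length_singleton]; omega
        · have hb : sz b ≤ 3 := by cases b <;> simp [sz, rep, Dat.size]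
          change sz ((b :: (l.foldl (h c) []).headD []) :: (l.foldl (h c) []).tail) ≤ _
          rw [sz_cons, sz_cons, List.length_singleton]; omega
    refine (key l).trans ?_
    have h1 := sz_sublist hl.sublist
    rw [sz_reverse] at h1
    have h2 := (length_lt_sz l).le.trans h1
    gcongr

theorem PF.block {f : γ → List Bool} (hf : PF f) : PF fun c => encodeBlocks [f c] :=
  ((hf.map (k := fun _ b => some b) (PF.snd.finite some)).append (.const [none])).congr fun c => by simp [encodeBlocks]

end StackProg

/-! ### Composition with a Turing machine -/

namespace StackProg
open DatRep (rep)
open Turing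

/-! ### Output length of a time-bounded machine -/

section Growth

variable {K : Type} [DecidableEq K] {Γ : K → Type} {Λ σ : Type}

/-- An upper bound for the number of symbols that a statement pushes. -/
def pushes : TM2.Stmt Γ Λ σ → ℕ
  | .push _ _ q => pushes q + 1
  | .peek _ _ q => pushes q
  | .pop _ _ q => pushes q
  | .load _ q => pushes q
  | .branch _ q q' => pushes q + pushes q'
  | .goto _ => 0
  | .halt => 0

theorem length_stepAux_le (q : TM2.Stmt Γ Λ σ) (v : σ) (S : ∀ k, List (Γ k)) (k : K) :
    ((TM2.stepAux q v S).stk k).length ≤ (S k).length + pushes q := by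
  induction q generalizing v S with
  | push k' f q ih =>
    refine (ih _ _).trans ?_
    by_cases h : k = k'
    · subst h; simp [pushes]; omega
    · simp only [Function.update_of_ne h, pushes]; omega
  | peek k' f q ih => exact ih _ _
  | pop k' f q ih =>
    refine (ih _ _).trans ?_
    by_cases h : k = k'
    · subst h; simp [pushes]
    · simp [Function.update_of_ne h, pushes]
  | load f q ih => exact ih _ _
  | branch f q q' ih ih' =>
    rw [TM2.stepAux]
    cases f v
    · exact (ih' _ _).trans (by simp only [pushes]; omega)
    · exact (ih _ _).trans (by simp only [pushes]; omega)
  | goto f => simp [pushes]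
  | halt => simp [pushes]

/-- One step executes one statement and so pushes at most `C` symbols. This bounds the output of a
reduction by its running time, as is needed before another program is run on it. -/
theorem Reach.length_le {M : Λ → TM2.Stmt Γ Λ σ} {C : ℕ} (hC : ∀ l, pushes (M l) ≤ C) (k : K) :
    ∀ (n : ℕ) (c c' : TM2.Cfg Γ Λ σ), Reach M n c c' →
      (c'.stk k).length ≤ (c.stk k).length + n * C := by
  have hnone : ∀ n, (flip bind (TM2.step M))^[n] none = none := by
    intro n
    induction n with
    | zero => rfl
    | succ n ih => rw [Function.iterate_succ_apply]; exact ih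
  intro n
  induction n with
  | zero =>
    intro c c' h
    obtain rfl : c = c' := Option.some.inj h
    simp
  | succ n ih =>
    rintro ⟨l, v, S⟩ c' h
    unfold Reach at h
    rw [Function.iterate_succ_apply] at h
    cases l with
    | none =>
      have h' : (flip bind (TM2.step M))^[n] none = some c' := h
      rw [hnone] at h'
      cases h'
    | some l =>
      have h1 := ih (TM2.stepAux (M l) v S) c' h
      have h2 := length_stepAux_le (M l) v S k
      have h3 := hC l
      rw [Nat.add_mul, one_mul]
      simp only at h1 h2 ⊢
      omega

end Growth

/-! ### Running a program after a machine -/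

section Combine

variable {K : Type} [DecidableEq K] {Γ : K → Type} {Λ σ : Type}

/-- The stacks of a machine together with an output stack. -/
def ExtΓ (Γ : K → Type) : Option K → Type
  | none => Option Bool
  | some k => Γ k

/-- The stacks of a machine, an output stack, and the four work stacks. -/
abbrev AllΓ (Γ : K → Type) : Option K ⊕ Fin 4 → Type :=
  Sum.elim (ExtΓ Γ) fun _ => Option Bool

/-- The contents of the stacks of a machine together with an output stack. -/
def extStk (S : ∀ k, List (Γ k)) (o : List (Option Bool)) : ∀ k, List (ExtΓ Γ k)
  | none => o
  | some k => S k

theorem update_extStk_some (S : ∀ k, List (Γ k)) (o : List (Option Bool)) (k : K)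
    (l : List (Γ k)) :
    Function.update (extStk S o) (some k) l = extStk (Function.update S k l) o := by
  funext k'
  rcases k' with _ | k'
  · exact Function.update_of_ne (by simp) _ _
  · by_cases h : k' = k
    · subst h
      exact (Function.update_self _ _ _).trans (Function.update_self k' l S).symm
    · have e := Function.update_of_ne h l S
      exact (Function.update_of_ne (by simpa using h) _ _).trans e.symm

theorem update_extStk_none (S : ∀ k, List (Γ k)) (o l : List (Option Bool)) :
    Function.update (extStk S o) none l = extStk S l := by
  funext k'
  rcases k' with _ | k'
  · exact Function.update_self _ _ _
  · exact Function.update_of_ne (by simp) _ _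

/-- All stacks. -/
def allStk (S : ∀ k, List (Γ k)) (o : List (Option Bool))
    (W : ∀ _ : Fin 4, List (Option Bool)) : ∀ k, List (AllΓ Γ k) :=
  stkSum (extStk S o) W

theorem update_allStk_some (S : ∀ k, List (Γ k)) (o : List (Option Bool))
    (W : ∀ _ : Fin 4, List (Option Bool)) (k : K) (l : List (Γ k)) :
    Function.update (allStk S o W) (Sum.inl (some k)) l
      = allStk (Function.update S k l) o W :=
  (stkSum_update_inl _ _ _ _).trans (by rw [update_extStk_some]; rfl)

/-- A statement of the first machine in the combined machine; halting leads to `next`. -/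
def transStmt {Λ' : Type} (emb : Λ → Λ') (next : Λ') :
    TM2.Stmt Γ Λ σ → TM2.Stmt (AllΓ Γ) Λ' (σ × Bool)
  | .push k f q => .push (Sum.inl (some k)) (fun v => f v.1) (transStmt emb next q)
  | .peek k f q => .peek (Sum.inl (some k)) (fun v o => (f v.1 o, v.2)) (transStmt emb next q)
  | .pop k f q => .pop (Sum.inl (some k)) (fun v o => (f v.1 o, v.2)) (transStmt emb next q)
  | .load f q => .load (fun v => (f v.1, v.2)) (transStmt emb next q)
  | .branch f q q' => .branch (fun v => f v.1) (transStmt emb next q) (transStmt emb next q')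
  | .goto f => .goto fun v => emb (f v.1)
  | .halt => .goto fun _ => next

/-- A configuration of the first machine in the combined machine. -/
def transCfg {Λ' : Type} (emb : Λ → Λ') (next : Λ') (c : TM2.Cfg Γ Λ σ) :
    TM2.Cfg (AllΓ Γ) Λ' (σ × Bool) :=
  ⟨some (c.l.elim next emb), (c.var, false), allStk c.stk [] fun _ => []⟩

/-- The translated statements leave the flag, the output stack and the work stacks alone, so they
simulate the first machine step by step; halting turns into a jump. -/
theorem stepAux_transStmt {Λ' : Type} (emb : Λ → Λ') (next : Λ') (q : TM2.Stmt Γ Λ σ) (v : σ)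
    (S : ∀ k, List (Γ k)) :
    TM2.stepAux (transStmt emb next q) (v, false) (allStk S [] fun _ => []) =
      transCfg emb next (TM2.stepAux q v S) := by
  induction q generalizing v S with
  | push k f q ih =>
    rw [TM2.stepAux, ← ih, ← update_allStk_some]; rfl
  | peek k f q ih => rw [TM2.stepAux, ← ih]; rfl
  | pop k f q ih =>
    rw [TM2.stepAux, ← ih, ← update_allStk_some]; rfl
  | load f q ih => rw [TM2.stepAux, ← ih]; rfl
  | branch f q q' ih ih' =>
    rw [transStmt, TM2.stepAux, TM2.stepAux, ih, ih']
    cases f v <;> rfl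
  | goto f => rfl
  | halt => rfl

theorem Reach.transCfg {Λ' : Type} {emb : Λ → Λ'} {next : Λ'} {M : Λ → TM2.Stmt Γ Λ σ}
    {M' : Λ' → TM2.Stmt (AllΓ Γ) Λ' (σ × Bool)}
    (hM : ∀ l, M' (emb l) = transStmt emb next (M l)) :
    ∀ (n : ℕ) (c c' : TM2.Cfg Γ Λ σ), Reach M n c c' →
      Reach M' n (StackProg.transCfg emb next c) (StackProg.transCfg emb next c') := by
  have hnone : ∀ n, (flip bind (TM2.step M))^[n] none = none := by
    intro n
    induction n with
    | zero => rfl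
    | succ n ih => rw [Function.iterate_succ_apply]; exact ih
  intro n
  induction n with
  | zero =>
    intro c c' h
    obtain rfl : c = c' := Option.some.inj h
    rfl
  | succ n ih =>
    rintro ⟨l, v, S⟩ c' h
    unfold Reach at h
    rw [Function.iterate_succ_apply] at h
    cases l with
    | none =>
      have h' : (flip bind (TM2.step M))^[n] none = some c' := h
      rw [hnone] at h'
      cases h'
    | some l =>
      have h1 := ih (TM2.stepAux (M l) v S) c' h
      rw [Nat.add_comm]
      refine Reach.trans (Reach.single ?_) h1
      simp only [StackProg.transCfg, Option.elim, TM2.step, hM]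
      rw [stepAux_transStmt]
      rfl

/-! #### Reading and writing block strings -/

/-- The code of a symbol as an element of a represented list. -/
def symCode (x : Option Bool) : List (Option Bool) := some true :: (rep x).enc

/-- Push the symbols of a word one after another onto the first auxiliary stack. -/
def pushSeq : List (Option Bool) → WProg
  | [] => .skip
  | x :: w => .seq (.push 1 x) (pushSeq w)

theorem pushSeq_run (w m a b c : List (Option Bool)) :
    RunLe (pushSeq w) (st m a b c) (st m (w.reverse ++ a) b c) (w.length + 1) := by
  induction w generalizing a with
  | nil => exact .skip _
  | cons x w ih =>
    rw [List.reverse_cons, List.append_assoc]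
    exact (RunLe.seq (.push1 x m a b c) (ih (x :: a))).mono (by simp; omega)

theorem RunLe.lift {X : Type} [DecidableEq X] {ΓX : X → Type} {P : WProg}
    {S S' : ∀ _ : Fin 4, List (Option Bool)} {N : ℕ} (h : RunLe P S S' N)
    (R : ∀ x, List (ΓX x)) : RunLe (P.lift ΓX) (stkSum R S) (stkSum R S') N := by
  obtain ⟨n, hn, h⟩ := h
  exact ⟨n, hn, h.lift R⟩

theorem length_symCode_le (x : Option Bool) : (symCode x).length ≤ 6 := by
  rcases x with _ | _ | _ <;> decide

section Load

variable (k : K) (e : Γ k ≃ Option Bool)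

/-- Is the top symbol of stack `k` the symbol `x`? -/
def isSym (x : Option Bool) (o : Option (Γ k)) : Bool := decide (o.map e = some x)

/-- Transfer the codes of all symbols of stack `k` to the first auxiliary stack. -/
def loadLoop : Prog (AllΓ Γ) :=
  .loop (Sum.inl (some k)) (fun o : Option (Γ k) => o.isSome) <|
    .ite (Sum.inl (some k)) (isSym k e none)
      (.seq (.pop (Sum.inl (some k))) ((pushSeq (symCode none)).lift (ExtΓ Γ))) <|
    .ite (Sum.inl (some k)) (isSym k e (some false))
      (.seq (.pop (Sum.inl (some k))) ((pushSeq (symCode (some false))).lift (ExtΓ Γ)))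
      (.seq (.pop (Sum.inl (some k))) ((pushSeq (symCode (some true))).lift (ExtΓ Γ)))

theorem pop_run (S : ∀ k, List (Γ k)) (s : List (Γ k)) (x : Γ k) (o : List (Option Bool))
    (W : ∀ _ : Fin 4, List (Option Bool)) :
    RunLe (.pop (Sum.inl (some k)) : Prog (AllΓ Γ)) (allStk (Function.update S k (x :: s)) o W)
      (allStk (Function.update S k s) o W) 1 := by
  refine ⟨1, le_rfl, (Run.pop (Γ := AllΓ Γ) (Sum.inl (some k)) _).cast rfl ?_⟩
  have e : (allStk (Function.update S k (x :: s)) o W (Sum.inl (some k))).tail = s := by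
    change (Function.update S k (x :: s) k).tail = s
    rw [Function.update_self]; rfl
  rw [e]
  refine (update_allStk_some _ o W k s).trans ?_
  rw [Function.update_idem]

theorem loadLoop_run (S : ∀ k, List (Γ k)) (s : List (Option Bool)) :
    ∀ (m a b c o : List (Option Bool)), RunLe (loadLoop k e)
      (allStk (Function.update S k (s.map e.symm)) o (st m a b c))
      (allStk (Function.update S k []) o (st m ((s.flatMap symCode).reverse ++ a) b c))
      (s.length * 11 + 1) := by
  induction s with
  | nil =>
    intro m a b c o
    refine RunLe.loop_false (Γ := AllΓ Γ) ?_
    change ((Function.update S k [] k).head?).isSome = false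
    rw [Function.update_self]; rfl
  | cons x s ih =>
    intro m a b c o
    have h := ih m ((symCode x).reverse ++ a) b c o
    have e1 : (List.flatMap symCode (x :: s)).reverse ++ a
        = (List.flatMap symCode s).reverse ++ ((symCode x).reverse ++ a) := by
      simp
    have hhead : (allStk (Function.update S k (List.map e.symm (x :: s))) o (st m a b c)
        (Sum.inl (some k))).head? = some (e.symm x) := by
      change (Function.update S k (List.map e.symm (x :: s)) k).head? = _
      rw [Function.update_self]; rfl
    have hbody : RunLe (.seq (.pop (Sum.inl (some k))) ((pushSeq (symCode x)).lift (ExtΓ Γ)) :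
        Prog (AllΓ Γ)) (allStk (Function.update S k (List.map e.symm (x :: s))) o (st m a b c))
        (allStk (Function.update S k (s.map e.symm)) o (st m ((symCode x).reverse ++ a) b c))
        (1 + 7) :=
      .seq (pop_run k S _ _ o _) (((pushSeq_run (symCode x) m a b c).lift _).mono
        (by have := length_symCode_le x; omega))
    rw [e1, List.length_cons]
    have htest : ∀ y, isSym k e y (allStk (Function.update S k (List.map e.symm (x :: s))) o
        (st m a b c) (Sum.inl (some k))).head? = decide (x = y) := by
      intro y
      rw [hhead]; simp [isSym]
    refine (RunLe.loop_true (N := 10) ?_ ?_ h).mono (by omega)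
    · rw [hhead]; rfl
    · rcases x with _ | _ | _
      · exact (RunLe.ite_true (by rw [htest]; rfl) hbody).mono (by omega)
      · exact RunLe.ite_false (by rw [htest]; rfl) (RunLe.ite_true (by rw [htest]; rfl) hbody)
      · exact RunLe.ite_false (by rw [htest]; rfl) (RunLe.ite_false (by rw [htest]; rfl) hbody)

/-- In prefix notation the tree of a list of symbols is flat: one constant-size code per symbol,
closed by a leaf. Strings and trees can thus be converted symbol by symbol. -/
theorem enc_rep_list (s : List (Option Bool)) :
    (rep s).enc = s.flatMap symCode ++ [some false] := by
  induction s with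
  | nil => rfl
  | cons x s ih =>
    have : (rep (x :: s)).enc = some true :: ((rep x).enc ++ (rep s).enc) := rfl
    rw [this, ih]
    simp [symCode]

/-- Move the string on stack `k` to the main stack as a tree. -/
def load : Prog (AllΓ Γ) :=
  .seq (.push (Sum.inr 1) none) <| .seq (loadLoop k e) <|
    .seq (.push (Sum.inr 1) (some false)) ((unstash 1).lift (ExtΓ Γ))

theorem load_run (S : ∀ k, List (Γ k)) (s : List (Option Bool)) (m a b c o : List (Option Bool)) :
    RunLe (load k e) (allStk (Function.update S k (s.map e.symm)) o (st m a b c))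
      (allStk (Function.update S k []) o (st ((rep s).enc ++ m) a b c))
      (s.length * 11 + 3 + 6 * sz s) := by
  have h : RunLe ((unstash 1).lift (ExtΓ Γ)) (allStk (Function.update S k []) o
      (st m (some false :: ((s.flatMap symCode).reverse ++ none :: a)) b c))
      (allStk (Function.update S k []) o (st ((rep s).enc ++ m) a b c)) (6 * sz s) := by
    have h := (unstashA_run (rep s) m a b c).lift (extStk (Function.update S k []) o)
    have e1 : (rep s).enc.reverse ++ none :: a
        = some false :: ((s.flatMap symCode).reverse ++ none :: a) := by
      rw [enc_rep_list]; simp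
    rw [e1] at h
    exact h
  exact RunLe.mono (.seq ((RunLe.push1 none m a b c).lift _)
    (.seq (loadLoop_run k e S s m (none :: a) b c o)
      (.seq ((RunLe.push1 (some false) _ _ _ _).lift _) h))) (by omega)

end Load

/-- Write the represented string on the main stack to the output stack, in reverse order. -/
def unload (Γ : K → Type) : Prog (AllΓ Γ) :=
  .seq (.loop (Sum.inr 0) isNode <| .seq (.pop (Sum.inr 0)) <| .ite (Sum.inr 0) isNode
    (.seq (.pop (Sum.inr 0)) <| .seq (.pop (Sum.inr 0)) <| .ite (Sum.inr 0) isNode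
      (.seq (.pop (Sum.inr 0)) <| .seq (.pop (Sum.inr 0)) <| .seq (.pop (Sum.inr 0))
        (.push (Sum.inl none) (some true : Option Bool)))
      (.seq (.pop (Sum.inr 0)) (.push (Sum.inl none) (some false : Option Bool))))
    (.seq (.pop (Sum.inr 0)) (.push (Sum.inl none) (none : Option Bool)))) (.pop (Sum.inr 0))

theorem popM_run (S : ∀ k, List (Γ k)) (x : Option Bool) (m a b c o : List (Option Bool)) :
    RunLe (.pop (Sum.inr 0) : Prog (AllΓ Γ)) (allStk S o (st (x :: m) a b c))
      (allStk S o (st m a b c)) 1 :=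
  (RunLe.pop0 x m a b c).lift _

theorem pushOut_run (S : ∀ k, List (Γ k)) (x : Option Bool) (o : List (Option Bool))
    (W : ∀ _ : Fin 4, List (Option Bool)) :
    RunLe (.push (Sum.inl none) x : Prog (AllΓ Γ)) (allStk S o W) (allStk S (x :: o) W) 1 := by
  refine ⟨1, le_rfl, (Run.push (Γ := AllΓ Γ) (Sum.inl none) x _).cast rfl ?_⟩
  refine (stkSum_update_inl _ _ _ _).trans ?_
  exact congrArg (fun R => stkSum R W) (update_extStk_none S o (x :: o))

theorem unload_run (S : ∀ k, List (Γ k)) (s : List (Option Bool)) (m a b c : List (Option Bool)) :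
    ∀ o, RunLe (unload Γ) (allStk S o (st ((rep s).enc ++ m) a b c))
      (allStk S (s.reverse ++ o) (st m a b c)) (s.length * 10 + 2) := by
  intro o
  refine RunLe.seq (N := s.length * 10 + 1) (S' := allStk S (s.reverse ++ o)
    (st (some false :: m) a b c)) ?_ (popM_run S _ m a b c _)
  induction s generalizing o with
  | nil => exact .loop_false rfl
  | cons x s ih =>
    have h := ih (x :: o)
    rw [List.reverse_cons, List.append_assoc, List.length_cons]
    rcases x with _ | _ | _
    · exact (RunLe.loop_true (N := 9) rfl (RunLe.mono (.seq (popM_run S _ _ _ _ _ _)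
        (.ite_false rfl (.seq (popM_run S _ _ _ _ _ _) (pushOut_run S none o _))))
        (by omega)) h).mono (by omega)
    · exact (RunLe.loop_true (N := 9) rfl (RunLe.mono (.seq (popM_run S _ _ _ _ _ _)
        (.ite_true rfl (.seq (popM_run S _ _ _ _ _ _) (.seq (popM_run S _ _ _ _ _ _)
        (.ite_false rfl (.seq (popM_run S _ _ _ _ _ _) (pushOut_run S (some false) o _)))))))
        (by omega)) h).mono (by omega)
    · exact (RunLe.loop_true (N := 9) rfl (RunLe.mono (.seq (popM_run S _ _ _ _ _ _)
        (.ite_true rfl (.seq (popM_run S _ _ _ _ _ _) (.seq (popM_run S _ _ _ _ _ _)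
        (.ite_true rfl (.seq (popM_run S _ _ _ _ _ _) (.seq (popM_run S _ _ _ _ _ _)
        (.seq (popM_run S _ _ _ _ _ _) (pushOut_run S (some true) o _)))))))))
        (by omega)) h).mono (by omega)

end Combine

theorem haltList_stk (tm : FinTM2) (s : List (tm.Γ tm.k₁)) :
    (haltList tm s).stk = Function.update (fun _ => []) tm.k₁ s := by
  funext k
  by_cases h : k = tm.k₁
  · subst h
    rw [Function.update_self]
    simp [haltList]
  · rw [Function.update_of_ne h]
    simp [haltList, h]

theorem initList_stk (tm : FinTM2) (s : List (tm.Γ tm.k₀)) :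
    (initList tm s).stk = Function.update (fun _ => []) tm.k₀ s := by
  funext k
  by_cases h : k = tm.k₀
  · subst h
    rw [Function.update_self]
    simp [initList]
  · rw [Function.update_of_ne h]
    simp [initList, h]

/-- The machine that runs `tm`, then a program on its output, and finally writes the result. -/
noncomputable def combine (tm : FinTM2) (e : tm.Γ tm.k₁ ≃ Option Bool) (P : WProg) : FinTM2 :=
  let Q : Prog (AllΓ tm.Γ) := .seq (load tm.k₁ e) (.seq (P.lift _) (unload tm.Γ))
  have := tm.kFin
  have := tm.ΛFin
  have := tm.σFin
  have := Fintype.ofFinite (Lbl Q)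
  { K := Option tm.K ⊕ Fin 4
    k₀ := Sum.inl (some tm.k₀)
    k₁ := Sum.inl none
    Γ := AllΓ tm.Γ
    Λ := tm.Λ ⊕ Option (Lbl Q)
    main := Sum.inl tm.main
    σ := tm.σ × Bool
    initialState := (tm.initialState, false)
    Γk₀Fin := tm.Γk₀Fin
    m := Sum.elim
      (fun l => transStmt Sum.inl (Sum.inr (some (start Q))) (tm.m l))
      (fun l => l.elim (.load (fun v => (v.1, false)) .halt)
        (code Q (fun l => Sum.inr (some l)) (Sum.inr none))) }

/-- Three phases are chained: the simulated machine, then loading, `P` and unloading, then the final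
halt. The result comes out reversed because unloading pushes its first symbol first. -/
theorem combine_reach (tm : FinTM2) (e : tm.Γ tm.k₁ ≃ Option Bool) (P : WProg)
    (x : List (tm.Γ tm.k₀)) (s s' : List (Option Bool)) (n N : ℕ)
    (h : Reach tm.m n (initList tm x) (haltList tm (s.map e.symm)))
    (hP : RunLe P (st ((rep s).enc ++ []) [] [] []) (st ((rep s').enc ++ []) [] [] []) N) :
    ∃ n' ≤ n + (s.length * 11 + 6 * sz s + N + s'.length * 10 + 6),
      Reach (combine tm e P).m n' (initList (combine tm e P) x)
        (haltList (combine tm e P) s'.reverse) := by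
  have h1 := Reach.transCfg (emb := Sum.inl)
    (M' := (combine tm e P).m) (fun l => rfl) n _ _ h
  have h2 := (load_run tm.k₁ e (fun _ => []) s [] [] [] [] []).seq
    ((hP.lift (extStk (Function.update (fun _ => []) tm.k₁ []) [])).seq
      (unload_run (Function.update (fun _ => []) tm.k₁ []) s' [] [] [] [] []))
  obtain ⟨n2, hn2, h2⟩ := h2
  obtain ⟨b, h3⟩ := h2.reach (combine tm e P).m (fun l => Sum.inr (some l)) (Sum.inr none)
    (fun l => rfl) (tm.initialState, false)
  refine ⟨n + (n2 + 1), by omega, Reach.trans ?_ (Reach.trans h3 (Reach.single ?_))⟩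
  · have e1 : StackProg.transCfg Sum.inl (Sum.inr (some (start _))) (initList tm x)
        = initList (combine tm e P) x := by
      refine congrArg₂ (TM2.Cfg.mk _) rfl ?_
      rw [initList_stk tm x]
      refine (update_allStk_some (fun _ => []) [] (fun _ => []) tm.k₀ x).symm.trans ?_
      refine Eq.trans ?_ (initList_stk (combine tm e P) x).symm
      exact congrArg (fun f : ∀ k, List (AllΓ tm.Γ k) =>
        Function.update f (Sum.inl (some tm.k₀)) x) (funext fun k => by
        rcases k with (_ | k) | k <;> rfl)
    have e2 : StackProg.transCfg Sum.inl (Sum.inr (some (start (.seq (load tm.k₁ e)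
        (.seq (P.lift _) (unload tm.Γ))))))
        (haltList tm (s.map e.symm)) = ⟨some (Sum.inr (some (start _))), (tm.initialState, false),
        allStk (Function.update (fun _ => []) tm.k₁ (s.map e.symm)) [] (st [] [] [] [])⟩ := by
      refine congrArg₂ (TM2.Cfg.mk _) rfl ?_
      rw [haltList_stk]
      exact congrArg (allStk _ []) (funext fun k => by fin_cases k <;> rfl)
    exact Eq.mp (congrArg₂ (Reach (combine tm e P).m n) e1 e2) h1
  · have e3 : (haltList (combine tm e P) s'.reverse).stk =
        allStk (Function.update (fun _ => []) tm.k₁ []) (s'.reverse ++ []) (st [] [] [] []) := by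
      refine (haltList_stk (combine tm e P) s'.reverse).trans ?_
      funext k
      rcases k with (_ | k) | k
      · exact (Function.update_self _ _ _).trans (List.append_nil _).symm
      · refine (Function.update_of_ne (by simp [combine]) _ _).trans ?_
        exact (congrFun (Function.update_eq_self tm.k₁ fun k : tm.K => ([] : List (tm.Γ k))) k).symm
      · refine (Function.update_of_ne (by simp [combine]) _ _).trans ?_
        fin_cases k <;> rfl
    -- The final step also clears the test flag, since a halting configuration must carry the
    -- initial internal state.
    change some _ = some _
    refine congrArg some (congrArg₂ (TM2.Cfg.mk _) rfl e3.symm)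

/-- A polynomial-time reduction followed by a polynomial-time function on strings. -/
theorem polyTime_comp {I J J' Γ₁ : Type} {ea : I → List Γ₁} {eb : J → List (Option Bool)}
    {f : I → J} (hf : PolyTime ea eb f) {G : List (Option Bool) → List (Option Bool)} (hG : PF G)
    {ec : J' → List (Option Bool)} {g : J → J'} (hg : ∀ j, G (eb j) = ec (g j)) :
    PolyTime ea ec fun x => g (f x) := by
  obtain ⟨⟨⟨tm, ein, eout⟩, time, hout⟩⟩ := hf
  -- The program computes the reversed string in order to cancel the reversal by `unload`.
  obtain ⟨P, p, hP⟩ := (PF.reverse.comp hG).run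
  obtain ⟨q, hq⟩ := (PF.reverse.comp hG).sz_bd
  obtain ⟨B, hB⟩ := sz_bdd_of_finite (Option Bool)
  have := tm.ΛFin
  let C := ∑ l, pushes (tm.m l)
  have hC : ∀ l, pushes (tm.m l) ≤ C := fun l =>
    Finset.single_le_sum (f := fun l => pushes (tm.m l)) (fun _ _ => Nat.zero_le _)
      (Finset.mem_univ l)
  let len : Polynomial ℕ := .X + time * .C C
  let size : Polynomial ℕ := 1 + len * .C (B + 1)
  refine ⟨⟨⟨combine tm eout P, ein, Equiv.refl _⟩,
    time + (len * .C 11 + .C 6 * size + p.comp size + q.comp size * .C 10 + .C 6), fun a => ?_⟩⟩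
  let s := eb (f a)
  have hreach : Reach tm.m (hout a).steps (initList tm ((ea a).map ein.invFun))
      (haltList tm (s.map eout.symm)) := (hout a).evals_in_steps
  -- The output of the first machine has at most its input length plus `C` symbols per step.
  have hlen : s.length ≤ len.eval (ea a).length := by
    have h := Reach.length_le hC tm.k₁ _ _ _ hreach
    rw [haltList_stk, Function.update_self, List.length_map] at h
    have h2 : ((initList tm ((ea a).map ein.invFun)).stk tm.k₁).length ≤ (ea a).length := by
      rw [initList_stk]
      by_cases hk : tm.k₁ = tm.k₀
      · have : ∀ (k : tm.K) (_ : k = tm.k₀) (l : List (tm.Γ tm.k₀)),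
            (Function.update (fun k : tm.K => ([] : List (tm.Γ k))) tm.k₀ l k).length
              ≤ l.length := by
          rintro k rfl l
          rw [Function.update_self]
        exact (this _ hk _).trans (by simp)
      · rw [Function.update_of_ne hk]; simp
    have h3 : (hout a).steps * C ≤ time.eval (ea a).length * C :=
      Nat.mul_le_mul_right _ (hout a).steps_le_m
    simp only [len, Polynomial.eval_add, Polynomial.eval_X, Polynomial.eval_mul,
      Polynomial.eval_C]
    omega
  have hsize : sz s ≤ size.eval (ea a).length := by
    refine (sz_le_of_forall fun b _ => hB b).trans ?_
    simp only [size, Polynomial.eval_add, Polynomial.eval_one, Polynomial.eval_mul,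
      Polynomial.eval_C]
    gcongr
  have hex := combine_reach tm eout P _ s (G s).reverse _ _ hreach (hP s [] [] [] [])
  refine ⟨⟨hex.choose, ?_⟩, hex.choose_spec.1.trans ?_⟩
  · have e : (G s).reverse.reverse = (ec (g (f a))).map (Equiv.refl (Option Bool)).invFun := by
      rw [← hg, List.reverse_reverse]; exact (List.map_id _).symm
    exact Eq.trans (id hex.choose_spec.2 : _ = _)
      (congrArg (fun l => some (haltList (combine tm eout P) l)) e)
  · have h1 := (hout a).steps_le_m
    have h2 : p.eval (sz s) ≤ p.eval (size.eval (ea a).length) := eval_mono p hsize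
    have h3 : (G s).reverse.length ≤ q.eval (size.eval (ea a).length) :=
      (length_lt_sz _).le.trans ((hq s).trans (eval_mono q hsize))
    simp only [Polynomial.eval_add, Polynomial.eval_mul, Polynomial.eval_C, Polynomial.eval_comp]
    omega

end StackProg

/-! ### Properties of the codes and profiles -/

namespace StackProg

section Greedy

variable {α : Type} (R : α → α → Bool)

theorem greedy_subset (l : List α) : ∀ x ∈ greedy R l, x ∈ l := by
  induction l using List.reverseRecOn with
  | nil => simp [greedy]
  | append_singleton l a ih =>
    rw [greedy_append_singleton]
    intro x hx
    split_ifs at hx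
    · rcases List.mem_cons.1 hx with rfl | hx
      · simp
      · simp [ih x hx]
    · simp [ih x hx]

theorem pairwise_greedy (l : List α) : (greedy R l).Pairwise fun x y => R x y = true := by
  induction l using List.reverseRecOn with
  | nil => simp [greedy]
  | append_singleton l a ih =>
    rw [greedy_append_singleton]
    split_ifs with h
    · exact List.pairwise_cons.2 ⟨List.all_eq_true.1 h, ih⟩
    · exact ih

theorem length_greedy_le (l : List α) : (greedy R l).length ≤ l.length := by
  induction l using List.reverseRecOn with
  | nil => simp [greedy]
  | append_singleton l a ih =>
    rw [greedy_append_singleton]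
    split_ifs with h <;> simp <;> omega

/-- An element is rejected only because of one that has been kept, and kept elements are never
removed. For codes this says that the neighborhoods of the code words cover everything. -/
theorem greedy_maximal (l : List α) {x : α} (hx : x ∈ l) :
    x ∈ greedy R l ∨ ∃ y ∈ greedy R l, R x y = false := by
  induction l using List.reverseRecOn with
  | nil => simp at hx
  | append_singleton l a ih =>
    rw [greedy_append_singleton]
    rcases List.mem_append.1 hx with hx | hx
    · split_ifs with h
      · rcases ih hx with h1 | ⟨y, hy, h1⟩
        · exact .inl (List.mem_cons_of_mem _ h1)
        · exact .inr ⟨y, List.mem_cons_of_mem _ hy, h1⟩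
      · exact ih hx
    · obtain rfl := List.mem_singleton.1 hx
      split_ifs with h
      · exact .inl List.mem_cons_self
      · right
        simpa using h

end Greedy

/-! ### A Gilbert–Varshamov bound for the greedy code -/

variable {D : ℕ}

/-- The number of positions at which two words agree. -/
def agree (w w' : List (Color D)) : ℕ :=
  ((w.zip w').filter fun x => x.1 = x.2).length

theorem agree_cons (a b : Color D) (w w' : List (Color D)) :
    agree (a :: w) (b :: w') = (if a = b then 1 else 0) + agree w w' := by
  by_cases h : a = b <;> simp [agree, h]; omega

theorem far_iff (w w' : List (Color D)) : far D w w' = true ↔ agree w w' * D < w.length := by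
  simp [far, agree, List.length_flatMap]

theorem agree_self (w : List (Color D)) : agree w w = w.length := by
  induction w with
  | nil => rfl
  | cons a w ih => rw [agree_cons, ih]; simp; omega

theorem sum_agree (w w' : List (Color D)) (h : w.length = w'.length) :
    ∑ j ∈ Finset.range w.length, (if w[j]? = w'[j]? then 1 else 0) = agree w w' := by
  induction w generalizing w' with
  | nil => simp [agree]
  | cons a w ih =>
    cases w' with
    | nil => simp at h
    | cons b w' =>
      rw [List.length_cons, Finset.sum_range_succ', agree_cons, ← ih w' (by simpa using h),
        Nat.add_comm]
      simp

theorem card_agree (w w' : List (Color D)) {l : ℕ} (h : w.length = l) (h' : w'.length = l) :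
    ((Finset.range l).filter fun j => w[j]? = w'[j]?).card = agree w w' := by
  rw [Finset.card_filter, ← sum_agree w w' (h.trans h'.symm), h]

/-- An exponential moment, which factors over the positions: the agreeing symbol contributes $4^D$,
and the others contribute at most $4^D$ in total. -/
theorem sum_pow_agree (c : List (Color D)) :
    ((words D c.length).map fun w => (4 ^ D) ^ agree w c).sum ≤ (2 * 4 ^ D) ^ c.length := by
  induction c with
  | nil => simp [words, agree]
  | cons b c ih =>
    have key : ∀ w : List (Color D), (((List.finRange (4 ^ D)).map fun a => a :: w).map
        fun w => (4 ^ D) ^ agree w (b :: c)).sum ≤ (2 * 4 ^ D) * (4 ^ D) ^ agree w c := by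
      intro w
      rw [List.map_map]
      have : (List.map ((fun w => (4 ^ D) ^ agree w (b :: c)) ∘ fun a => a :: w)
          (List.finRange (4 ^ D))).sum = ∑ a : Color D, (4 ^ D) ^ agree (a :: w) (b :: c) := by
        rw [← List.ofFn_eq_map, List.sum_ofFn]; rfl
      rw [this]
      calc ∑ a : Color D, (4 ^ D) ^ agree (a :: w) (b :: c)
          ≤ ∑ a : Color D, ((if a = b then 4 ^ D * (4 ^ D) ^ agree w c else 0)
              + (4 ^ D) ^ agree w c) := by
            refine Finset.sum_le_sum fun a _ => ?_
            rw [agree_cons]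
            split_ifs
            · rw [pow_add, pow_one]; omega
            · rw [Nat.zero_add, Nat.zero_add]
        _ = (2 * 4 ^ D) * (4 ^ D) ^ agree w c := by
            rw [Finset.sum_add_distrib]
            simp
            ring
    rw [List.length_cons, words, List.map_flatMap, pow_succ, List.flatMap, List.sum_flatten,
      List.map_map]
    refine (List.sum_le_sum (g := fun w => (2 * 4 ^ D) * (4 ^ D) ^ agree w c)
      fun w _ => key w).trans ?_
    rw [List.sum_map_mul_left, Nat.mul_comm]
    exact Nat.mul_le_mul_right _ ih

/-- Markov's inequality for the exponential moment: a word that is not far from `c` agrees with it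
in at least $l/D$ places and so has weight at least $(4^D)^{l/D}=4^l$, while the total weight is at
most $(2\cdot4^D)^l$. -/
theorem count_not_far (c : List (Color D)) :
    (words D c.length).countP (fun w => !far D w c) * 2 ^ c.length ≤ (4 ^ D) ^ c.length := by
  have h1 : (words D c.length).countP (fun w => !far D w c) * 4 ^ c.length
      ≤ ((words D c.length).map fun w => (4 ^ D) ^ agree w c).sum := by
    have : ∀ w ∈ words D c.length, (if !far D w c then 4 ^ c.length else 0)
        ≤ (4 ^ D) ^ agree w c := by
      intro w hw
      split_ifs with h
      · have h2 : ¬ agree w c * D < w.length := by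
          rw [← far_iff]; simpa using h
        rw [length_of_mem_words hw] at h2
        rw [← pow_mul]
        exact Nat.pow_le_pow_right (by norm_num) (by rw [Nat.mul_comm]; omega)
      · exact Nat.zero_le _
    refine le_trans (le_of_eq ?_) (List.sum_le_sum this)
    generalize words D c.length = W
    induction W with
    | nil => simp
    | cons w W ih =>
      rw [List.map_cons, List.sum_cons, ← ih, List.countP_cons]
      split_ifs <;> ring
  have h2 := h1.trans (sum_pow_agree c)
  rw [mul_pow] at h2
  have h3 : (4 : ℕ) ^ c.length = 2 ^ c.length * 2 ^ c.length := by
    rw [← mul_pow]; norm_num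
  rw [h3, ← mul_assoc, mul_comm (2 ^ c.length) ((4 ^ D) ^ c.length)] at h2
  exact Nat.le_of_mul_le_mul_right h2 (by positivity)

theorem length_of_mem_codebook {l : ℕ} {w : List (Color D)} (h : w ∈ codebook D l) :
    w.length = l :=
  length_of_mem_words (greedy_subset _ _ _ h)

/-- By maximality the neighborhoods of the code words cover all $(4^D)^l$ words, and each contains
at most a fraction $2^{-l}$ of them. Double counting of the pairs gives the bound. -/
theorem two_pow_le_length_codebook (hD : 0 < D) (l : ℕ) : 2 ^ l ≤ (codebook D l).length := by
  have h1 : (words D l).length ≤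
      ((codebook D l).map fun c => (words D l).countP fun w => !far D w c).sum := by
    have h2 : ∀ w ∈ words D l, 1 ≤ (codebook D l).countP fun c => !far D w c := by
      intro w hw
      rw [Nat.one_le_iff_ne_zero, ← Nat.pos_iff_ne_zero, List.countP_pos_iff]
      rcases greedy_maximal (far D) _ hw with h | ⟨c, hc, h⟩
      · refine ⟨w, h, ?_⟩
        have : ¬ (far D w w = true) := by
          rw [far_iff, agree_self, not_lt]; exact Nat.le_mul_of_pos_right _ hD
        simpa using this
      · exact ⟨c, hc, by simp [h]⟩
    have h3 : (words D l).length ≤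
        ((words D l).map fun w => (codebook D l).countP fun c => !far D w c).sum := by
      have := List.sum_le_sum (f := fun _ => 1) h2
      simpa using this
    refine h3.trans (le_of_eq ?_)
    have swap : ∀ (A B : List (List (Color D))),
        (A.map fun w => B.countP fun c => !far D w c).sum
          = (B.map fun c => A.countP fun w => !far D w c).sum := by
      intro A B
      induction A with
      | nil => simp
      | cons w A ih =>
        rw [List.map_cons, List.sum_cons, ih]
        simp only [List.countP_cons]
        rw [List.sum_map_add, Nat.add_comm]
        congr 1
        clear ih
        induction B with
        | nil => rfl
        | cons c B ih => rw [List.countP_cons, List.map_cons, List.sum_cons, ih, Nat.add_comm]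
    exact swap _ _
  have h4 : ((codebook D l).map fun c => (words D l).countP fun w => !far D w c).sum * 2 ^ l
      ≤ (codebook D l).length * (4 ^ D) ^ l := by
    rw [← List.sum_map_mul_right]
    refine (List.sum_le_card_nsmul _ ((4 ^ D) ^ l) fun x hx => ?_).trans (by simp)
    obtain ⟨c, hc, rfl⟩ := List.mem_map.1 hx
    have := count_not_far c
    rwa [length_of_mem_codebook hc] at this
  rw [length_words] at h1
  have h5 := (Nat.mul_le_mul_right (2 ^ l) h1).trans h4
  rw [Nat.mul_comm] at h5
  exact Nat.le_of_mul_le_mul_right h5 (by positivity)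

theorem agree_comm (w w' : List (Color D)) : agree w w' = agree w' w := by
  induction w generalizing w' with
  | nil => cases w' <;> rfl
  | cons a w ih =>
    cases w' with
    | nil => rfl
    | cons b w' => rw [agree_cons, agree_cons, ih]; simp only [eq_comm]

theorem agree_codebook {l : ℕ} {i j : ℕ} (hi : i < (codebook D l).length)
    (hj : j < (codebook D l).length) (hij : i ≠ j) :
    agree (codebook D l)[i] (codebook D l)[j] * D < l := by
  have h : ∀ (i j : ℕ) (_ : i < (codebook D l).length) (_ : j < (codebook D l).length), i < j →
      far D (codebook D l)[i] (codebook D l)[j] = true :=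
    List.pairwise_iff_getElem.1 (pairwise_greedy (far D) (words D l))
  rcases lt_or_gt_of_ne hij with hlt | hlt
  · have h1 := (far_iff _ _).1 (h i j hi hj hlt)
    rwa [length_of_mem_codebook (List.getElem_mem hi)] at h1
  · have h1 := (far_iff _ _).1 (h j i hj hi hlt)
    rw [length_of_mem_codebook (List.getElem_mem hj)] at h1
    rwa [agree_comm]

/-! #### Profiles -/

theorem length_insertWord {A : List (Finset (Color D))} {w : List (Color D)} {l : ℕ}
    (hA : A.length = l) (hw : w.length = l) : (insertWord A w).length = l := by
  simp [insertWord, hA, hw]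

theorem profile_append_singleton (l : ℕ) (ws : List (List (Color D))) (w : List (Color D)) :
    profile l (ws ++ [w]) = insertWord (profile l ws) w := by
  simp [profile]

theorem length_profile {l : ℕ} {ws : List (List (Color D))} (h : ∀ w ∈ ws, w.length = l) :
    (profile l ws).length = l := by
  induction ws using List.reverseRecOn with
  | nil => simp [profile]
  | append_singleton ws w ih =>
    rw [profile_append_singleton]
    exact length_insertWord (ih fun w' hw' => h w' (by simp [hw'])) (h w (by simp))

theorem profile_getElem? {l : ℕ} {ws : List (List (Color D))} (h : ∀ w ∈ ws, w.length = l)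
    {j : ℕ} (hj : j < l) : ∃ A, (profile l ws)[j]? = some A ∧
      ∀ a, a ∈ A ↔ ∃ w ∈ ws, w[j]? = some a := by
  induction ws using List.reverseRecOn with
  | nil => exact ⟨∅, by simp [profile, hj], by simp⟩
  | append_singleton ws w ih =>
    obtain ⟨A, hA, hmem⟩ := ih fun w' hw' => h w' (by simp [hw'])
    have hw := h w (by simp)
    have hj' : j < w.length := hw ▸ hj
    refine ⟨insert w[j] A, ?_, fun a => ?_⟩
    · have : (insertWord (profile l ws) w)[j]? =
          (((profile l ws).zip w)[j]?).map fun x => insert x.2 x.1 := by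
        simp [insertWord]
      have hz : ((profile l ws).zip w)[j]? = some (A, w[j]) :=
        List.getElem?_zip_eq_some.2 ⟨hA, List.getElem?_eq_getElem hj'⟩
      rw [profile_append_singleton, this, hz]
      rfl
    · rw [Finset.mem_insert, hmem]
      constructor
      · rintro (rfl | ⟨w', hw', h'⟩)
        · exact ⟨w, by simp, by simp⟩
        · exact ⟨w', by simp [hw'], h'⟩
      · rintro ⟨w', hw', h'⟩
        rcases List.mem_append.1 hw' with hw' | hw'
        · exact .inr ⟨w', hw', h'⟩
        · obtain rfl := List.mem_singleton.1 hw'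
          rw [List.getElem?_eq_getElem hj'] at h'
          exact .inl (Option.some.inj h').symm

theorem mem_tupleProfiles {l : ℕ} {ws : List (List (Color D))} {y : ℕ}
    {A : List (Finset (Color D))} : A ∈ tupleProfiles l ws y ↔
      ∃ t : List (List (Color D)), t.length = y ∧ (∀ w ∈ t, w ∈ ws) ∧ A = profile l t := by
  induction y generalizing A with
  | zero =>
    simp only [tupleProfiles, List.mem_singleton, List.length_eq_zero_iff]
    constructor
    · rintro rfl; exact ⟨[], rfl, by simp, rfl⟩
    · rintro ⟨t, rfl, _, rfl⟩; rfl
  | succ y ih =>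
    simp only [tupleProfiles, List.mem_flatMap, List.mem_map]
    constructor
    · rintro ⟨B, hB, w, hw, rfl⟩
      obtain ⟨t, ht, hmem, rfl⟩ := ih.1 hB
      refine ⟨t ++ [w], by simp [ht], fun w' hw' => ?_, (profile_append_singleton _ _ _).symm⟩
      rcases List.mem_append.1 hw' with h | h
      · exact hmem _ h
      · obtain rfl := List.mem_singleton.1 h; exact hw
    · rintro ⟨t, ht, hmem, rfl⟩
      obtain ⟨t', w, rfl⟩ : ∃ t' w, t = t' ++ [w] :=
        ⟨t.dropLast, t.getLast (by rintro rfl; exact absurd ht (by simp)),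
          (List.dropLast_append_getLast _).symm⟩
      refine ⟨profile l t', ih.2 ⟨t', by simpa using ht, fun w' hw' => hmem w' (by simp [hw']),
        rfl⟩, w, hmem w (by simp), (profile_append_singleton _ _ _).symm⟩

theorem length_tupleProfiles (l : ℕ) (ws : List (List (Color D))) (y : ℕ) :
    (tupleProfiles l ws y).length = ws.length ^ y := by
  induction y with
  | zero => rfl
  | succ y ih => simp [tupleProfiles, List.length_flatMap, ih, pow_succ]

theorem differ_eq_false {A B : List (Finset (Color D))} (h : A.length = B.length)
    (hd : differ A B = false) : A = B := by
  induction A generalizing B with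
  | nil => exact (List.length_eq_zero_iff.1 h.symm).symm
  | cons a A ih =>
    cases B with
    | nil => simp at h
    | cons b B =>
      simp only [differ, List.zip_cons_cons, List.any_cons, Bool.or_eq_false_iff] at hd
      rw [ih (by simpa using h) hd.2]
      simpa using hd.1

theorem differ_self (A : List (Finset (Color D))) : differ A A = false := by
  induction A with
  | nil => rfl
  | cons a A ih =>
    simp only [differ, List.zip_cons_cons, List.any_cons, Bool.or_eq_false_iff]
    exact ⟨by simp, ih⟩

theorem mem_marked {α : Type} {n : ℕ} (b : Fin n → Bool) (l : List α) (x : α) :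
    x ∈ marked (List.ofFn b) l ↔ ∃ i : Fin n, b i = true ∧ l[(i : ℕ)]? = some x := by
  simp only [marked, List.mem_map, List.mem_filter, Prod.exists]
  constructor
  · rintro ⟨b', x', ⟨hz, hb⟩, rfl⟩
    obtain ⟨i, hi⟩ := List.mem_iff_getElem?.1 hz
    obtain ⟨h1, h2⟩ := List.getElem?_zip_eq_some.1 hi
    simp only at h1 h2 hb
    rw [List.getElem?_ofFn] at h1
    split_ifs at h1 with hn
    exact ⟨⟨i, hn⟩, (Option.some.inj h1).trans hb, h2⟩
  · rintro ⟨i, hb, hi⟩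
    refine ⟨true, x, ⟨List.mem_iff_getElem?.2 ⟨i, List.getElem?_zip_eq_some.2 ⟨?_, hi⟩⟩, rfl⟩, rfl⟩
    simp [hb]

end StackProg

/-! ### The reduction as a function on strings and on instances -/

namespace StackProg
open DatRep (rep)
variable {γ : Type} [DatRep γ]

section Words

variable (D K : ℕ) (vecs : List (List Bool))

/-- The copies of one point, in unary. -/
def copyUnits : List Unit := (vecs.headD []).flatMap fun _ => List.replicate K ()

/-- The number of points, in unary. -/
def units : List Unit := vecs.flatMap fun _ => copyUnits K vecs

/-- The length of the code words. -/
def wordLen : ℕ := (bin (units K vecs)).length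

/-- The code in use. -/
def book : List (List (Color D)) := codebook D (wordLen K vecs)

/-- The code words of all elements of the universe. -/
def vertexWords : List (List (Color D)) :=
  ((vecs.headD []).zip (book D K vecs)).map fun x => x.2

/-- The code words that distinguish the copies of a point. -/
def copyWords : List (List (Color D)) :=
  ((copyUnits K vecs).zip (book D K vecs)).map fun x => x.2

/-- The points as words. -/
def pointWords : List (List (Finset (Color D) × Color D)) :=
  vecs.flatMap fun v => (copyWords D K vecs).map fun w =>
    (profile (wordLen K vecs) (marked v (book D K vecs))).zip w

/-- The candidate centers as words. -/
def centerWords (y : ℕ) : List (List (Finset (Color D))) :=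
  greedy differ (tupleProfiles (wordLen K vecs) (vertexWords D K vecs) y)

end Words

section WordsPF

variable (D K : ℕ) {f : γ → List (List Bool)} (hf : PF f)
include hf

theorem PF.copyUnits : PF fun c => StackProg.copyUnits K (f c) :=
  (hf.headD []).flatMap (.const _)

theorem PF.units : PF fun c => StackProg.units K (f c) :=
  hf.flatMap ((hf.copyUnits K).comp .fst)

theorem PF.book : PF fun c => StackProg.book D K (f c) :=
  ((hf.units K).words D).greedy (PF.far D)

theorem PF.vertexWords : PF fun c => StackProg.vertexWords D K (f c) :=
  ((hf.headD []).zip (hf.book D K)).map PF.snd.snd'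

theorem PF.copyWords : PF fun c => StackProg.copyWords D K (f c) :=
  ((hf.copyUnits K).zip (hf.book D K)).map PF.snd.snd'

theorem PF.pointWords : PF fun c => StackProg.pointWords D K (f c) := by
  refine hf.flatMap (k := fun c v => (StackProg.copyWords D K (f c)).map fun w =>
    (StackProg.profile (wordLen K (f c)) (StackProg.marked v (StackProg.book D K (f c)))).zip w) ?_
  refine ((hf.copyWords D K).comp PF.fst).map (k := fun (x : γ × List Bool) w =>
    (StackProg.profile (wordLen K (f x.1))
      (StackProg.marked x.2 (StackProg.book D K (f x.1)))).zip w) ?_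
  exact ((((hf.units K).bin.comp PF.fst).profile (PF.snd.marked
    ((hf.book D K).comp PF.fst))).comp PF.fst).zip PF.snd

theorem PF.centerWords (y : ℕ) : PF fun c => StackProg.centerWords D K (f c) y :=
  ((hf.units K).bin.tupleProfiles (hf.vertexWords D K) y).greedy PF.differ

end WordsPF

/-- The string of a rational vector. -/
def ratStr {d : ℕ} (v : Fin d → ℚ) : List (Option Bool) :=
  encodeBlocks ((List.ofFn v).flatMap encodeRat)

variable {D d : ℕ} (K y : ℕ) (PA : Finset (Color D) × Color D → Fin d → ℚ)
  (PB : Finset (Color D) → Fin d → ℚ)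

/-- The reduction on strings. -/
def reduceString (s : List (Option Bool)) : List (Option Bool) :=
  encodeBlocks [bin ((bin (units K (parseBlocks s).tail)).flatMap fun _ => List.replicate d ())] ++
  (encodeBlocks [bin (units K (parseBlocks s).tail)] ++
  (encodeBlocks [bin (centerWords D K (parseBlocks s).tail y)] ++
  (encodeBlocks [(parseBlocks s).headD []] ++
  (((pointWords D K (parseBlocks s).tail).flatMap fun p => p.flatMap fun x => ratStr (PA x)) ++
  (centerWords D K (parseBlocks s).tail y).flatMap fun A => A.flatMap fun a => ratStr (PB a)))))

theorem PF.reduceString : PF (StackProg.reduceString K y PA PB) := by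
  have hp : PF StackProg.parseBlocks := PF.id.parseBlocks
  have hv := hp.tail
  refine (((hv.units K).bin.flatMap (.const _)).bin.block).append ((hv.units K).bin.block.append
    ((hv.centerWords D K y).bin.block.append ((hp.headD []).block.append (.append ?_ ?_))))
  · refine (hv.pointWords D K).flatMap (k := fun _ p => p.flatMap fun x => ratStr (PA x)) ?_
    refine PF.snd.flatMap (k := fun _ x => ratStr (PA x)) ?_
    exact PF.finite₂ PF.snd.fst' PF.snd.snd' fun a b => ratStr (PA (a, b))
  · refine (hv.centerWords D K y).flatMap (k := fun _ p => p.flatMap fun x => ratStr (PB x)) ?_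
    refine PF.snd.flatMap (k := fun _ x => ratStr (PB x)) ?_
    exact PF.finite PF.snd fun a => ratStr (PB a)

/-! #### Instances -/

/-- Concatenation of the vectors of the letters of a word. -/
def realize {X : Type} (g : X → Fin d → ℚ) (l : ℕ) (w : List X) (i : Fin (l * d)) : ℚ :=
  (w[(i.divNat : ℕ)]?).elim 0 fun x => g x i.modNat

theorem ofFn_realize {X : Type} (g : X → Fin d → ℚ) {l : ℕ} {w : List X} (hw : w.length = l) :
    List.ofFn (realize g l w) = w.flatMap fun x => List.ofFn (g x) := by
  subst hw
  rw [List.ofFn_mul, List.flatMap_def]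
  congr 1
  refine List.ext_getElem (by simp) fun i h1 h2 => ?_
  simp only [List.getElem_ofFn, List.getElem_map]
  have hi : i < w.length := by simpa using h1
  congr 1
  funext j
  have hd : 0 < d := j.pos
  have e1 : (i * d + (j : ℕ)) / d = i := by
    rw [Nat.mul_comm, Nat.mul_add_div hd, Nat.div_eq_of_lt j.2, Nat.add_zero]
  have e2 : (i * d + (j : ℕ)) % d = j := by
    rw [Nat.mul_comm, Nat.mul_add_mod, Nat.mod_eq_of_lt j.2]
  have e3 : ∀ h, (Fin.modNat (⟨i * d + (j : ℕ), h⟩ : Fin (w.length * d))) = j :=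
    fun h => Fin.ext e2
  simp only [realize, Fin.divNat, e1, e3, List.getElem?_eq_getElem hi, Option.elim]

theorem realize_injOn {X : Type} {g : X → Fin d → ℚ} (hg : Function.Injective g) {l : ℕ}
    {w w' : List X} (hw : w.length = l) (hw' : w'.length = l)
    (h : realize g l w = realize g l w') : w = w' := by
  have h1 : List.ofFn (realize g l w) = List.ofFn (realize g l w') := by rw [h]
  rw [ofFn_realize g hw, ofFn_realize g hw'] at h1
  clear h
  have hlen : w.length = w'.length := hw.trans hw'.symm
  clear hw hw'
  induction w generalizing w' with
  | nil => exact (List.length_eq_zero_iff.1 hlen.symm).symm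
  | cons x w ih =>
    cases w' with
    | nil => simp at hlen
    | cons x' w' =>
      rw [List.flatMap_cons, List.flatMap_cons] at h1
      obtain ⟨e1, e2⟩ := List.append_inj h1 (by simp)
      rw [hg (List.ofFn_injective e1), ih e2 (by simpa using hlen)]

/-- The characteristic vectors of the edges. -/
def vectors {z : ℕ} (I : JCInstance z) : List (List Bool) :=
  I.edges.map fun T => List.ofFn fun i => decide (i ∈ T)

/-- The reduction on instances. -/
def reduce {z : ℕ} (I : JCInstance z) : KMedianInstance where
  d := wordLen K (vectors I) * d
  k := I.k
  points := ((pointWords D K (vectors I)).map (realize PA (wordLen K (vectors I)))).dedup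
  centers := ((centerWords D K (vectors I) y).map (realize PB (wordLen K (vectors I)))).dedup
  points_nodup := List.nodup_dedup _
  centers_nodup := List.nodup_dedup _

theorem parseBlocks_encode {z : ℕ} (I : JCInstance z) :
    parseBlocks I.encode = Computability.encodeNat I.k :: vectors I :=
  parseBlocks_encodeBlocks _

theorem headD_vectors_length {z : ℕ} (I : JCInstance z) :
    ((vectors I).headD []).length = I.n := by
  rcases h : I.edges with _ | ⟨T, E⟩
  · exact absurd h I.nonempty
  · simp [vectors, h]

theorem length_vectors {z : ℕ} (I : JCInstance z) : (vectors I).length = I.edges.length := by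
  simp [vectors]

theorem length_copyUnits {z : ℕ} (I : JCInstance z) :
    (copyUnits K (vectors I)).length = I.n * K := by
  simp [copyUnits, List.length_flatMap, ← headD_vectors_length]

theorem length_units {z : ℕ} (I : JCInstance z) :
    (units K (vectors I)).length = I.edges.length * (I.n * K) := by
  simp [units, List.length_flatMap, length_copyUnits, length_vectors]

variable {K}

/-- The word length is the bit length of the number of points, so already $2^l$ exceeds that number.
Hence there are enough code words both for the universe and for the copies. -/
theorem units_lt_book (hD : 0 < D) {z : ℕ} (I : JCInstance z) :
    (units K (vectors I)).length < (book D K (vectors I)).length :=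
  (lt_two_pow_length_encodeNat _).trans_le (two_pow_le_length_codebook hD _)

theorem copies_lt_book (hD : 0 < D) {z : ℕ} (I : JCInstance z) :
    I.n * K < (book D K (vectors I)).length := by
  refine lt_of_le_of_lt ?_ (units_lt_book hD I)
  rw [length_units]
  exact Nat.le_mul_of_pos_left _ (List.length_pos_iff.2 I.nonempty)

theorem map_snd_zip_eq_take {α β : Type} (l : List α) (l' : List β) :
    (l.zip l').map (fun x => x.2) = l'.take l.length := by
  induction l generalizing l' with
  | nil => rfl
  | cons a l ih => cases l' with
    | nil => rfl
    | cons b l' => simp [ih]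

theorem copyWords_eq {z : ℕ} (I : JCInstance z) :
    copyWords D K (vectors I) = (book D K (vectors I)).take (I.n * K) := by
  rw [copyWords, map_snd_zip_eq_take, length_copyUnits]

theorem length_copyWords (hD : 0 < D) {z : ℕ} (I : JCInstance z) :
    (copyWords D K (vectors I)).length = I.n * K := by
  rw [copyWords_eq, List.length_take, Nat.min_eq_left (copies_lt_book hD I).le]

theorem length_pointWords (hD : 0 < D) {z : ℕ} (I : JCInstance z) :
    (pointWords D K (vectors I)).length = I.edges.length * (I.n * K) := by
  simp [pointWords, List.length_flatMap, length_copyWords hD, length_vectors]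

theorem length_of_mem_book {vecs : List (List Bool)} {w : List (Color D)}
    (h : w ∈ book D K vecs) : w.length = wordLen K vecs :=
  length_of_mem_codebook h

theorem mem_book_of_mem_marked {vecs : List (List Bool)} {v : List Bool} {w : List (Color D)}
    (h : w ∈ marked v (book D K vecs)) : w ∈ book D K vecs := by
  simp only [marked, List.mem_map, List.mem_filter] at h
  obtain ⟨x, ⟨hx, _⟩, rfl⟩ := h
  exact (List.of_mem_zip hx).2

theorem length_of_mem_pointWords {vecs : List (List Bool)}
    {p : List (Finset (Color D) × Color D)} (h : p ∈ pointWords D K vecs) :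
    p.length = wordLen K vecs := by
  simp only [pointWords, copyWords, List.mem_flatMap, List.mem_map] at h
  obtain ⟨v, _, w, ⟨x, hx, rfl⟩, rfl⟩ := h
  rw [List.length_zip, length_profile fun w hw => length_of_mem_book (mem_book_of_mem_marked hw),
    length_of_mem_book (List.of_mem_zip hx).2, Nat.min_self]

theorem mem_book_of_mem_vertexWords {vecs : List (List Bool)} {w : List (Color D)}
    (h : w ∈ vertexWords D K vecs) : w ∈ book D K vecs := by
  simp only [vertexWords, List.mem_map] at h
  obtain ⟨x, hx, rfl⟩ := h
  exact (List.of_mem_zip hx).2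

theorem length_of_mem_tupleProfiles {vecs : List (List Bool)} {y : ℕ}
    {A : List (Finset (Color D))}
    (h : A ∈ tupleProfiles (wordLen K vecs) (vertexWords D K vecs) y) :
    A.length = wordLen K vecs := by
  obtain ⟨t, _, ht, rfl⟩ := mem_tupleProfiles.1 h
  exact length_profile fun w hw => length_of_mem_book (mem_book_of_mem_vertexWords (ht w hw))

/-- The greedy scan with `differ` merely deletes duplicates. As `differ` looks only at common
positions, this uses that all profiles have equal length. -/
theorem mem_centerWords {vecs : List (List Bool)} {y : ℕ} {A : List (Finset (Color D))} :
    A ∈ centerWords D K vecs y ↔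
      A ∈ tupleProfiles (wordLen K vecs) (vertexWords D K vecs) y := by
  refine ⟨greedy_subset _ _ _, fun h => ?_⟩
  rcases greedy_maximal differ _ h with h1 | ⟨B, hB, h1⟩
  · exact h1
  · have hB' := greedy_subset _ _ _ hB
    rwa [differ_eq_false ((length_of_mem_tupleProfiles h).trans
      (length_of_mem_tupleProfiles hB').symm) h1]

theorem nodup_centerWords (vecs : List (List Bool)) (y : ℕ) :
    (centerWords D K vecs y).Nodup :=
  (pairwise_greedy differ _).imp fun h => by
    rintro rfl; rw [differ_self] at h; cases h

theorem nodup_map_realize_centers {PB : Finset (Color D) → Fin d → ℚ}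
    (hPB : Function.Injective PB) (vecs : List (List Bool)) (y : ℕ) :
    ((centerWords D K vecs y).map (realize PB (wordLen K vecs))).Nodup :=
  (nodup_centerWords vecs y).map_on fun _ hA _ hB h => realize_injOn hPB
    (length_of_mem_tupleProfiles (mem_centerWords.1 hA))
    (length_of_mem_tupleProfiles (mem_centerWords.1 hB)) h

theorem nodup_map_realize_points {PA : Finset (Color D) × Color D → Fin d → ℚ}
    (hPA : Function.Injective PA) {vecs : List (List Bool)} (h : (pointWords D K vecs).Nodup) :
    ((pointWords D K vecs).map (realize PA (wordLen K vecs))).Nodup :=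
  h.map_on fun _ hA _ hB h => realize_injOn hPA
    (length_of_mem_pointWords hA) (length_of_mem_pointWords hB) h

theorem encodeBlocks_append (l l' : List (List Bool)) :
    encodeBlocks (l ++ l') = encodeBlocks l ++ encodeBlocks l' :=
  List.flatMap_append

theorem encodeBlocks_realize {X : Type} (g : X → Fin d → ℚ) {l : ℕ} {W : List (List X)}
    (hW : ∀ w ∈ W, w.length = l) :
    encodeBlocks ((W.map (realize g l)).flatMap fun v => (List.ofFn v).flatMap encodeRat)
      = W.flatMap fun w => w.flatMap fun x => ratStr (g x) := by
  induction W with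
  | nil => rfl
  | cons w W ih =>
    rw [List.map_cons, List.flatMap_cons, encodeBlocks_append, ih fun w hw => hW w (by simp [hw]),
      List.flatMap_cons, ofFn_realize g (hW w (by simp))]
    congr 1
    simp only [encodeBlocks, ratStr, List.flatMap_assoc]

/-- The instance is defined with `dedup`, but the program on strings never compares vectors. Both
agree because the words are already distinct and the vectors of letters are injective. -/
theorem reduceString_encode (hD : 0 < D) {PA : Finset (Color D) × Color D → Fin d → ℚ}
    {PB : Finset (Color D) → Fin d → ℚ} (hPA : Function.Injective PA)
    (hPB : Function.Injective PB) {z : ℕ} (I : JCInstance z)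
    (hI : (pointWords D K (vectors I)).Nodup) :
    reduceString K y PA PB I.encode = (reduce K y PA PB I).encode := by
  have h1 := (nodup_map_realize_points hPA hI).dedup
  have h2 := (nodup_map_realize_centers (K := K) hPB (vectors I) y).dedup
  have hE : (reduce K y PA PB I).encode = encodeBlocks ([Computability.encodeNat
      (wordLen K (vectors I) * d), Computability.encodeNat (pointWords D K (vectors I)).length,
      Computability.encodeNat (centerWords D K (vectors I) y).length, Computability.encodeNat I.k] ++
      ((pointWords D K (vectors I)).map (realize PA (wordLen K (vectors I))) ++
      (centerWords D K (vectors I) y).map (realize PB (wordLen K (vectors I)))).flatMap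
        fun v => (List.ofFn v).flatMap encodeRat) := by
    rw [← List.length_map (as := pointWords D K (vectors I)) (realize PA (wordLen K (vectors I))),
      ← List.length_map (as := centerWords D K (vectors I) y)
        (realize PB (wordLen K (vectors I))), ← h1, ← h2]
    rfl
  rw [hE]
  simp only [reduceString, parseBlocks_encode, List.tail_cons, List.headD_cons]
  have e : ∀ (a b c d : List Bool) (l : List (List Bool)), encodeBlocks ([a, b, c, d] ++ l) =
      encodeBlocks [a] ++ (encodeBlocks [b] ++ (encodeBlocks [c] ++ (encodeBlocks [d] ++
        encodeBlocks l))) := by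
    intro a b c d l; simp [encodeBlocks]
  rw [e, List.flatMap_append, encodeBlocks_append,
    encodeBlocks_realize PA fun w hw => length_of_mem_pointWords hw,
    encodeBlocks_realize PB fun w hw => length_of_mem_tupleProfiles (mem_centerWords.1 hw)]
  -- The dimension is counted by repeating `d` unary marks for each bit, which avoids multiplication
  -- of binary numbers.
  have hlen : ((bin (units K (vectors I))).flatMap fun _ => List.replicate d ()).length
      = wordLen K (vectors I) * d := by
    simp [List.length_flatMap, wordLen]
  have hbin : bin ((bin (units K (vectors I))).flatMap fun _ => List.replicate d ())
      = Computability.encodeNat (wordLen K (vectors I) * d) := by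
    rw [bin, hlen]
  have hbin' : bin (units K (vectors I))
      = Computability.encodeNat (pointWords D K (vectors I)).length := by
    rw [bin, length_units, length_pointWords hD]
  rw [hbin, hbin']
  rfl

end StackProg

/-! ### Combinatorics of the reduced instances -/

namespace StackProg

variable {D K z : ℕ}

/-- The color of an element of the universe at position `j`. -/
def col (D K : ℕ) (I : JCInstance z) (j : ℕ) (v : Fin I.n) : Color D :=
  ((book D K (vectors I)).getD v []).getD j 0

/-- The word of color sets of a set. -/
def profWord (D K : ℕ) (I : JCInstance z) (S : Finset (Fin I.n)) : List (Finset (Color D)) :=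
  (List.range (wordLen K (vectors I))).map fun j => S.image (col D K I j)

theorem length_profWord (I : JCInstance z) (S : Finset (Fin I.n)) :
    (profWord D K I S).length = wordLen K (vectors I) := by
  simp [profWord]

theorem lt_book (hD : 0 < D) (hK : 0 < K) (I : JCInstance z) (v : Fin I.n) :
    (v : ℕ) < (book D K (vectors I)).length :=
  v.2.trans_le ((Nat.le_mul_of_pos_right _ hK).trans (copies_lt_book hD I).le)

theorem book_getD (hD : 0 < D) (hK : 0 < K) (I : JCInstance z) (v : Fin I.n) :
    (book D K (vectors I)).getD v [] = (book D K (vectors I))[(v : ℕ)]'(lt_book hD hK I v) := by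
  rw [List.getD_eq_getElem?_getD, List.getElem?_eq_getElem (lt_book hD hK I v)]; rfl

theorem length_book_getD (hD : 0 < D) (hK : 0 < K) (I : JCInstance z) (v : Fin I.n) :
    ((book D K (vectors I)).getD v []).length = wordLen K (vectors I) := by
  rw [book_getD hD hK]
  exact length_of_mem_book (List.getElem_mem _)

theorem getElem?_book_getD (hD : 0 < D) (hK : 0 < K) (I : JCInstance z) (v : Fin I.n) {j : ℕ}
    (hj : j < wordLen K (vectors I)) :
    ((book D K (vectors I)).getD v [])[j]? = some (col D K I j v) := by
  rw [col, List.getD_eq_getElem?_getD (i := j),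
    List.getElem?_eq_getElem (by rwa [length_book_getD hD hK])]
  rfl

/-- A profile depends only on the set of its words, so neither order nor repetitions matter. This
covers both the marked lists of edges and the tuples behind centers. -/
theorem profile_eq_profWord (hD : 0 < D) (hK : 0 < K) (I : JCInstance z) (S : Finset (Fin I.n))
    {ws : List (List (Color D))}
    (h : ∀ w, w ∈ ws ↔ ∃ v ∈ S, (book D K (vectors I)).getD v [] = w) :
    profile (wordLen K (vectors I)) ws = profWord D K I S := by
  have hlen : ∀ w ∈ ws, w.length = wordLen K (vectors I) := by
    intro w hw
    obtain ⟨v, _, rfl⟩ := (h w).1 hw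
    exact length_book_getD hD hK I v
  refine List.ext_getElem? fun j => ?_
  by_cases hj : j < wordLen K (vectors I)
  · obtain ⟨A, hA, hmem⟩ := profile_getElem? hlen hj
    rw [hA]
    simp only [profWord, List.getElem?_map, List.getElem?_range hj, Option.map_some]
    congr 1
    ext a
    rw [hmem, Finset.mem_image]
    constructor
    · rintro ⟨w, hw, h1⟩
      obtain ⟨v, hv, rfl⟩ := (h w).1 hw
      rw [getElem?_book_getD hD hK I v hj] at h1
      exact ⟨v, hv, Option.some.inj h1⟩
    · rintro ⟨v, hv, rfl⟩
      exact ⟨_, (h _).2 ⟨v, hv, rfl⟩, getElem?_book_getD hD hK I v hj⟩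
  · rw [List.getElem?_eq_none (by rw [length_profile hlen]; omega),
      List.getElem?_eq_none (by rw [length_profWord]; omega)]

theorem profile_marked (hD : 0 < D) (hK : 0 < K) (I : JCInstance z) (T : Finset (Fin I.n)) :
    profile (wordLen K (vectors I)) (marked (List.ofFn fun i => decide (i ∈ T))
      (book D K (vectors I))) = profWord D K I T := by
  refine profile_eq_profWord hD hK I T fun w => ?_
  rw [mem_marked]
  refine exists_congr fun v => ?_
  rw [decide_eq_true_iff, List.getElem?_eq_getElem (lt_book hD hK I v), book_getD hD hK,
    Option.some.injEq]

theorem mem_vertexWords (hD : 0 < D) (hK : 0 < K) (I : JCInstance z) (w : List (Color D)) :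
    w ∈ vertexWords D K (vectors I) ↔ ∃ v : Fin I.n, (book D K (vectors I)).getD v [] = w := by
  rw [vertexWords, map_snd_zip_eq_take, headD_vectors_length, List.mem_take_iff_getElem]
  constructor
  · rintro ⟨i, hi, rfl⟩
    exact ⟨⟨i, (lt_min_iff.1 hi).1⟩, book_getD hD hK I _⟩
  · rintro ⟨v, rfl⟩
    exact ⟨v, lt_min v.2 (lt_book hD hK I v), (book_getD hD hK I v).symm⟩

/-- A tuple of words may repeat an element, so only $|S|\le y$ can be claimed. The distance
estimates below therefore allow smaller sets. -/
theorem exists_of_mem_centerWords (hD : 0 < D) (hK : 0 < K) (I : JCInstance z) {y : ℕ}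
    {A : List (Finset (Color D))} (hA : A ∈ centerWords D K (vectors I) y) :
    ∃ S : Finset (Fin I.n), S.card ≤ y ∧ A = profWord D K I S := by
  obtain ⟨t, ht, hmem, rfl⟩ := mem_tupleProfiles.1 (mem_centerWords.1 hA)
  have hex : ∀ w ∈ t, ∃ v : Fin I.n, (book D K (vectors I)).getD v [] = w := fun w hw =>
    (mem_vertexWords hD hK I w).1 (hmem w hw)
  rcases t with _ | ⟨w0, t0⟩
  · exact ⟨∅, by simp, profile_eq_profWord hD hK I ∅ (by simp)⟩
  · obtain ⟨v0, _⟩ := hex w0 (by simp)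
    have : Nonempty (Fin I.n) := ⟨v0⟩
    choose! u hu using hex
    refine ⟨((w0 :: t0).map u).toFinset, (List.toFinset_card_le _).trans (by simp [← ht]),
      profile_eq_profWord hD hK I _ fun w => ?_⟩
    simp only [List.mem_toFinset, List.mem_map]
    constructor
    · intro hw; exact ⟨u w, ⟨w, hw, rfl⟩, hu w hw⟩
    · rintro ⟨_, ⟨w', hw', rfl⟩, rfl⟩
      rwa [hu w' hw']

theorem profWord_mem_centerWords (hD : 0 < D) (hK : 0 < K) (I : JCInstance z)
    (S : Finset (Fin I.n)) : profWord D K I S ∈ centerWords D K (vectors I) S.card := by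
  refine mem_centerWords.2 (mem_tupleProfiles.2
    ⟨S.toList.map fun v : Fin I.n => (book D K (vectors I)).getD (v : ℕ) [], by simp, fun w hw => ?_, ?_⟩)
  · obtain ⟨v, _, rfl⟩ := List.mem_map.1 hw
    exact (mem_vertexWords hD hK I _).2 ⟨v, rfl⟩
  · refine (profile_eq_profWord hD hK I S fun w => ?_).symm
    simp

/-- Different elements have different code words, and equal colors at a position mean an agreement
of these words. -/
theorem card_col_eq (hD : 0 < D) (hK : 0 < K) (I : JCInstance z) {u v : Fin I.n} (h : u ≠ v) :
    ((Finset.range (wordLen K (vectors I))).filter fun j =>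
      col D K I j u = col D K I j v).card * D < wordLen K (vectors I) := by
  have h1 := agree_codebook (lt_book hD hK I u) (lt_book hD hK I v)
    (fun e => h (Fin.ext e))
  have h2 := card_agree _ _ (length_book_getD hD hK I u) (length_book_getD hD hK I v)
  rw [book_getD hD hK, book_getD hD hK] at h2
  refine lt_of_le_of_lt (Nat.mul_le_mul_right _ ?_) h1
  refine (Finset.card_le_card fun j hj => ?_).trans h2.le
  rw [Finset.mem_filter, Finset.mem_range] at hj ⊢
  refine ⟨hj.1, ?_⟩
  rw [← book_getD hD hK, ← book_getD hD hK, getElem?_book_getD hD hK I u hj.1,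
    getElem?_book_getD hD hK I v hj.1, hj.2]

/-- The coloring is injective on a small set at most positions. -/
theorem card_not_injOn (hD : 0 < D) (hK : 0 < K) (I : JCInstance z) (U : Finset (Fin I.n)) :
    ((Finset.range (wordLen K (vectors I))).filter fun j =>
      ¬ Set.InjOn (col D K I j) U).card * D ≤ U.card ^ 2 * wordLen K (vectors I) := by
  -- Union bound: where injectivity fails, some pair of distinct elements of `U` collides.
  have hsub : (Finset.range (wordLen K (vectors I))).filter (fun j =>
      ¬ Set.InjOn (col D K I j) U) ⊆ (U.offDiag).biUnion fun x =>
        (Finset.range (wordLen K (vectors I))).filter fun j =>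
          col D K I j x.1 = col D K I j x.2 := by
    intro j hj
    rw [Finset.mem_filter] at hj
    obtain ⟨u, hu, v, hv, huv, hne⟩ : ∃ u ∈ U, ∃ v ∈ U, col D K I j u = col D K I j v ∧ u ≠ v := by
      have := hj.2
      simp only [Set.InjOn] at this
      push Not at this
      obtain ⟨u, hu, v, hv, h1, h2⟩ := this
      exact ⟨u, hu, v, hv, h1, h2⟩
    rw [Finset.mem_biUnion]
    exact ⟨(u, v), Finset.mem_offDiag.2 ⟨hu, hv, hne⟩, Finset.mem_filter.2 ⟨hj.1, huv⟩⟩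
  calc _ ≤ (∑ x ∈ U.offDiag, ((Finset.range (wordLen K (vectors I))).filter fun j =>
          col D K I j x.1 = col D K I j x.2).card) * D :=
        Nat.mul_le_mul_right _ ((Finset.card_le_card hsub).trans Finset.card_biUnion_le)
    _ ≤ ∑ x ∈ U.offDiag, wordLen K (vectors I) := by
        rw [Finset.sum_mul]
        exact Finset.sum_le_sum fun x hx =>
          (card_col_eq hD hK I (Finset.mem_offDiag.1 hx).2.2).le
    _ ≤ U.card ^ 2 * wordLen K (vectors I) := by
        rw [Finset.sum_const, smul_eq_mul, Finset.offDiag_card]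
        exact Nat.mul_le_mul_right _ (by rw [sq]; omega)

theorem pointWords_eq (hD : 0 < D) (hK : 0 < K) (I : JCInstance z) :
    pointWords D K (vectors I) = I.edges.flatMap fun T =>
      (copyWords D K (vectors I)).map fun w => (profWord D K I T).zip w := by
  rw [pointWords, vectors, List.flatMap_map]
  congr 1
  funext T
  rw [← profile_marked hD hK]
  rfl

theorem nodup_codebook (hD : 0 < D) (l : ℕ) : (codebook D l).Nodup :=
  (pairwise_greedy (far D) _).imp fun h => by
    rintro rfl
    rw [far_iff, agree_self] at h
    exact absurd (Nat.le_mul_of_pos_right _ hD) (not_le.2 h)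

theorem wordLen_pos (hK : 0 < K) (hz : 0 < z) (I : JCInstance z) :
    0 < wordLen K (vectors I) := by
  have h := lt_two_pow_length_encodeNat (units K (vectors I)).length
  have h0 : 0 < (units K (vectors I)).length := by
    rw [length_units]
    have h1 := List.length_pos_iff.2 I.nonempty
    have h2 : 0 < I.n := by
      obtain ⟨T, hT⟩ := List.exists_mem_of_ne_nil _ I.nonempty
      have h3 := I.uniform T hT
      have h4 := T.card_le_univ
      rw [Fintype.card_fin] at h4
      omega
    positivity
  by_contra hc
  have : (Computability.encodeNat (units K (vectors I)).length).length = 0 := by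
    simpa [wordLen, bin] using hc
  rw [this] at h
  omega

/-- As $|T\cup T'|^2<D$, the coloring is injective on $T\cup T'$ at some position, and there the
color sets determine the sets. -/
theorem profWord_injOn (hD : (2 * z) ^ 2 < D) (hK : 0 < K) (hz : 0 < z) (I : JCInstance z)
    {T T' : Finset (Fin I.n)} (hT : T.card = z) (hT' : T'.card = z)
    (h : profWord D K I T = profWord D K I T') : T = T' := by
  have hD0 : 0 < D := by omega
  have h1 := card_not_injOn hD0 hK I (T ∪ T')
  have hl := wordLen_pos hK hz I
  obtain ⟨j, hj, hinj⟩ : ∃ j < wordLen K (vectors I),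
      Set.InjOn (col D K I j) (T ∪ T' : Finset (Fin I.n)) := by
    by_contra hc
    push Not at hc
    rw [Finset.filter_true_of_mem fun j hj => hc j (Finset.mem_range.1 hj),
      Finset.card_range] at h1
    have h2 : (T ∪ T').card ≤ 2 * z := (Finset.card_union_le _ _).trans (by omega)
    have h3 : (T ∪ T').card ^ 2 ≤ (2 * z) ^ 2 := Nat.pow_le_pow_left h2 2
    have h4 : (T ∪ T').card ^ 2 * wordLen K (vectors I) < D * wordLen K (vectors I) :=
      Nat.mul_lt_mul_of_pos_right (lt_of_le_of_lt h3 hD) hl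
    rw [Nat.mul_comm] at h1
    omega
  have h2 : T.image (col D K I j) = T'.image (col D K I j) := by
    have := congrArg (fun l => l[j]?) h
    simpa [profWord, List.getElem?_range hj] using this
  have h3 : ∀ {A B : Finset (Fin I.n)}, A ⊆ T ∪ T' → B ⊆ T ∪ T' →
      A.image (col D K I j) = B.image (col D K I j) → A ⊆ B := by
    intro A B hA hB hAB a ha
    have : col D K I j a ∈ B.image (col D K I j) := hAB ▸ Finset.mem_image_of_mem _ ha
    obtain ⟨b, hb, hab⟩ := Finset.mem_image.1 this
    rwa [← hinj (hB hb) (hA ha) hab]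
  exact Finset.Subset.antisymm (h3 Finset.subset_union_left Finset.subset_union_right h2)
    (h3 Finset.subset_union_right Finset.subset_union_left h2.symm)

/-- The first components recover the edge and the second ones the copy, so the number of points is
exactly the number of edges times the number of copies. -/
theorem nodup_pointWords (hD : (2 * z) ^ 2 < D) (hK : 0 < K) (hz : 0 < z) (I : JCInstance z) :
    (pointWords D K (vectors I)).Nodup := by
  have hD0 : 0 < D := by omega
  have hlen : ∀ w ∈ copyWords D K (vectors I), w.length = wordLen K (vectors I) := by
    intro w hw
    rw [copyWords_eq] at hw
    exact length_of_mem_book (List.mem_of_mem_take hw)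
  have hfst : ∀ T, ∀ w ∈ copyWords D K (vectors I),
      ((profWord D K I T).zip w).map Prod.fst = profWord D K I T := fun T w hw =>
    List.map_fst_zip (by rw [length_profWord, hlen w hw])
  have hsnd : ∀ T, ∀ w ∈ copyWords D K (vectors I),
      ((profWord D K I T).zip w).map Prod.snd = w := fun T w hw =>
    List.map_snd_zip (by rw [length_profWord, hlen w hw])
  rw [pointWords_eq hD0 hK, List.nodup_flatMap]
  refine ⟨fun T _ => List.Nodup.map_on (fun w hw w' hw' h => ?_) ?_, ?_⟩
  · rw [← hsnd T w hw, h, hsnd T w' hw']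
  · rw [copyWords_eq]
    exact (nodup_codebook hD0 _).sublist (List.take_sublist _ _)
  · refine List.Pairwise.imp_of_mem (R := fun T T' => T ≠ T') ?_ I.nodup
    intro T T' hT hT' hne x hx hx'
    obtain ⟨w, hw, rfl⟩ := List.mem_map.1 hx
    obtain ⟨w', hw', h⟩ := List.mem_map.1 hx'
    refine hne (profWord_injOn hD hK hz I (I.uniform T hT) (I.uniform T' hT') ?_)
    rw [← hfst T w hw, ← h, hfst T' w' hw']

end StackProg

/-! ### Rational gadgets from gap realizations -/

namespace StackProg

/-- The `p`-th power of the `ℓ_p` distance. -/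
noncomputable def powDist (p : ℝ) {d : ℕ} (a b : Fin d → ℝ) : ℝ :=
  ∑ i, |a i - b i| ^ p

theorem powDist_nonneg (p : ℝ) {d : ℕ} (a b : Fin d → ℝ) : 0 ≤ powDist p a b :=
  Finset.sum_nonneg fun _ _ => Real.rpow_nonneg (abs_nonneg _) _

theorem lpDist_eq (p : ℝ) {d : ℕ} (a b : Fin d → ℝ) : lpDist p a b = powDist p a b ^ (1 / p) :=
  rfl

theorem lpDist_nonneg (p : ℝ) {d : ℕ} (a b : Fin d → ℝ) : 0 ≤ lpDist p a b :=
  Real.rpow_nonneg (powDist_nonneg _ _ _) _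

theorem lpDist_rpow {p : ℝ} (hp : 0 < p) {d : ℕ} (a b : Fin d → ℝ) :
    lpDist p a b ^ p = powDist p a b := by
  rw [lpDist_eq, ← Real.rpow_mul (powDist_nonneg _ _ _), one_div_mul_cancel hp.ne', Real.rpow_one]

theorem exists_rat_seq_tendsto (r : ℝ) :
    ∃ u : ℕ → ℚ, Filter.Tendsto (fun n => (u n : ℝ)) Filter.atTop (nhds r) := by
  have h : ∀ n : ℕ, ∃ q : ℚ, r < q ∧ (q : ℝ) < r + 1 / ((n : ℝ) + 1) := fun n =>
    exists_rat_btwn (lt_add_of_pos_right _ (by positivity))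
  choose u hu hu' using h
  refine ⟨u, tendsto_of_tendsto_of_tendsto_of_le_of_le tendsto_const_nhds ?_
    (fun n => (hu n).le) fun n => (hu' n).le⟩
  simpa using tendsto_one_div_add_atTop_nhds_zero_nat.const_add r

/-- Finitely many real vectors can be approximated by pairwise distinct rational vectors. -/
theorem exists_injective_rat_seq {X : Type} [Finite X] {d : ℕ} (a : X → Fin d → ℝ) :
    ∃ u : ℕ → X → Fin (d + 1) → ℚ, (∀ n, Function.Injective (u n)) ∧
      ∀ x i, Filter.Tendsto (fun n => (u n x i : ℝ)) Filter.atTop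
        (nhds ((Fin.cons 0 (a x) : Fin (d + 1) → ℝ) i)) := by
  obtain ⟨m, ⟨idx⟩⟩ := Finite.exists_equiv_fin X
  choose v hv using fun x i => exists_rat_seq_tendsto (a x i)
  -- An additional coordinate, different for different `x` and tending to zero, makes the vectors
  -- distinct without affecting the limit.
  refine ⟨fun n x => Fin.cons ((idx x : ℕ) / ((n : ℚ) + 1)) fun i => v x i n, fun n x y h => ?_,
    fun x i => ?_⟩
  · have h0 := congrFun h 0
    have hn : ((n : ℚ) + 1) ≠ 0 := by positivity
    simp only [Fin.cons_zero] at h0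
    rw [div_left_inj' hn] at h0
    exact idx.injective (Fin.ext (by exact_mod_cast h0))
  · refine Fin.cases ?_ (fun i => ?_) i
    · simp only [Fin.cons_zero]
      have := (tendsto_one_div_add_atTop_nhds_zero_nat (𝕜 := ℝ)).const_mul ((idx x : ℕ) : ℝ)
      simpa [div_eq_mul_inv] using this
    · simpa using hv x i

/-- The power distance is continuous and only finitely many pairs have to be controlled.
Distinctness is what separates copies with the same color set, for which the given vectors coincide.
-/
theorem exists_rat_approx {p : ℝ} (hp : 0 < p) {X Y : Type} [Finite X] [Finite Y] {d : ℕ}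
    (a : X → Fin d → ℝ) (b : Y → Fin d → ℝ) {δ : ℝ} (hδ : 0 < δ) :
    ∃ (u : X → Fin (d + 1) → ℚ) (v : Y → Fin (d + 1) → ℚ),
      Function.Injective u ∧ Function.Injective v ∧
      ∀ x y, |powDist p (fun i => (u x i : ℝ)) (fun i => (v y i : ℝ))
        - powDist p (a x) (b y)| < δ := by
  obtain ⟨u, hu, hu'⟩ := exists_injective_rat_seq a
  obtain ⟨v, hv, hv'⟩ := exists_injective_rat_seq b
  have key : ∀ x y, Filter.Tendsto (fun n => powDist p (fun i => (u n x i : ℝ))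
      (fun i => (v n y i : ℝ))) Filter.atTop (nhds (powDist p (a x) (b y))) := by
    intro x y
    have h : powDist p (a x) (b y) = powDist p (Fin.cons 0 (a x) : Fin (d + 1) → ℝ)
        (Fin.cons 0 (b y) : Fin (d + 1) → ℝ) := by
      simp [powDist, Fin.sum_univ_succ, Real.zero_rpow hp.ne']
    rw [h]
    exact tendsto_finsetSum _ fun i _ =>
      ((hu' x i).sub (hv' y i)).abs.rpow_const (.inr hp.le)
  have h1 : ∀ᶠ n in Filter.atTop, ∀ x y, |powDist p (fun i => (u n x i : ℝ))
      (fun i => (v n y i : ℝ)) - powDist p (a x) (b y)| < δ :=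
    Filter.eventually_all.2 fun x => Filter.eventually_all.2 fun y => by
      have := (Metric.tendsto_nhds.1 (key x y)) δ hδ
      simpa [Real.dist_eq] using this
  obtain ⟨n, hn⟩ := h1.exists
  exact ⟨u n, v n, hu n, hv n, hn⟩

/-! #### Padding of color sets -/

section Pad

variable {c z : ℕ}

/-- A set of colors filled up to `t` elements by new colors. -/
def padSet (z t : ℕ) (A : Finset (Fin c)) : Finset (Fin (c + z)) :=
  (A.disjSum (Finset.univ.filter fun i : Fin z => (i : ℕ) < t - A.card)).map
    finSumFinEquiv.toEmbedding

theorem card_padSet {t : ℕ} (ht : t ≤ z) {A : Finset (Fin c)} (hA : A.card ≤ t) :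
    (padSet z t A).card = t := by
  rw [padSet, Finset.card_map, Finset.card_disjSum, Fin.card_filter_val_lt]
  omega

/-- The padding always uses an initial segment of the new colors, so inclusion of the paddings is a
comparison of their lengths. -/
theorem padSet_subset_iff {y : ℕ} (hy : y ≤ z) {A B : Finset (Fin c)} :
    padSet z y B ⊆ padSet z z A ↔ B ⊆ A ∧ y - B.card ≤ z - A.card := by
  rw [padSet, padSet, Finset.map_subset_map]
  constructor
  · intro h
    refine ⟨fun b hb => by simpa using h (Finset.inl_mem_disjSum.2 hb), ?_⟩
    by_contra hc
    have hz : z - A.card < z := by omega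
    have := h (Finset.inr_mem_disjSum.2 (Finset.mem_filter.2
      ⟨Finset.mem_univ (⟨z - A.card, hz⟩ : Fin z), not_le.1 hc⟩))
    simp at this
  · rintro ⟨h1, h2⟩
    refine Finset.disjSum_mono h1 fun i hi => ?_
    simp only [Finset.mem_filter, Finset.mem_univ, true_and] at hi ⊢
    omega

variable {V : Type} [DecidableEq V] {S T : Finset V} {y : ℕ}

/-- No injectivity is needed: $|f(T)|\le|f(S)|+|T\setminus S|$, so a coloring that merges elements
leaves at least as much padding in $T$ as in $S$. -/
theorem padSet_image_subset (f : V → Fin c) (h : S ⊆ T) (hT : T.card = z) (hS : S.card = y) :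
    padSet z y (S.image f) ⊆ padSet z z (T.image f) := by
  rw [padSet_subset_iff (by rw [← hT, ← hS]; exact Finset.card_le_card h)]
  refine ⟨Finset.image_subset_image h, ?_⟩
  have h1 : (T.image f).card ≤ (S.image f).card + (T \ S).card := by
    rw [← Finset.union_sdiff_of_subset h, Finset.image_union]
    refine (Finset.card_union_le _ _).trans ?_
    rw [Finset.union_sdiff_of_subset h]
    exact Nat.add_le_add_left Finset.card_image_le _
  have h2 := Finset.card_sdiff_add_card_eq_card h
  have h3 : (S.image f).card ≤ S.card := Finset.card_image_le
  have h4 : (T.image f).card ≤ T.card := Finset.card_image_le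
  omega

/-- Injectivity leaves the image of $T$ with all $z$ colors and hence without padding. So the
padding of $S$ must be empty as well, which forces $|S|=y$. -/
theorem subset_of_padSet_image_subset {f : V → Fin c}
    (hf : Set.InjOn f (S ∪ T : Finset V)) (hT : T.card = z) (hS : S.card ≤ y) (hy : y ≤ z)
    (h : padSet z y (S.image f) ⊆ padSet z z (T.image f)) : S ⊆ T ∧ S.card = y := by
  rw [padSet_subset_iff hy] at h
  have h1 : (T.image f).card = T.card := Finset.card_image_of_injOn
    (hf.mono (by simp))
  have h2 : (S.image f).card = S.card := Finset.card_image_of_injOn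
    (hf.mono (by simp))
  refine ⟨fun s hs => ?_, by omega⟩
  obtain ⟨t, ht, hst⟩ := Finset.mem_image.1 (h.1 (Finset.mem_image_of_mem f hs))
  rwa [← hf (by simp [ht]) (by simp [hs]) hst]

end Pad

/-- Rational vectors for pairs of a color set and a color, and for color sets, whose distances
reflect the inclusions among the padded sets. -/
theorem exists_gadget {p : ℝ} (hp : 1 ≤ p) {y z D : ℕ} (hy : y ≤ z) {lam : ℝ} (hlam : 1 ≤ lam)
    (h : GapRealizable p (johnsonAdj (4 ^ D + z) z y) lam) {e : ℝ} (he : 0 < e) :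
    ∃ (d : ℕ) (PA : Finset (Color D) × Color D → Fin d → ℚ) (PB : Finset (Color D) → Fin d → ℚ)
      (b : ℝ), 0 < b ∧ Function.Injective PA ∧ Function.Injective PB ∧
      ∀ (A : Finset (Color D)) (x : Color D) (B : Finset (Color D)), A.card ≤ z → B.card ≤ y →
        (padSet z y B ⊆ padSet z z A →
          powDist p (fun i => (PA (A, x) i : ℝ)) (fun i => (PB B i : ℝ)) ≤ b * (1 + e)) ∧
        b * (1 - e) ≤ powDist p (fun i => (PA (A, x) i : ℝ)) (fun i => (PB B i : ℝ)) ∧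
        (¬ padSet z y B ⊆ padSet z z A →
          b * lam ^ p * (1 - e) ≤
            powDist p (fun i => (PA (A, x) i : ℝ)) (fun i => (PB B i : ℝ))) := by
  classical
  obtain ⟨d, τA, τB, β, hβ, hedge, hnon⟩ := h
  have hp0 : 0 < p := by linarith
  have hb : 0 < β ^ p := Real.rpow_pos_of_pos hβ _
  -- The color in the pair is ignored by the real vectors and only separates copies. Color sets that
  -- are too large get the vector zero and never occur. An absolute error below $\beta^p e$ is a
  -- relative error of `e`, also for the larger distances because $\lambda\ge1$.
  obtain ⟨u, v, hu, hv, huv⟩ := exists_rat_approx hp0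
    (fun x : Finset (Color D) × Color D =>
      if h : x.1.card ≤ z then τA ⟨padSet z z x.1, card_padSet le_rfl h⟩ else 0)
    (fun B : Finset (Color D) =>
      if h : B.card ≤ y then τB ⟨padSet z y B, card_padSet hy h⟩ else 0)
    (mul_pos hb he)
  refine ⟨d + 1, u, v, β ^ p, hb, hu, hv, fun A x B hA hB => ?_⟩
  have h1 := abs_lt.1 (huv (A, x) B)
  simp only [hA, hB, dif_pos] at h1
  set P := powDist p (fun i => (u (A, x) i : ℝ)) (fun i => (v B i : ℝ))
  set Q := powDist p (τA ⟨padSet z z A, card_padSet le_rfl hA⟩)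
    (τB ⟨padSet z y B, card_padSet hy hB⟩) with hQ
  have hl : 1 ≤ lam ^ p := Real.one_le_rpow hlam hp0.le
  have h2 : padSet z y B ⊆ padSet z z A → Q = β ^ p := fun hsub => by
    rw [hQ, ← lpDist_rpow hp0, hedge ⟨_, card_padSet le_rfl hA⟩ ⟨_, card_padSet hy hB⟩ hsub]
  have h3 : ¬ padSet z y B ⊆ padSet z z A → β ^ p * lam ^ p ≤ Q := fun hsub => by
    rw [hQ, ← lpDist_rpow hp0, mul_comm, ← Real.mul_rpow (by linarith) hβ.le]
    exact Real.rpow_le_rpow (by positivity) (hnon ⟨_, card_padSet le_rfl hA⟩ ⟨_, card_padSet hy hB⟩ hsub) hp0.le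
  have h5 : β ^ p * 1 ≤ β ^ p * lam ^ p := mul_le_mul_of_nonneg_left hl hb.le
  have h6 : β ^ p * e * 1 ≤ β ^ p * e * lam ^ p := mul_le_mul_of_nonneg_left hl (by positivity)
  refine ⟨fun hsub => ?_, ?_, fun hsub => ?_⟩
  · have := h2 hsub; linarith
  · by_cases hsub : padSet z y B ⊆ padSet z z A
    · have := h2 hsub; linarith
    · have := h3 hsub; linarith
  · have := h3 hsub; linarith

end StackProg

/-! ### Distances and costs in the reduced instances -/

namespace StackProg

/-- Power distances add over the positions, which is why all estimates are made before the `p`-th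
root is taken. -/
theorem powDist_realize (p : ℝ) {X Y : Type} {d : ℕ} (g : X → Fin d → ℚ) (h : Y → Fin d → ℚ)
    {l : ℕ} {u : List X} {w : List Y} (hu : u.length = l) (hw : w.length = l) :
    powDist p (fun i => (realize g l u i : ℝ)) (fun i => (realize h l w i : ℝ)) =
      ∑ j : Fin l, powDist p (fun i => (g (u[j]'(hu ▸ j.2)) i : ℝ))
        (fun i => (h (w[j]'(hw ▸ j.2)) i : ℝ)) := by
  simp only [powDist]
  rw [← Fintype.sum_prod_type' (fun (j : Fin l) (i : Fin d) =>
    |(g (u[j]'(hu ▸ j.2)) i : ℝ) - (h (w[j]'(hw ▸ j.2)) i : ℝ)| ^ p)]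
  refine Fintype.sum_equiv finProdFinEquiv.symm _ _ fun i => ?_
  have h1 : (i.divNat : ℕ) < u.length := hu ▸ i.divNat.2
  have h2 : (i.divNat : ℕ) < w.length := hw ▸ i.divNat.2
  simp only [realize, finProdFinEquiv_symm_apply, List.getElem?_eq_getElem h1,
    List.getElem?_eq_getElem h2, Option.elim]
  rfl

variable {D K z y d : ℕ} {p lam e b : ℝ}
  {PA : Finset (Color D) × Color D → Fin d → ℚ} {PB : Finset (Color D) → Fin d → ℚ}

/-- The distances between the vectors reflect the inclusions among the padded sets. -/
def IsGadget (p lam e b : ℝ) (z y : ℕ) (PA : Finset (Color D) × Color D → Fin d → ℚ)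
    (PB : Finset (Color D) → Fin d → ℚ) : Prop :=
  ∀ (A : Finset (Color D)) (x : Color D) (B : Finset (Color D)), A.card ≤ z → B.card ≤ y →
    (padSet z y B ⊆ padSet z z A →
      powDist p (fun i => (PA (A, x) i : ℝ)) (fun i => (PB B i : ℝ)) ≤ b * (1 + e)) ∧
    b * (1 - e) ≤ powDist p (fun i => (PA (A, x) i : ℝ)) (fun i => (PB B i : ℝ)) ∧
    (¬ padSet z y B ⊆ padSet z z A →
      b * lam ^ p * (1 - e) ≤ powDist p (fun i => (PA (A, x) i : ℝ)) (fun i => (PB B i : ℝ)))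

/-- The point of an edge and a copy. -/
def pointVec (PA : Finset (Color D) × Color D → Fin d → ℚ) (K : ℕ) (I : JCInstance z)
    (T : Finset (Fin I.n)) (w : List (Color D)) : Fin (wordLen K (vectors I) * d) → ℚ :=
  realize PA (wordLen K (vectors I)) ((profWord D K I T).zip w)

/-- The candidate center of a set. -/
def centerVec (PB : Finset (Color D) → Fin d → ℚ) (K : ℕ) (I : JCInstance z)
    (S : Finset (Fin I.n)) : Fin (wordLen K (vectors I) * d) → ℚ :=
  realize PB (wordLen K (vectors I)) (profWord D K I S)

theorem length_of_mem_copyWords {vecs : List (List Bool)} {w : List (Color D)}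
    (hw : w ∈ copyWords D K vecs) : w.length = wordLen K vecs := by
  simp only [copyWords, List.mem_map] at hw
  obtain ⟨x, hx, rfl⟩ := hw
  exact length_of_mem_book (List.of_mem_zip hx).2

/-! ### Distances between points and candidate centers -/

section Distances

variable (hg : IsGadget p lam e b z y PA PB) (I : JCInstance z) {S T : Finset (Fin I.n)}
  {w : List (Color D)}

theorem powDist_point_center (S T : Finset (Fin I.n)) (hw : w.length = wordLen K (vectors I)) :
    powDist p (fun i => (pointVec PA K I T w i : ℝ)) (fun i => (centerVec PB K I S i : ℝ)) =
      ∑ j : Fin (wordLen K (vectors I)),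
        powDist p (fun i => (PA (T.image (col D K I j), w[j]) i : ℝ))
          (fun i => (PB (S.image (col D K I j)) i : ℝ)) := by
  rw [pointVec, centerVec, powDist_realize p PA PB
    (by rw [List.length_zip, length_profWord, hw, Nat.min_self]) (length_profWord I S)]
  simp [profWord]

include hg

theorem powDist_le_of_subset (hT : T.card = z) (hS : S.card = y) (h : S ⊆ T)
    (hw : w.length = wordLen K (vectors I)) :
    powDist p (fun i => (pointVec PA K I T w i : ℝ)) (fun i => (centerVec PB K I S i : ℝ)) ≤
      wordLen K (vectors I) * (b * (1 + e)) := by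
  rw [powDist_point_center I S T hw]
  refine (Finset.sum_le_card_nsmul _ _ (b * (1 + e)) fun j _ => ?_).trans (by simp)
  exact (hg _ _ _ (Finset.card_image_le.trans hT.le) (Finset.card_image_le.trans hS.le)).1
    (padSet_image_subset _ h hT hS)

theorem le_powDist (hT : T.card = z) (hS : S.card ≤ y)
    (hw : w.length = wordLen K (vectors I)) :
    wordLen K (vectors I) * (b * (1 - e)) ≤
      powDist p (fun i => (pointVec PA K I T w i : ℝ)) (fun i => (centerVec PB K I S i : ℝ)) := by
  rw [powDist_point_center I S T hw]
  refine le_trans (by simp) (Finset.card_nsmul_le_sum _ _ (b * (1 - e)) fun j _ => ?_)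
  exact (hg _ _ _ (Finset.card_image_le.trans hT.le) (Finset.card_image_le.trans hS)).2.1

/-- All but a fraction `e` of the positions color $S\cup T$ injectively, and at these the padded
sets are not included. The remaining positions are bounded below by zero. -/
theorem le_powDist_of_not_subset (hy : y ≤ z) (hD : 0 < D) (hK : 0 < K) (hb : 0 ≤ b)
    (hlam : 0 ≤ lam) (he : e ≤ 1) (hDe : ((2 * z : ℕ) : ℝ) ^ 2 ≤ e * D) (hT : T.card = z)
    (hS : S.card ≤ y) (h : ¬ (S ⊆ T ∧ S.card = y)) (hw : w.length = wordLen K (vectors I)) :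
    wordLen K (vectors I) * (1 - e) * (b * lam ^ p * (1 - e)) ≤
      powDist p (fun i => (pointVec PA K I T w i : ℝ)) (fun i => (centerVec PB K I S i : ℝ)) := by
  classical
  have hbad := card_not_injOn hD hK I (S ∪ T)
  have hcard : (S ∪ T).card ≤ 2 * z := (Finset.card_union_le _ _).trans (by omega)
  set l := wordLen K (vectors I) with hl
  have hpos : 0 ≤ b * lam ^ p * (1 - e) :=
    mul_nonneg (mul_nonneg hb (Real.rpow_nonneg hlam _)) (by linarith)
  set m := ((Finset.range l).filter fun j => ¬ Set.InjOn (col D K I j)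
    (S ∪ T : Finset (Fin I.n))).card with hm
  -- The bad positions are at most a fraction $(2z)^2/D\le e$ of all.
  have hme : (m : ℝ) ≤ e * l := by
    have h1 : m * D ≤ (2 * z) ^ 2 * l :=
      hbad.trans (Nat.mul_le_mul_right _ (Nat.pow_le_pow_left hcard 2))
    have h2 : (m : ℝ) * D ≤ ((2 * z : ℕ) : ℝ) ^ 2 * l := by exact_mod_cast h1
    have h3 : ((2 * z : ℕ) : ℝ) ^ 2 * l ≤ e * D * l :=
      mul_le_mul_of_nonneg_right hDe (Nat.cast_nonneg _)
    have hD' : (0 : ℝ) < D := by exact_mod_cast hD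
    refine le_of_mul_le_mul_right ?_ hD'
    calc (m : ℝ) * D ≤ e * D * l := h2.trans h3
      _ = e * l * D := by ring
  have hgood : (((Finset.range l).filter fun j => Set.InjOn (col D K I j)
      (S ∪ T : Finset (Fin I.n))).card : ℝ) = l - m := by
    rw [eq_sub_iff_add_eq, hm]
    have := Finset.card_filter_add_card_filter_not (s := Finset.range l)
      (fun j => Set.InjOn (col D K I j) (S ∪ T : Finset (Fin I.n)))
    rw [Finset.card_range] at this
    exact_mod_cast this
  rw [powDist_point_center I S T hw]
  have key : ∀ j : Fin l, (if Set.InjOn (col D K I j) (S ∪ T : Finset (Fin I.n))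
      then b * lam ^ p * (1 - e) else 0) ≤
      powDist p (fun i => (PA (T.image (col D K I j), w[j]) i : ℝ))
          (fun i => (PB (S.image (col D K I j)) i : ℝ)) := by
    intro j
    split_ifs with hj
    · refine (hg _ _ _ (Finset.card_image_le.trans hT.le)
        (Finset.card_image_le.trans hS)).2.2 fun hsub => h ?_
      exact subset_of_padSet_image_subset hj hT hS hy hsub
    · exact powDist_nonneg _ _ _
  refine le_trans ?_ (Finset.sum_le_sum fun j _ => key j)
  rw [Fin.sum_univ_eq_sum_range (fun j => if Set.InjOn (col D K I j)
    (S ∪ T : Finset (Fin I.n)) then b * lam ^ p * (1 - e) else 0) l, ← Finset.sum_filter,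
    Finset.sum_const, nsmul_eq_mul, hgood]
  exact mul_le_mul_of_nonneg_right (by linarith) hpos

end Distances

/-! ### Points, centers and cost of the reduced instance -/

section Sets

theorem card_reduce_C_le (I : JCInstance z) : (reduce K y PA PB I).C.card ≤ I.n ^ y := by
  change (((centerWords D K (vectors I) y).map
    (realize PB (wordLen K (vectors I)))).dedup).length ≤ _
  refine (List.dedup_sublist _).length_le.trans ?_
  rw [List.length_map, centerWords]
  refine (length_greedy_le _ _).trans ?_
  rw [length_tupleProfiles]
  refine Nat.pow_le_pow_left ?_ y
  rw [vertexWords, List.length_map, List.length_zip, headD_vectors_length]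
  exact Nat.min_le_left _ _

variable (hPA : Function.Injective PA) (hPB : Function.Injective PB) (hz : 0 < z)
  (hD : (2 * z) ^ 2 < D) (hK : 0 < K) (I : JCInstance z)
include hD hK

theorem reduce_points (hPA : Function.Injective PA) (hz : 0 < z) :
    (reduce K y PA PB I).points = I.edges.flatMap fun T =>
      (copyWords D K (vectors I)).map (pointVec PA K I T) := by
  change ((pointWords D K (vectors I)).map (realize PA (wordLen K (vectors I)))).dedup = _
  rw [(nodup_map_realize_points hPA (nodup_pointWords hD hK hz I)).dedup,
    pointWords_eq (by omega) hK, List.map_flatMap]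
  simp only [List.map_map]
  rfl

theorem card_reduce_P (hPA : Function.Injective PA) (hz : 0 < z) :
    (reduce K y PA PB I).P.card = I.edges.length * (I.n * K) := by
  refine (congrArg List.length (reduce_points hD hK I hPA hz)).trans ?_
  change List.length (α := Fin (wordLen K (vectors I) * d) → ℚ) _ = _
  simp [List.length_flatMap, length_copyWords (K := K) (show 0 < D by omega)]

theorem mem_reduce_P (hPA : Function.Injective PA) (hz : 0 < z)
    {a : Fin (wordLen K (vectors I) * d) → ℚ} :
    a ∈ (reduce K y PA PB I).P ↔
      ∃ T ∈ I.edges, ∃ w ∈ copyWords D K (vectors I), pointVec PA K I T w = a := by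
  have h : a ∈ I.edges.flatMap (fun T =>
      (copyWords D K (vectors I)).map (pointVec PA K I T)) ↔
      ∃ T ∈ I.edges, ∃ w ∈ copyWords D K (vectors I), pointVec PA K I T w = a := by simp
  rw [← h]
  exact iff_of_eq (congrArg (a ∈ ·) (reduce_points (y := y) (PB := PB) hD hK I hPA hz))

theorem exists_of_mem_reduce_C {a : Fin (wordLen K (vectors I) * d) → ℚ}
    (h : a ∈ (reduce K y PA PB I).C) :
    ∃ S : Finset (Fin I.n), S.card ≤ y ∧ a = centerVec PB K I S := by
  change a ∈ ((centerWords D K (vectors I) y).map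
    (realize PB (wordLen K (vectors I)))).dedup at h
  rw [List.mem_dedup, List.mem_map] at h
  obtain ⟨A, hA, rfl⟩ := h
  obtain ⟨S, hS, rfl⟩ := exists_of_mem_centerWords (by omega) hK I hA
  exact ⟨S, hS, rfl⟩

theorem centerVec_mem_reduce_C {S : Finset (Fin I.n)} (hS : S.card = y) :
    centerVec PB K I S ∈ (reduce K y PA PB I).C := by
  change centerVec PB K I S ∈ ((centerWords D K (vectors I) y).map
    (realize PB (wordLen K (vectors I)))).dedup
  rw [List.mem_dedup, List.mem_map]
  exact ⟨_, hS ▸ profWord_mem_centerWords (by omega) hK I S, rfl⟩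

theorem kMedianCost_reduce (hPA : Function.Injective PA) (hz : 0 < z)
    (σ : (Fin (wordLen K (vectors I) * d) → ℚ) → (Fin (wordLen K (vectors I) * d) → ℚ)) :
    kMedianCost p (reduce K y PA PB I) σ =
      ∑ T ∈ I.E, ((copyWords D K (vectors I)).map fun w =>
        lpDist p (fun i => (pointVec PA K I T w i : ℝ))
          (fun i => (σ (pointVec PA K I T w) i : ℝ))).sum := by
  have h : kMedianCost p (reduce K y PA PB I) σ = ((reduce K y PA PB I).points.map fun a =>
      lpDist p (fun i => (a i : ℝ)) (fun i => (σ a i : ℝ))).sum := by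
    rfl
  have h' := congrArg (fun l : List (Fin (wordLen K (vectors I) * d) → ℚ) =>
    (l.map fun a => lpDist p (fun i => (a i : ℝ)) (fun i => (σ a i : ℝ))).sum)
    (reduce_points (y := y) (PB := PB) hD hK I hPA hz)
  refine h.trans (h'.trans ?_)
  rw [List.map_flatMap, List.flatMap, List.sum_flatten,
    List.map_map]
  simp only [List.map_map, Function.comp_def]
  rfl

end Sets

end StackProg

/-! ### Completeness and soundness of the reduction -/

namespace StackProg

variable {D K z y d : ℕ} {p lam e b : ℝ}
  {PA : Finset (Color D) × Color D → Fin d → ℚ} {PB : Finset (Color D) → Fin d → ℚ}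

/-- Each point is sent to the center of a set of the cover that is contained in its edge. -/
theorem exists_clustering (hg : IsGadget p lam e b z y PA PB) (hp : 0 < p)
    (hPA : Function.Injective PA) (hz : 0 < z) (hD : (2 * z) ^ 2 < D) (hK : 0 < K)
    {I : JCInstance z} (hI : I ∈ JCYes z y) :
    ∃ c σ, IsClustering (reduce K y PA PB I) c σ ∧
      kMedianCost p (reduce K y PA PB I) σ ≤ (reduce K y PA PB I).P.card *
        (wordLen K (vectors I) * (b * (1 + e))) ^ (1 / p) := by
  classical
  obtain ⟨S, hS, hcov⟩ := hI
  set R := (wordLen K (vectors I) * (b * (1 + e))) ^ (1 / p) with hR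
  have hex : ∀ a : Fin (wordLen K (vectors I) * d) → ℚ, ∃ v : Fin (wordLen K (vectors I) * d) → ℚ,
      a ∈ (reduce K y PA PB I).P → (∃ j : Fin I.k, centerVec PB K I (S j) = v) ∧
        lpDist p (fun i => (a i : ℝ)) (fun i => (v i : ℝ)) ≤ R := by
    intro a
    by_cases ha : a ∈ (reduce K y PA PB I).P
    · obtain ⟨T, hT, w, hw, rfl⟩ := (mem_reduce_P hD hK I hPA hz).1 ha
      have hTE : T ∈ covAll S I.E := hcov.symm ▸ hT
      obtain ⟨j, _, hj⟩ := Finset.mem_biUnion.1 hTE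
      refine ⟨centerVec PB K I (S j), fun _ => ⟨⟨j, rfl⟩, ?_⟩⟩
      rw [lpDist_eq]
      exact Real.rpow_le_rpow (powDist_nonneg _ _ _) (powDist_le_of_subset hg I (I.uniform T hT)
        (hS j) (Finset.mem_filter.1 hj).2 (length_of_mem_copyWords hw)) (by positivity)
    · exact ⟨0, fun h => absurd h ha⟩
  choose σ hσ using hex
  refine ⟨fun j => centerVec PB K I (S j), σ, ⟨fun j => centerVec_mem_reduce_C hD hK I (hS j),
    fun a ha => (hσ a ha).1⟩, ?_⟩
  exact (Finset.sum_le_card_nsmul _ _ R fun a ha => (hσ a ha).2).trans (nsmul_eq_mul _ _).le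

/-- Every point pays at least `R`, and the copies of an uncovered edge pay at least `lam * R`;
soundness of Coverage bounds the number of covered edges by $\alpha|E|$. -/
theorem le_kMedianCost (hg : IsGadget p lam e b z y PA PB) (hp : 0 < p) (hy : y < z)
    (hPA : Function.Injective PA) (hD : (2 * z) ^ 2 < D) (hK : 0 < K)
    (hb : 0 ≤ b) (hlam : 1 ≤ lam) (he0 : 0 ≤ e) (he : e ≤ 1)
    (hDe : ((2 * z : ℕ) : ℝ) ^ 2 ≤ e * D) {α : ℝ}
    {I : JCInstance z} (hI : I ∈ JCNo α z y)
    {c : Fin I.k → Fin (wordLen K (vectors I) * d) → ℚ}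
    {σ : (Fin (wordLen K (vectors I) * d) → ℚ) → (Fin (wordLen K (vectors I) * d) → ℚ)}
    (hc : IsClustering (reduce K y PA PB I) c σ) :
    (reduce K y PA PB I).P.card * (wordLen K (vectors I) * (1 - e) * (b * (1 - e))) ^ (1 / p) *
      (1 + (1 - α) * (lam - 1)) ≤ kMedianCost p (reduce K y PA PB I) σ := by
  classical
  have hz : 0 < z := by omega
  have hD0 : 0 < D := by omega
  set R := ((wordLen K (vectors I) : ℝ) * (1 - e) * (b * (1 - e))) ^ (1 / p) with hR
  have hbase : 0 ≤ (wordLen K (vectors I) : ℝ) * (1 - e) * (b * (1 - e)) :=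
    mul_nonneg (mul_nonneg (Nat.cast_nonneg _) (by linarith)) (mul_nonneg hb (by linarith))
  have hR0 : 0 ≤ R := Real.rpow_nonneg hbase _
  choose S hS hcS using fun j : Fin I.k => exists_of_mem_reduce_C hD hK I (hc.1 j)
  obtain ⟨S0, hS0⟩ : ∃ S0 : Finset (Fin I.n), S0.card = y := by
    obtain ⟨T, hT⟩ := List.exists_mem_of_ne_nil _ I.nonempty
    obtain ⟨S0, _, h⟩ := Finset.exists_subset_card_eq (hy.le.trans (I.uniform T hT).ge)
    exact ⟨S0, h⟩
  -- A center of a set with fewer than `y` elements is far from every point. It may be replaced by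
  -- an arbitrary `y`-set, which at worst covers more edges.
  set S' : Fin I.k → Finset (Fin I.n) := fun j => if (S j).card = y then S j else S0 with hS'
  have hcov := hI S' fun j => by
    simp only [hS']
    split_ifs with h
    · exact h
    · exact hS0
  have hnear : ∀ T ∈ I.E, ∀ w ∈ copyWords D K (vectors I), ∀ j,
      R ≤ lpDist p (fun i => (pointVec PA K I T w i : ℝ)) (fun i => (c j i : ℝ)) := by
    intro T hT w hw j
    rw [hcS j, lpDist_eq]
    refine Real.rpow_le_rpow hbase (le_trans ?_ (le_powDist hg I (I.uniform T hT) (hS j)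
      (length_of_mem_copyWords hw))) (by positivity)
    refine mul_le_mul_of_nonneg_right ?_ (mul_nonneg hb (by linarith))
    exact mul_le_of_le_one_right (Nat.cast_nonneg _) (by linarith)
  have hfar : ∀ T ∈ I.E, T ∉ covAll S' I.E → ∀ w ∈ copyWords D K (vectors I), ∀ j,
      lam * R ≤ lpDist p (fun i => (pointVec PA K I T w i : ℝ)) (fun i => (c j i : ℝ)) := by
    intro T hT hTn w hw j
    rw [hcS j, lpDist_eq]
    have h1 : lam * R = ((wordLen K (vectors I) : ℝ) * (1 - e) * (b * lam ^ p * (1 - e))) ^ (1 / p) := by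
      have : (wordLen K (vectors I) : ℝ) * (1 - e) * (b * lam ^ p * (1 - e)) =
          lam ^ p * ((wordLen K (vectors I) : ℝ) * (1 - e) * (b * (1 - e))) := by ring
      rw [this, Real.mul_rpow (Real.rpow_nonneg (by linarith) _) hbase,
        ← Real.rpow_mul (by linarith), mul_one_div_cancel hp.ne', Real.rpow_one]
    rw [h1]
    refine Real.rpow_le_rpow (mul_nonneg (mul_nonneg (Nat.cast_nonneg _) (by linarith))
      (mul_nonneg (mul_nonneg hb (Real.rpow_nonneg (by linarith) _)) (by linarith)))
      (le_powDist_of_not_subset hg I hy.le hD0 hK hb (by linarith) he hDe (I.uniform T hT) (hS j)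
      (fun h => hTn ?_) (length_of_mem_copyWords hw)) (by positivity)
    refine Finset.mem_biUnion.2 ⟨j, Finset.mem_univ _, Finset.mem_filter.2 ⟨hT, ?_⟩⟩
    simp only [hS', h.2, if_true]
    exact h.1
  have hσ : ∀ T ∈ I.E, ∀ w ∈ copyWords D K (vectors I), ∃ j, c j = σ (pointVec PA K I T w) :=
    fun T hT w hw => hc.2 _ ((mem_reduce_P hD hK I hPA hz).2 ⟨T, hT, w, hw, rfl⟩)
  have hsum : ∀ T ∈ I.E, (I.n * K : ℕ) * (if T ∈ covAll S' I.E then R else lam * R) ≤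
      ((copyWords D K (vectors I)).map fun w =>
        lpDist p (fun i => (pointVec PA K I T w i : ℝ))
          (fun i => (σ (pointVec PA K I T w) i : ℝ))).sum := by
    intro T hT
    rw [← length_copyWords hD0 I, ← nsmul_eq_mul]
    refine le_trans ?_ (List.card_nsmul_le_sum _
      (if T ∈ covAll S' I.E then R else lam * R) fun x hx => ?_)
    · rw [List.length_map]
    · obtain ⟨w, hw, rfl⟩ := List.mem_map.1 hx
      obtain ⟨j, hj⟩ := hσ T hT w hw
      rw [← hj]
      split_ifs with h
      · exact hnear T hT w hw j
      · exact hfar T hT h w hw j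
  rw [kMedianCost_reduce hD hK I hPA hz, card_reduce_P hD hK I hPA hz]
  refine le_trans ?_ (Finset.sum_le_sum hsum)
  have hsub : covAll S' I.E ⊆ I.E := by
    intro T hT
    obtain ⟨j, _, hj⟩ := Finset.mem_biUnion.1 hT
    exact (Finset.mem_filter.1 hj).1
  have hE : (I.E.card : ℝ) = I.edges.length := rfl
  have hval : ∑ T ∈ I.E, ((I.n * K : ℕ) : ℝ) * (if T ∈ covAll S' I.E then R else lam * R) =
      ((I.n * K : ℕ) : ℝ) * R * ((covAll S' I.E).card +
        (I.E.card - (covAll S' I.E).card) * lam) := by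
    rw [← Finset.mul_sum, Finset.sum_ite, Finset.sum_const, Finset.sum_const,
      Finset.filter_mem_eq_inter, Finset.inter_eq_right.2 hsub]
    have h1 : ((I.E.filter fun T => T ∉ covAll S' I.E).card : ℝ) =
        I.E.card - (covAll S' I.E).card := by
      rw [eq_sub_iff_add_eq, Finset.filter_notMem_eq_sdiff]
      exact_mod_cast Finset.card_sdiff_add_card_eq_card hsub
    rw [nsmul_eq_mul, nsmul_eq_mul, h1]
    ring
  rw [hval]
  -- The difference of the two sides is $(\lambda-1)(\alpha|E|-|\mathrm{cov}|)\ge0$.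
  have h2 : (I.E.card : ℝ) * (1 + (1 - α) * (lam - 1)) ≤ (covAll S' I.E).card +
        (I.E.card - (covAll S' I.E).card) * lam := by
    nlinarith [mul_nonneg (sub_nonneg.2 hlam) (sub_nonneg.2 hcov)]
  calc _ = ((I.n * K : ℕ) : ℝ) * R * ((I.E.card : ℝ) * (1 + (1 - α) * (lam - 1))) := by
        rw [hE]; push_cast; ring
    _ ≤ _ := mul_le_mul_of_nonneg_left h2 (mul_nonneg (Nat.cast_nonneg _) hR0)

end StackProg

/-! ### Hardness of k-median from gap realizations -/

namespace StackProg

/-! ### Number of points, dimension and number of centers -/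

section Size

variable {D K z y d : ℕ} {PA : Finset (Color D) × Color D → Fin d → ℚ}
  {PB : Finset (Color D) → Fin d → ℚ} (hPA : Function.Injective PA) (hz : 0 < z)
  (hD : (2 * z) ^ 2 < D) (hK : 0 < K) (I : JCInstance z)

theorem _root_.JCInstance.n_pos (hz : 0 < z) (I : JCInstance z) : 0 < I.n := by
  obtain ⟨T, hT⟩ := List.exists_mem_of_ne_nil _ I.nonempty
  have h3 := I.uniform T hT
  have h4 := T.card_le_univ
  rw [Fintype.card_fin] at h4
  omega

include hPA hz hD hK

theorem le_card_reduce_P : K ≤ (reduce K y PA PB I).P.card := by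
  rw [card_reduce_P hD hK I hPA hz]
  have h1 := List.length_pos_iff.2 I.nonempty
  have h2 := I.n_pos hz
  exact Nat.le_trans (Nat.le_mul_of_pos_left K h2) (Nat.le_mul_of_pos_left _ h1)

/-- Together with `wordLen_mul_log_le` this pins the word length to $\log_2 N$ up to an additive
one, where $N$ is the number of points. -/
theorem log_card_reduce_P_le :
    Real.log (reduce K y PA PB I).P.card ≤ wordLen K (vectors I) * Real.log 2 := by
  have hpos : 0 < (reduce K y PA PB I).P.card := hK.trans_le (le_card_reduce_P hPA hz hD hK I)
  have h := (lt_two_pow_length_encodeNat (units K (vectors I)).length).le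
  rw [length_units, ← card_reduce_P (y := y) (PB := PB) hD hK I hPA hz] at h
  have hlen : (Computability.encodeNat (reduce K y PA PB I).P.card).length
      = wordLen K (vectors I) := by
    rw [wordLen, bin, length_units, ← card_reduce_P (y := y) (PB := PB) hD hK I hPA hz]
  rw [hlen] at h
  rw [← Real.log_pow]
  exact Real.log_le_log (by exact_mod_cast hpos) (by exact_mod_cast h)

theorem wordLen_mul_log_le : wordLen K (vectors I) * Real.log 2 ≤
    Real.log 2 + Real.log (reduce K y PA PB I).P.card := by
  have hpos : 0 < (reduce K y PA PB I).P.card := hK.trans_le (le_card_reduce_P hPA hz hD hK I)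
  have h := two_pow_length_encodeNat_le hpos
  have hlen : (Computability.encodeNat (reduce K y PA PB I).P.card).length
      = wordLen K (vectors I) := by
    rw [wordLen, bin, length_units, ← card_reduce_P (y := y) (PB := PB) hD hK I hPA hz]
  rw [hlen] at h
  have hpos' : (0 : ℝ) < (reduce K y PA PB I).P.card := by exact_mod_cast hpos
  rw [← Real.log_pow, ← Real.log_mul (by norm_num) hpos'.ne']
  exact Real.log_le_log (by positivity) (by exact_mod_cast h)

/-- The copies ensure $n\le N$, so the at most $n^y$ centers are polynomial in $N$, although the
number of edges alone might be much smaller than $n$. The factor two absorbs the rounding of the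
word length, as $N\ge2$. -/
theorem reduce_bounded (hK2 : 2 ≤ K) : (reduce K y PA PB I).Bounded (2 * d / Real.log 2)
    (Polynomial.X ^ y) := by
  have h2 : 2 ≤ (reduce K y PA PB I).P.card := hK2.trans (le_card_reduce_P hPA hz hD hK I)
  have hl2 : 0 < Real.log 2 := Real.log_pos (by norm_num)
  refine ⟨h2, ?_, ?_⟩
  · have h3 := wordLen_mul_log_le (y := y) (PB := PB) hPA hz hD hK I
    have h4 : Real.log 2 ≤ Real.log (reduce K y PA PB I).P.card :=
      Real.log_le_log (by norm_num) (by exact_mod_cast h2)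
    change ((wordLen K (vectors I) * d : ℕ) : ℝ) ≤ _
    rw [div_mul_eq_mul_div, le_div_iff₀ hl2]
    push_cast
    have h5 : wordLen K (vectors I) * Real.log 2 ≤
      2 * Real.log (reduce K y PA PB I).P.card := by linarith
    have h6 := mul_le_mul_of_nonneg_right h5 (Nat.cast_nonneg (α := ℝ) d)
    linarith
  · refine (card_reduce_C_le I).trans ?_
    rw [Polynomial.eval_pow, Polynomial.eval_X]
    refine Nat.pow_le_pow_left ?_ y
    rw [card_reduce_P hD hK I hPA hz]
    exact Nat.le_trans (Nat.le_mul_of_pos_right _ hK)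
      (Nat.le_mul_of_pos_left _ (List.length_pos_iff.2 I.nonempty))

end Size

variable {z y : ℕ} {p lam α : ℝ}

/-- Gap realizations of all large Johnson graphs turn hardness of Johnson Coverage into hardness
of k-median. -/
theorem kMedianNPHardWithin_of_gapRealizable (hp : 1 ≤ p) (hyz : y < z) (hlam : 1 ≤ lam)
    (h : ∀ D : ℕ, GapRealizable p (johnsonAdj (4 ^ D + z) z y) lam)
    (hJ : JohnsonCoverageNPHard α z y) {ε : ℝ} (hε : 0 < ε) :
    KMedianNPHardWithin p (1 + (1 - α) * (lam - 1) - ε) := by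
  set Z := 1 + (1 - α) * (lam - 1) with hZ
  have hp0 : 0 < p := by linarith
  have hz : 0 < z := by omega
  -- All losses combine to a factor of at least $1-4e$, so $4e|Z|\le\varepsilon$ has to hold; adding
  -- one avoids division by zero.
  obtain ⟨e, he0, he1, heε⟩ : ∃ e : ℝ, 0 < e ∧ e ≤ 1 / 2 ∧ 4 * e * (|Z| + 1) ≤ ε := by
    have hZ1 : 0 < |Z| + 1 := by positivity
    refine ⟨min (1 / 2) (ε / (4 * (|Z| + 1))), by positivity, min_le_left _ _, ?_⟩
    calc 4 * min (1 / 2) (ε / (4 * (|Z| + 1))) * (|Z| + 1)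
        ≤ 4 * (ε / (4 * (|Z| + 1))) * (|Z| + 1) := by gcongr; exact min_le_right _ _
      _ = ε := by field_simp
  obtain ⟨D, hD⟩ := exists_nat_gt (((2 * z : ℕ) : ℝ) ^ 2 / e)
  have hDe : ((2 * z : ℕ) : ℝ) ^ 2 < e * D := by rwa [div_lt_iff₀' he0] at hD
  have hD' : (2 * z) ^ 2 < D := by
    have h1 : e * (D : ℝ) ≤ 1 * D := by gcongr; linarith
    have h2 := hDe.trans_le h1
    rw [one_mul] at h2
    exact_mod_cast h2
  -- With $K=2^m$ copies per vertex, $\log N\ge m\log2$, and $em>1$ makes the rounding term $\log2$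
  -- at most $e\log N$.
  obtain ⟨m, hm⟩ := exists_nat_gt (1 / e)
  have hme : 1 < e * m := by rwa [div_lt_iff₀' he0] at hm
  have hm1 : 1 ≤ m := by
    rcases Nat.eq_zero_or_pos m with rfl | h
    · simp at hme; linarith
    · exact h
  have hK2 : 2 ≤ 2 ^ m := by
    calc 2 = 2 ^ 1 := rfl
      _ ≤ 2 ^ m := Nat.pow_le_pow_right (by norm_num) hm1
  have hK : 0 < 2 ^ m := by positivity
  obtain ⟨d, PA, PB, b, hb, hPA, hPB, hg⟩ := exists_gadget hp hyz.le hlam (h D) he0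
  have hg : IsGadget p lam e b z y PA PB := hg
  have hl2 : 0 < Real.log 2 := Real.log_pos (by norm_num)
  -- One factor $1+e$ comes from the gadget, the other from the rounding of the word length.
  set r := b * (1 + e) * (1 + e) / Real.log 2 with hr
  have hr0 : 0 < r := by positivity
  refine ⟨2 * d / Real.log 2, Polynomial.X ^ y, r ^ (1 / p), by positivity, fun L hL => ?_⟩
  obtain ⟨f, hf, hyes, hno⟩ := hJ L hL
  refine ⟨fun x => reduce (2 ^ m) y PA PB (f x), polyTime_comp hf
    (PF.reduceString (2 ^ m) y PA PB) fun I => reduceString_encode _ (by omega) hPA hPB I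
      (nodup_pointWords hD' hK hz I), fun x hx => ?_, fun x hx => ?_⟩
  · refine ⟨reduce_bounded hPA hz hD' hK _ hK2, ?_⟩
    obtain ⟨c, σ, hc, hcost⟩ := exists_clustering hg hp0 hPA hz hD' hK (hyes x hx)
    refine ⟨c, σ, hc, hcost.trans ?_⟩
    set N := (reduce (2 ^ m) y PA PB (f x)).P.card with hN
    have hKN : 2 ^ m ≤ N := le_card_reduce_P hPA hz hD' hK (f x)
    have h1 : wordLen (2 ^ m) (vectors (f x)) * Real.log 2 ≤ Real.log 2 + Real.log N :=
      wordLen_mul_log_le (y := y) (PB := PB) hPA hz hD' hK (f x)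
    have h2 : m * Real.log 2 ≤ Real.log N := by
      rw [← Real.log_pow]
      exact Real.log_le_log (by positivity) (by exact_mod_cast hKN)
    have hLN : 0 ≤ Real.log N := le_trans (by positivity) h2
    have h3 : wordLen (2 ^ m) (vectors (f x)) * Real.log 2 ≤ (1 + e) * Real.log N := by
      have h4 := mul_le_mul_of_nonneg_left h2 he0.le
      have h5 := mul_le_mul_of_nonneg_right hme.le hl2.le
      nlinarith
    have h6 : (wordLen (2 ^ m) (vectors (f x)) : ℝ) * (b * (1 + e)) ≤ r * Real.log N := by
      rw [hr, div_mul_eq_mul_div, le_div_iff₀ hl2]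
      have := mul_le_mul_of_nonneg_left h3 (show 0 ≤ b * (1 + e) by positivity)
      linarith
    rw [mul_comm (r ^ (1 / p)), mul_assoc, ← Real.mul_rpow hr0.le hLN]
    exact mul_le_mul_of_nonneg_left (Real.rpow_le_rpow (by positivity) h6 (by positivity))
      (Nat.cast_nonneg _)
  · refine ⟨reduce_bounded hPA hz hD' hK _ hK2, fun c σ hc => ?_⟩
    have hcost := le_kMedianCost hg hp0 hyz hPA hD' hK hb.le hlam he0.le (by linarith) hDe.le
      (hno x hx) hc
    set N := (reduce (2 ^ m) y PA PB (f x)).P.card with hN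
    have hKN : 2 ^ m ≤ N := le_card_reduce_P hPA hz hD' hK (f x)
    have hLN : 0 ≤ Real.log N := Real.log_natCast_nonneg N
    have hLl : Real.log N ≤ wordLen (2 ^ m) (vectors (f x)) * Real.log 2 :=
      log_card_reduce_P_le (y := y) (PB := PB) hPA hz hD' hK (f x)
    -- This is the ratio of the lower bound $b(1-e)^2$ to the upper bound $b(1+e)^2$ before the
    -- root. Since $p\ge1$, the root only brings it closer to one.
    set κ := ((1 - e) / (1 + e)) ^ 2 with hκ
    have hq0 : 0 ≤ (1 - e) / (1 + e) := div_nonneg (by linarith) (by linarith)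
    have hq1 : (1 - e) / (1 + e) ≤ 1 := (div_le_one (by linarith)).2 (by linarith)
    have hκ0 : 0 ≤ κ := sq_nonneg _
    have hκ1 : κ ≤ 1 := pow_le_one₀ hq0 hq1
    have hκ4 : 1 - 4 * e ≤ κ := by
      rw [hκ, div_pow, le_div_iff₀ (by positivity)]
      nlinarith [mul_pos he0 he0, mul_pos (mul_pos he0 he0) he0]
    have hFZ : Z - ε ≤ κ * Z := by
      have h1 : (1 - κ) * Z ≤ 4 * e * (|Z| + 1) :=
        calc (1 - κ) * Z ≤ (1 - κ) * |Z| :=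
              mul_le_mul_of_nonneg_left (le_abs_self _) (by linarith)
          _ ≤ 4 * e * (|Z| + 1) := by
              refine mul_le_mul (by linarith) (by linarith) (abs_nonneg _) (by linarith)
      linarith
    have hκr : κ * (r ^ (1 / p) * Real.log N ^ (1 / p)) ≤
        (wordLen (2 ^ m) (vectors (f x)) * (1 - e) * (b * (1 - e))) ^ (1 / p) := by
      have h1 : κ = (κ ^ p) ^ (1 / p) := by
        rw [← Real.rpow_mul hκ0, mul_one_div_cancel hp0.ne', Real.rpow_one]
      rw [← Real.mul_rpow hr0.le hLN, h1, ← Real.mul_rpow (Real.rpow_nonneg hκ0 _) (by positivity)]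
      refine Real.rpow_le_rpow (by positivity) ?_ (by positivity)
      have h2 : κ ^ p ≤ κ := by
        calc κ ^ p ≤ κ ^ (1 : ℝ) := Real.rpow_le_rpow_of_exponent_ge' hκ0 hκ1 (by norm_num) hp
          _ = κ := Real.rpow_one _
      calc κ ^ p * (r * Real.log N)
          ≤ κ * (r * (wordLen (2 ^ m) (vectors (f x)) * Real.log 2)) := by gcongr
        _ = _ := by
          rw [hκ, hr]
          field_simp
    -- For large $\alpha$ the number `Z` may be negative; the bound is then trivial because costs
    -- are nonnegative.
    rcases le_or_gt Z 0 with hZ0 | hZ0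
    · have h1 : (Z - ε) * (r ^ (1 / p) * N * Real.log N ^ (1 / p)) ≤ 0 :=
        mul_nonpos_of_nonpos_of_nonneg (by linarith) (by positivity)
      exact h1.trans (Finset.sum_nonneg fun _ _ => lpDist_nonneg _ _ _)
    · refine le_trans ?_ hcost
      calc (Z - ε) * (r ^ (1 / p) * N * Real.log N ^ (1 / p))
          ≤ κ * Z * (r ^ (1 / p) * N * Real.log N ^ (1 / p)) := by gcongr
        _ = N * (κ * (r ^ (1 / p) * Real.log N ^ (1 / p))) * Z := by ring
        _ ≤ _ := by gcongr

end StackProg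

/-! ### Gap numbers of Johnson graphs -/

namespace StackProg

variable {p : ℝ}

theorem lpDist_comm (p : ℝ) {d : ℕ} (a b : Fin d → ℝ) : lpDist p a b = lpDist p b a := by
  simp only [lpDist, abs_sub_comm]

theorem lpDist_triangle (hp : 1 ≤ p) {d : ℕ} (a b c : Fin d → ℝ) :
    lpDist p a c ≤ lpDist p a b + lpDist p b c := by
  simpa [lpDist] using
    Real.Lp_add_le Finset.univ (fun i => a i - b i) (fun i => b i - c i) hp

theorem _root_.GapRealizable.mono {A B : Type} {Adj : A → B → Prop} {lam lam' : ℝ}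
    (h : GapRealizable p Adj lam) (hl : lam' ≤ lam) : GapRealizable p Adj lam' := by
  obtain ⟨d, τA, τB, β, hβ, h1, h2⟩ := h
  exact ⟨d, τA, τB, β, hβ, h1, fun u v hn =>
    (mul_le_mul_of_nonneg_right hl hβ.le).trans (h2 u v hn)⟩

theorem gapRealizable_one {A B : Type} (Adj : A → B → Prop) : GapRealizable p Adj 1 :=
  ⟨1, fun _ _ => 0, fun _ _ => 1, 1, one_pos, fun _ _ _ => by simp [lpDist],
    fun _ _ _ => by simp [lpDist]⟩

theorem le_gapNumber {A B : Type} {Adj : A → B → Prop} {lam : ℝ} (hlam : 1 ≤ lam)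
    (h : GapRealizable p Adj lam) : ENNReal.ofReal lam ≤ gapNumber p Adj :=
  le_iSup₂_of_le lam ⟨hlam, h⟩ le_rfl

/-- The supremum need not be attained, but everything strictly below it is realizable since
realizability passes to smaller gaps. -/
theorem gapRealizable_of_lt_gapNumber {A B : Type} {Adj : A → B → Prop} {lam : ℝ}
    (h : ENNReal.ofReal lam < gapNumber p Adj) : GapRealizable p Adj lam := by
  obtain ⟨lam', h'⟩ := lt_iSup_iff.1 h
  obtain ⟨⟨_, hr⟩, hlt⟩ := lt_iSup_iff.1 h'
  exact hr.mono (ENNReal.ofReal_lt_ofReal_iff'.1 hlt).1.le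

/-- The gap number of `J(Δ + 2, Δ + 1, 1)` is at most three, by a path of length three between
the ends of a non-edge. -/
theorem gapNumber_le_three (hp : 1 ≤ p) {Δ : ℕ} (hΔ : 1 ≤ Δ) :
    gapNumber p (johnsonAdj (Δ + 2) (Δ + 1) (Δ + 1 - Δ)) ≤ 3 := by
  refine iSup₂_le fun lam h => ?_
  obtain ⟨_, d, τA, τB, β, hβ, hedge, hnon⟩ := h
  have hcA : ∀ a : Fin (Δ + 2), ({a}ᶜ : Finset (Fin (Δ + 2))).card = Δ + 1 := fun a => by
    rw [Finset.card_compl, Finset.card_singleton, Fintype.card_fin]; omega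
  have hcB : ∀ a : Fin (Δ + 2), ({a} : Finset (Fin (Δ + 2))).card = Δ + 1 - Δ := fun a => by
    rw [Finset.card_singleton]; omega
  have hadj : ∀ a b : Fin (Δ + 2), johnsonAdj (Δ + 2) (Δ + 1) (Δ + 1 - Δ) ⟨{a}ᶜ, hcA a⟩
      ⟨{b}, hcB b⟩ ↔ b ≠ a := fun a b => by simp [johnsonAdj, eq_comm]
  -- The path is $\{x\}^c,\{y\},\{w\}^c,\{x\}$; its ends form a non-edge. The three distinct
  -- elements exist because $\Delta\ge1$.
  obtain ⟨x, y, w, hxy, hxw, hyw⟩ : ∃ x y w : Fin (Δ + 2), x ≠ y ∧ x ≠ w ∧ y ≠ w :=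
    ⟨⟨0, by omega⟩, ⟨1, by omega⟩, ⟨2, by omega⟩, by simp [Fin.ext_iff]⟩
  have h1 := hnon _ _ (mt (hadj x x).1 (by simp))
  have h2 := hedge _ _ ((hadj x y).2 hxy.symm)
  have h3 := hedge _ _ ((hadj w y).2 hyw)
  have h4 := hedge _ _ ((hadj w x).2 hxw)
  have h5 := lpDist_triangle hp (τA ⟨{x}ᶜ, hcA x⟩) (τB ⟨{y}, hcB y⟩) (τB ⟨{x}, hcB x⟩)
  have h6 := lpDist_triangle hp (τB ⟨{y}, hcB y⟩) (τA ⟨{w}ᶜ, hcA w⟩) (τB ⟨{x}, hcB x⟩)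
  rw [lpDist_comm p (τB _) (τA _)] at h6
  have h7 : lam * β ≤ 3 * β := by linarith
  have h8 : lam ≤ 3 := le_of_mul_le_mul_right h7 hβ
  calc ENNReal.ofReal lam ≤ ENNReal.ofReal 3 := ENNReal.ofReal_le_ofReal h8
    _ = 3 := by norm_num

/-- The indicator vectors of `J(q, t, t - 1)` in `ℓ_p`. -/
theorem gapRealizable_indicator (hp : 0 < p) {q t : ℕ} (ht : 1 ≤ t) :
    GapRealizable p (johnsonAdj q t (t - 1)) (3 ^ (1 / p)) := by
  classical
  have key : ∀ T S : Finset (Fin q), lpDist p (fun i => if i ∈ T then (1 : ℝ) else 0)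
      (fun i => if i ∈ S then (1 : ℝ) else 0) =
        (((T \ S).card + (S \ T).card : ℕ) : ℝ) ^ (1 / p) := by
    intro T S
    rw [lpDist]
    congr 1
    have : ∀ i : Fin q, |(if i ∈ T then (1 : ℝ) else 0) - (if i ∈ S then (1 : ℝ) else 0)| ^ p =
        (if i ∈ T \ S then (1 : ℝ) else 0) + (if i ∈ S \ T then (1 : ℝ) else 0) := by
      intro i
      by_cases h1 : i ∈ T <;> by_cases h2 : i ∈ S <;> simp [h1, h2, Real.zero_rpow hp.ne']
    rw [Finset.sum_congr rfl fun i _ => this i, Finset.sum_add_distrib]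
    simp only [Finset.sum_boole, Finset.filter_univ_mem, Nat.cast_add]
  have hcard : ∀ T S : Finset (Fin q), T.card + (S \ T).card = S.card + (T \ S).card := by
    intro T S
    rw [Nat.add_comm, Finset.card_sdiff_add_card, Nat.add_comm, Finset.card_sdiff_add_card,
      Finset.union_comm]
  refine ⟨q, fun T i => if i ∈ T.1 then 1 else 0, fun S i => if i ∈ S.1 then 1 else 0, 1, one_pos,
    fun T S h => ?_, fun T S h => ?_⟩
  · have h0 := hcard T.1 S.1
    have h1 : (S.1 \ T.1).card = 0 := by
      rw [Finset.card_eq_zero, Finset.sdiff_eq_empty_iff_subset]; exact h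
    have h2 := T.2
    have h3 := S.2
    rw [key, show (T.1 \ S.1).card + (S.1 \ T.1).card = 1 by omega]
    simp
  · have h0 := hcard T.1 S.1
    have h1 : 0 < (S.1 \ T.1).card := by
      rw [Nat.pos_iff_ne_zero, Ne, Finset.card_eq_zero, Finset.sdiff_eq_empty_iff_subset]; exact h
    have h2 := T.2
    have h3 := S.2
    rw [key, mul_one]
    refine Real.rpow_le_rpow (by norm_num) ?_ (by positivity)
    -- A non-edge has $|S\setminus T|\ge1$, and $|T\setminus S|$ is larger by one, so the symmetric
    -- difference has at least three elements, as opposed to one for an edge.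
    exact_mod_cast (show 3 ≤ (T.1 \ S.1).card + (S.1 \ T.1).card by omega)

/-! ### The constants `gammaGap` -/

section Gamma

variable {Δ : ℕ}

/-- Besides the bound itself, this shows that the infimum is finite, so that `toReal` in `gammaGap`
loses nothing. -/
theorem iInf_gapNumber_le_three (hp : 1 ≤ p) (hΔ : 1 ≤ Δ) :
    (⨅ (q : ℕ) (t : ℕ) (_ : Δ + 1 ≤ t ∧ t ≤ q), gapNumber p (johnsonAdj q t (t - Δ))) ≤ 3 :=
  iInf_le_of_le (Δ + 2) (iInf_le_of_le (Δ + 1) (iInf_le_of_le ⟨le_rfl, by omega⟩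
    (gapNumber_le_three hp hΔ)))

theorem gammaGap_le_three (hp : 1 ≤ p) (hΔ : 1 ≤ Δ) : gammaGap p Δ ≤ 3 :=
  ENNReal.toReal_mono (by norm_num) (iInf_gapNumber_le_three hp hΔ)

theorem le_gammaGap (hp : 1 ≤ p) (hΔ : 1 ≤ Δ) {lam : ℝ} (hlam : 1 ≤ lam)
    (h : ∀ q t, Δ + 1 ≤ t → t ≤ q → GapRealizable p (johnsonAdj q t (t - Δ)) lam) :
    lam ≤ gammaGap p Δ :=
  (ENNReal.ofReal_le_iff_le_toReal
    (ne_top_of_le_ne_top (by norm_num) (iInf_gapNumber_le_three hp hΔ))).1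
    (le_iInf fun q => le_iInf fun t => le_iInf fun hqt => le_gapNumber hlam (h q t hqt.1 hqt.2))

theorem one_le_gammaGap (hp : 1 ≤ p) (hΔ : 1 ≤ Δ) : 1 ≤ gammaGap p Δ :=
  le_gammaGap hp hΔ le_rfl fun _ _ _ _ => gapRealizable_one _

theorem gapRealizable_of_lt_gammaGap {lam : ℝ} (hlam : 1 ≤ lam) (h : lam < gammaGap p Δ)
    {q t : ℕ} (ht : Δ + 1 ≤ t) (hq : t ≤ q) : GapRealizable p (johnsonAdj q t (t - Δ)) lam :=
  gapRealizable_of_lt_gapNumber (((ENNReal.ofReal_lt_iff_lt_toReal (by linarith)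
    fun hc => by rw [gammaGap, hc, ENNReal.toReal_top] at h; linarith).2 h).trans_le
      (iInf_le_of_le q (iInf_le_of_le t (iInf_le _ ⟨ht, hq⟩))))

end Gamma

theorem gammaGap_one_one : gammaGap 1 1 = 3 := by
  refine le_antisymm (gammaGap_le_three le_rfl le_rfl)
    (le_gammaGap le_rfl le_rfl (by norm_num) fun q t ht _ => ?_)
  have := gapRealizable_indicator one_pos (q := q) (t := t) (by omega)
  simpa using this

theorem sqrt_three_le_gammaGap_two_one : Real.sqrt 3 ≤ gammaGap 2 1 := by
  refine le_gammaGap one_le_two le_rfl ?_ fun q t ht _ => ?_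
  · rw [Real.one_le_sqrt]; norm_num
  · have := gapRealizable_indicator two_pos (q := q) (t := t) (by omega)
    rwa [← Real.sqrt_eq_rpow] at this

theorem _root_.KMedianNPHardWithin.mono {F F' : ℝ} (h : KMedianNPHardWithin p F) (hF : F' ≤ F) :
    KMedianNPHardWithin p F' := by
  obtain ⟨A, B, ρ, hρ, h⟩ := h
  refine ⟨A, B, ρ, hρ, fun L hL => ?_⟩
  obtain ⟨f, hf, hyes, hno⟩ := h L hL
  refine ⟨f, hf, hyes, fun x hx => ⟨(hno x hx).1, fun c σ hc => ?_⟩⟩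
  refine le_trans (mul_le_mul_of_nonneg_right hF ?_) ((hno x hx).2 c σ hc)
  exact mul_nonneg (by positivity) (Real.rpow_nonneg (Real.log_natCast_nonneg _) _)

/-- For $\alpha<1$ a gap within $\eta$ of $\gamma$ is used, at the price
$(1-\alpha)\eta=\varepsilon/2$; the maximum with one keeps the gap admissible. For $\alpha\ge1$ the
claimed factor is at most $1-\varepsilon$, and the trivial gap one suffices. -/
theorem kMedianNPHardWithin_zetaOne (hp : 1 ≤ p) {α : ℝ} {z y : ℕ} (hy : 1 ≤ y) (hyz : y < z)
    (hJ : JohnsonCoverageNPHard α z y) {ε : ℝ} (hε : 0 < ε) :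
    KMedianNPHardWithin p (zetaOne p (z - y) α - ε) := by
  have hΔ : 1 ≤ z - y := by omega
  have hγ := one_le_gammaGap hp hΔ
  rcases le_or_gt 1 α with hα | hα
  · refine (kMedianNPHardWithin_of_gapRealizable hp hyz le_rfl
      (fun D => gapRealizable_one _) hJ hε).mono ?_
    have : (1 - α) * (gammaGap p (z - y) - 1) ≤ 0 :=
      mul_nonpos_of_nonpos_of_nonneg (by linarith) (by linarith)
    rw [zetaOne]
    linarith
  · set η := ε / (2 * (1 - α)) with hη
    have hα' : 0 < 1 - α := by linarith
    have hη0 : 0 < η := by positivity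
    have hηα : (1 - α) * η = ε / 2 := by rw [hη]; field_simp
    have hreal : ∀ D : ℕ, GapRealizable p (johnsonAdj (4 ^ D + z) z y)
        (max 1 (gammaGap p (z - y) - η)) := by
      intro D
      rcases le_or_gt (gammaGap p (z - y) - η) 1 with h | h
      · rw [max_eq_left h]
        exact gapRealizable_one _
      · rw [max_eq_right h.le]
        have := gapRealizable_of_lt_gammaGap (q := 4 ^ D + z) (t := z) h.le
          (sub_lt_self _ hη0) (by omega) (Nat.le_add_left _ _)
        rwa [Nat.sub_sub_self hyz.le] at this
    refine (kMedianNPHardWithin_of_gapRealizable hp hyz (le_max_left _ _) hreal hJ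
      (half_pos hε)).mono ?_
    have h1 := mul_le_mul_of_nonneg_left (le_max_right 1 (gammaGap p (z - y) - η)) hα'.le
    rw [zetaOne]
    nlinarith

/-- Because $\gamma\le3$, raising $\alpha$ by $\varepsilon/4$ lowers $\zeta_1$ by at most
$\varepsilon/2$; the other half of $\varepsilon$ is spent in the reduction. -/
theorem kMedianNPHardWithin_of_hypothesis (hJ : JohnsonCoverageHypothesis) (hp : 1 ≤ p) {ε : ℝ}
    (hε : 0 < ε) : KMedianNPHardWithin p (zetaOne p 1 (1 - 1 / Real.exp 1) - ε) := by
  obtain ⟨z, hz, h⟩ := hJ (ε / 4) (by positivity)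
  have h1 := kMedianNPHardWithin_zetaOne hp (by omega) (by omega) h (half_pos hε)
  rw [show z - (z - 1) = 1 by omega] at h1
  refine h1.mono ?_
  have h2 := gammaGap_le_three hp le_rfl
  rw [zetaOne, zetaOne]
  nlinarith

theorem lt_one_add_two_div_exp : (1.73 : ℝ) < 1 + 2 / Real.exp 1 := by
  have h := Real.exp_one_lt_d9
  have : (0.73 : ℝ) < 2 / Real.exp 1 := by
    rw [lt_div_iff₀ (Real.exp_pos 1)]; linarith
  linarith

theorem lt_one_add_sqrt_three_sub_one_div_exp :
    (1.269 : ℝ) < 1 + (Real.sqrt 3 - 1) / Real.exp 1 := by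
  have h := Real.exp_one_lt_d9
  have h3 : (1.732 : ℝ) < Real.sqrt 3 := Real.lt_sqrt_of_sq_lt (by norm_num)
  have : (0.269 : ℝ) < (Real.sqrt 3 - 1) / Real.exp 1 := by
    rw [lt_div_iff₀ (Real.exp_pos 1)]; linarith
  linarith

theorem zetaOne_one : zetaOne 1 1 (1 - 1 / Real.exp 1) = 1 + 2 / Real.exp 1 := by
  rw [zetaOne, gammaGap_one_one]
  ring

theorem le_zetaOne_two :
    1 + (Real.sqrt 3 - 1) / Real.exp 1 ≤ zetaOne 2 1 (1 - 1 / Real.exp 1) := by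
  have h := mul_le_mul_of_nonneg_left sqrt_three_le_gammaGap_two_one
    (one_div_pos.2 (Real.exp_pos 1)).le
  rw [zetaOne, div_eq_mul_one_div]
  linarith

end StackProg

/-! ### The main theorem -/

open StackProg in
theorem mainTheorem4 :
    (∀ (p : ℝ), 1 ≤ p → ∀ (α : ℝ) (z y : ℕ), 1 ≤ y → y < z → JohnsonCoverageNPHard α z y →
      ∀ ε : ℝ, 0 < ε → KMedianNPHardWithin p (zetaOne p (z - y) α - ε)) ∧
    (JohnsonCoverageHypothesis →
      (∀ (p : ℝ), 1 ≤ p → ∀ ε : ℝ, 0 < ε →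
        KMedianNPHardWithin p (zetaOne p 1 (1 - 1 / Real.exp 1) - ε)) ∧
      KMedianNPHardWithin 1 1.73 ∧
      (∀ F : ℝ, F < 1 + (Real.sqrt 3 - 1) / Real.exp 1 → KMedianNPHardWithin 2 F)) ∧
    zetaOne 1 1 (1 - 1 / Real.exp 1) = 1 + 2 / Real.exp 1 ∧
    1 + (Real.sqrt 3 - 1) / Real.exp 1 ≤ zetaOne 2 1 (1 - 1 / Real.exp 1) ∧
    (1.73 : ℝ) < 1 + 2 / Real.exp 1 ∧
    (1.269 : ℝ) < 1 + (Real.sqrt 3 - 1) / Real.exp 1 := by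
  refine ⟨fun p hp α z y hy hyz hJ ε hε => kMedianNPHardWithin_zetaOne hp hy hyz hJ hε,
    fun hJ => ⟨fun p hp ε hε => kMedianNPHardWithin_of_hypothesis hJ hp hε, ?_, fun F hF => ?_⟩,
    zetaOne_one, le_zetaOne_two, lt_one_add_two_div_exp, lt_one_add_sqrt_three_sub_one_div_exp⟩
  -- Here $\varepsilon$ is exactly the positive difference between $\zeta_1(1)$ and $1.73$.
  · have := kMedianNPHardWithin_of_hypothesis hJ le_rfl (sub_pos.2 lt_one_add_two_div_exp)
    rwa [zetaOne_one, sub_sub_cancel] at this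
  · have := kMedianNPHardWithin_of_hypothesis hJ one_le_two
      (sub_pos.2 (hF.trans_le le_zetaOne_two))
    rwa [sub_sub_cancel] at this
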